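/- **Setting.** All request sequences are finite, and a (possibly randomized) online algorithm is called $c$-competitive on an instance if there is a constant $a\ge 0$ that does not depend on the request sequence (but may depend on the instance) such that its (expected) cost is at most $c\cdot\mathrm{OPT}(\sigma)+a$ on every request sequence $\sigma$, where $\mathrm{OPT}(\sigma)$ is the optimal offline cost from the same initial state. *Allocation.* An instance is given by $\ell\ge 1$, weights $w_1,\dots,w_\ell>0$ and a starting point $x(0)$ in the simplex $\Delta^{\ell-1}=\{x\in[0,1]^\ell:\sum_i x_i=1\}$. At each time $t=1,2,\dots$ a direction $r_t\in\{1,\dots,\ell\}$ and a cost function $f_t\colon[0,1]\to\mathbb R_{\ge0}\cup\{\infty\}$ are revealed; the algorithm then moves from $x(t-1)$ to $x(t)\in\Delta^{\ell-1}$ and pays $\sum_i w_i|x_i(t)-x_i(t-1)|+f_t(x_{r_t}(t))$. In *soft allocation*, each $f_t$ has the form $f_t(z)=\varepsilon\cdot\mathbf 1_{\{z<c\}}$ with $\varepsilon,c>0$. In *strict allocation*, each $f_t$ has the form $f_t(z)=\infty$ for $z\le c$ and $f_t(z)=0$ for $z>c$, with $c\ge 0$. Online algorithms for allocation are deterministic.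 *Weighted interleaved myopic paging (WIMP) with $\ell$ weight classes.* An instance is given by a finite universe of pages, partitioned into $\ell$ classes (some possibly empty) with pairwise distinct weights $w_1,\dots,w_\ell>0$, a cache size $k\ge 1$ and an initial cache content. At each time a page is requested; it must be in the cache when it is served, the cache never holds more than $k$ pages, and fetching a page of class $i$ into the cache costs $w_i$. At each time the algorithm knows the requests so far and, for any two pages of the same class, which of the two is requested earlier in the future (if either is requested again); it has no other information about future requests. A $c$-competitive algorithm for soft allocation (strict allocation, WIMP) with parameter $\ell$ means one for every instance with this $\ell$. **Theorem.** There is an absolute constant $C$ such that for every $\varphi\colon\mathbb N\to[0,\infty)$ and every $\ell\ge1$: 1. if there is a $\varphi(\ell)$-competitive online algorithm for soft allocation in $\ell$ dimensions, then there is a $C\varphi(\ell)$-competitive randomized algorithm for WIMP with $\ell$ weight classes; 2. if there is a $\varphi(\ell)$-competitive randomized algorithm for WIMP with $\ell$ weight classes, then there is a $C\varphi(\ell)$-competitive online algorithm for strict allocation in $\ell$ dimensions. -/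

import Mathlib

open MeasureTheory
open scoped ENNReal NNReal

namespace MyopicPaging

/-! ### Allocation problems on the simplex -/

/-- The unit simplex `Δ^{ℓ-1} = {x ∈ [0,1]^ℓ : ∑ i, x i = 1}`, as a type. -/
abbrev Simplex (ℓ : ℕ) : Type := stdSimplex ℝ (Fin ℓ)

/-- The `i`-th coordinate of a point of the simplex, as a point of `[0,1]`. -/
def coord {ℓ : ℕ} (x : Simplex ℓ) (i : Fin ℓ) : Set.Icc (0 : ℝ) 1 :=
  ⟨x.1 i, mem_Icc_of_mem_stdSimplex x.2 i⟩

/-- A request of an allocation problem: a direction `r ∈ [ℓ]` and a cost function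
`f : [0,1] → ℝ₊ ∪ {∞}`. -/
structure AllocRequest (ℓ : ℕ) where
  /-- the direction -/
  dir : Fin ℓ
  /-- the cost function -/
  cost : Set.Icc (0 : ℝ) 1 → ℝ≥0∞

/-- Soft thresholds: `f z = ε` for `z < c` and `f z = 0` otherwise, for some `ε, c > 0`. -/
def IsSoftThreshold {ℓ : ℕ} (r : AllocRequest ℓ) : Prop :=
  ∃ ε c : ℝ, 0 < ε ∧ 0 < c ∧
    ∀ z : Set.Icc (0 : ℝ) 1, r.cost z = if (z : ℝ) < c then ENNReal.ofReal ε else 0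

/-- Strict thresholds: `f z = ∞` for `z ≤ c` and `f z = 0` otherwise, for some `c ≥ 0`. -/
def IsStrictThreshold {ℓ : ℕ} (r : AllocRequest ℓ) : Prop :=
  ∃ c : ℝ, 0 ≤ c ∧
    ∀ z : Set.Icc (0 : ℝ) 1, r.cost z = if (z : ℝ) ≤ c then ⊤ else 0

/-- The weighted movement cost `∑ i, w i * |y i - x i|`. -/
noncomputable def moveCost {ℓ : ℕ} (w : Fin ℓ → ℝ) (x y : Simplex ℓ) : ℝ≥0∞ :=
  ENNReal.ofReal (∑ i, w i * |y.1 i - x.1 i|)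

/-- Total cost (movement plus service) on the request sequence `σ` of the trajectory
`x 0, x 1, …`. The request in position `t` of the list (counted from `0`) is served by moving
from `x t` to `x (t + 1)`, and its service cost is charged at the new point. -/
noncomputable def allocCost {ℓ : ℕ} (w : Fin ℓ → ℝ) (σ : List (AllocRequest ℓ))
    (x : ℕ → Simplex ℓ) : ℝ≥0∞ :=
  ∑ t : Fin σ.length,
    (moveCost w (x t) (x (t + 1)) + (σ.get t).cost (coord (x (t + 1)) (σ.get t).dir))

/-- The optimal offline cost on `σ` from the starting point `x₀`. -/
noncomputable def allocOpt {ℓ : ℕ} (w : Fin ℓ → ℝ) (x₀ : Simplex ℓ)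
    (σ : List (AllocRequest ℓ)) : ℝ≥0∞ :=
  ⨅ x : {x : ℕ → Simplex ℓ // x 0 = x₀}, allocCost w σ x.1

/-- There is a `c`-competitive (deterministic) online algorithm for the allocation problem in `ℓ`
dimensions with requests of the given kind: for all positive movement weights and every starting
point there are an online algorithm `A`, which maps the list of requests revealed so far to the
current point, and an additive constant `a`, independent of the request sequence, such that the
cost of `A` is at most `c * OPT + a` on every finite request sequence. -/
def AllocCompetitive (ℓ : ℕ) (kind : AllocRequest ℓ → Prop) (c : ℝ≥0) : Prop :=
  ∀ w : Fin ℓ → ℝ, (∀ i, 0 < w i) → ∀ x₀ : Simplex ℓ,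
    ∃ A : List (AllocRequest ℓ) → Simplex ℓ, A [] = x₀ ∧
      ∃ a : ℝ≥0, ∀ σ : List (AllocRequest ℓ), (∀ r ∈ σ, kind r) →
        allocCost w σ (fun t => A (σ.take t)) ≤ (c : ℝ≥0∞) * allocOpt w x₀ σ + (a : ℝ≥0∞)

/-- There is a `c`-competitive online algorithm for soft allocation in `ℓ` dimensions. -/
def SoftAllocCompetitive (ℓ : ℕ) (c : ℝ≥0) : Prop :=
  AllocCompetitive ℓ IsSoftThreshold c

/-- There is a `c`-competitive online algorithm for strict allocation in `ℓ` dimensions. -/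
def StrictAllocCompetitive (ℓ : ℕ) (c : ℝ≥0) : Prop :=
  AllocCompetitive ℓ IsStrictThreshold c

/-! ### Weighted interleaved myopic paging (WIMP) -/

/-- A weighted paging instance with `ℓ` weight classes: a finite universe of pages, each of which
lies in one of `ℓ` classes with pairwise distinct positive weights, a cache size `k ≥ 1`, and an
initial cache content. -/
structure PagingInstance (ℓ : ℕ) where
  /-- the number of pages in the universe -/
  n : ℕ
  /-- the weight class of a page -/
  cls : Fin n → Fin ℓ
  /-- the weight of each class -/
  weight : Fin ℓ → ℝ
  weight_pos : ∀ i, 0 < weight i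
  weight_injective : Function.Injective weight
  /-- the cache size -/
  k : ℕ
  k_pos : 0 < k
  /-- the initial cache content -/
  init : Finset (Fin n)
  init_card : init.card ≤ k

namespace PagingInstance

variable {ℓ : ℕ} (I : PagingInstance ℓ)

/-- The pages of the universe. -/
abbrev Page : Type := Fin I.n

/-- Given the list `fut` of all future requests, `p` and `q` belong to the same weight class and
the next request to `p` comes before the next request to `q` (if `q` is requested again at all).
Note that `List.idxOf` is the length of the list for pages that do not occur in it. -/
def Earlier (fut : List I.Page) (p q : I.Page) : Prop :=
  I.cls p = I.cls q ∧ fut.idxOf p < fut.idxOf q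

/-- What an algorithm learns in one time step: the requested page, and the relative order of the
pages within each weight class with respect to the time of their next request. -/
abbrev Observation : Type := I.Page × (I.Page → I.Page → Prop)

/-- The observations along a request sequence; the entry at each time shows the page requested at
that time and the order induced by the later requests. -/
def observations : List I.Page → List I.Observation
  | [] => []
  | p :: fut => (p, I.Earlier fut) :: observations fut

/-- The cost of a sequence `S 0, S 1, …, S T` of cache contents: fetching a page into the cache
costs its weight. -/
noncomputable def cost (T : ℕ) (S : ℕ → Finset I.Page) : ℝ≥0∞ :=
  ∑ t ∈ Finset.range T, ∑ p ∈ S (t + 1) \ S t, ENNReal.ofReal (I.weight (I.cls p))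

/-- The caches `S 0, S 1, …` start at the initial content, never hold more than `k` pages, and
contain each requested page at the time of its request. -/
def Serves (σ : List I.Page) (S : ℕ → Finset I.Page) : Prop :=
  S 0 = I.init ∧ ∀ t : Fin σ.length, σ.get t ∈ S (t + 1) ∧ (S (t + 1)).card ≤ I.k

/-- The optimal offline cost of the request sequence `σ`. -/
noncomputable def opt (σ : List I.Page) : ℝ≥0∞ :=
  ⨅ S : {S : ℕ → Finset I.Page // I.Serves σ S}, I.cost σ.length S.1

/-- A deterministic WIMP algorithm: the cache content as a function of all observations made so
far (the last of which belongs to the current request). -/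
structure DetAlgorithm where
  /-- the cache content after the given observations -/
  cache : List I.Observation → Finset I.Page
  cache_nil : cache [] = I.init
  serves : ∀ (h : List I.Observation) (o : I.Observation), o.1 ∈ cache (h ++ [o])
  card_le : ∀ (h : List I.Observation) (o : I.Observation), (cache (h ++ [o])).card ≤ I.k

/-- The cost of a deterministic algorithm on the request sequence `σ`. -/
noncomputable def DetAlgorithm.cost {I : PagingInstance ℓ} (A : I.DetAlgorithm)
    (σ : List I.Page) : ℝ≥0∞ :=
  I.cost σ.length (fun t => A.cache ((I.observations σ).take t))

/-- There is a `c`-competitive randomized WIMP algorithm for the instance `I`: a random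
deterministic algorithm `A ω`, such that the expected cost is at most `c * OPT + a` on every finite
request sequence, with an additive constant `a` independent of the request sequence. -/
def Competitive (c : ℝ≥0) : Prop :=
  ∃ (Ω : Type) (_ : MeasurableSpace Ω) (μ : Measure Ω) (_ : IsProbabilityMeasure μ)
    (A : Ω → I.DetAlgorithm),
    (∀ (h : List I.Observation) (C : Finset I.Page), MeasurableSet {ω | (A ω).cache h = C}) ∧
    ∃ a : ℝ≥0, ∀ σ : List I.Page,
      ∫⁻ ω, (A ω).cost σ ∂μ ≤ (c : ℝ≥0∞) * I.opt σ + (a : ℝ≥0∞)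

end PagingInstance

/-- There is a `c`-competitive randomized algorithm for WIMP with `ℓ` weight classes. -/
def WIMPCompetitive (ℓ : ℕ) (c : ℝ≥0) : Prop :=
  ∀ I : PagingInstance ℓ, I.Competitive c

end MyopicPaging

/-! Both reductions identify a fraction `x i` of the unit mass with `k * x i` cache slots for class
`i`. Within a class the relative order of the next requests is known, so for any given number of
slots farthest-in-future is the right policy. The only real decision is how to divide the slots
among the classes, and that is an allocation problem.

From soft allocation to WIMP. For each class the farthest-in-future caches of all sizes are
maintained at once; they stay nested (`IsChain.step`). A page `p` has a position, the least size
whose cache contains it. A request to `p` becomes a soft threshold at `position / k` with charge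
equal to the weight of `p`, i.e. the price of a fault. A second threshold at `1 / k`, with a charge
that no competitive algorithm can afford (`one_div_le_of_competitive`), ensures that the class of
`p` keeps a slot. Any paging schedule induces an allocation. Its soft cost is at most 6 times the
paging cost plus a constant, by a potential that counts how far the farthest-in-future cache of
equal size lags behind the schedule (`Dominated.change`, `Dominated.serve`, `exists_allocReach`).
Conversely, the fractional online allocation is rounded online to integral slot numbers at an
expected factor 16 (`exists_online_rounding`). The rounding never falls below `⌊k * x i⌋`, hence a
page that causes no soft charge causes no fault (`simCache_step_le`).

The rounding keeps each coordinate on the two integers next to its value, with the right mean, while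
the total is exactly `k`. Weights are grouped by powers of two. The totals of the weight levels come
from rounding tail sums with one random offset, and inside a level units are exchanged between
outcomes until the sum is right (`exists_rounding_sum_eq`). A move of one coordinate disturbs only
its own and lower levels, whose weights form a geometric series.

From WIMP to strict allocation. On a grid of mesh `1 / k`, each class gets `k` numbered pages, and
the demand that class `i` hold more than `j` units becomes repeated rounds of requests to its first
`j + 1` pages, in the order of their numbers. The within-class order of future requests is then
predictable, so the extra information is worthless (`observations_take_append_eq`). Repetition
forces the expected number of pages of the class up to `j` (`exists_rounds`), and the expected
numbers, divided by `k`, form the deterministic fractional allocation (`exists_grid_algorithm`). The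
additive constant still depends on `k`; starting after a nearly worst prefix removes this
(`exists_grid_algorithm_uniform`). Finally `k` tends to infinity along an ultrafilter. Raising the
thresholds by summable amounts keeps the inequalities strict in the limit, and the optimum can
follow at bounded extra cost (`eventually_gridReach`, `strictAllocCompetitive_of_wimp`). -/

namespace MyopicPaging

/-! ### Online rounding of fractional allocations -/

/-- The uniform distribution on the unit interval, as a measure on `ℝ`. -/
noncomputable def unitMeasure : Measure ℝ := volume.restrict (Set.Ico 0 1)

instance : IsProbabilityMeasure unitMeasure :=
  ⟨by simp [unitMeasure]⟩

/-- Subsets of the unit interval can be divided arbitrarily. -/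
lemma exists_subset_unitMeasure_eq {E : Set ℝ} (hE : MeasurableSet E) {δ : ℝ} (h0 : 0 ≤ δ)
    (h1 : δ ≤ unitMeasure.real E) :
    ∃ A ⊆ E, MeasurableSet A ∧ unitMeasure.real A = δ := by
  -- The measure of `E` up to `t` is 1-Lipschitz in `t`, so by the intermediate value theorem some
  -- truncation of `E` has measure `δ`.
  set g : ℝ → ℝ := fun t => unitMeasure.real (E ∩ Set.Iic t) with hg
  have hmono : Monotone g := fun s t hst =>
    measureReal_mono (Set.inter_subset_inter_right _ (Set.Iic_subset_Iic.2 hst))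
  have key : ∀ s t : ℝ, s ≤ t → g t - g s ≤ t - s := by
    intro s t hst
    have h2 : E ∩ Set.Iic t ⊆ (E ∩ Set.Iic s) ∪ Set.Ioc s t := by
      rintro z ⟨hz, hzt⟩
      rcases le_or_gt z s with h | h
      · exact Or.inl ⟨hz, h⟩
      · exact Or.inr ⟨h, hzt⟩
    have h3 : g t ≤ g s + unitMeasure.real (Set.Ioc s t) :=
      (measureReal_mono h2).trans (measureReal_union_le _ _)
    have h4 : unitMeasure.real (Set.Ioc s t) ≤ t - s := by
      rw [measureReal_def]
      refine ENNReal.toReal_le_of_le_ofReal (by linarith) ?_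
      refine (Measure.restrict_apply_le _ _).trans ?_
      simp
    linarith
  have hcont : Continuous g := by
    have : LipschitzWith 1 g := by
      refine LipschitzWith.of_dist_le_mul fun s t => ?_
      rw [Real.dist_eq, Real.dist_eq, NNReal.coe_one, one_mul]
      rcases le_total s t with h | h
      · rw [abs_sub_comm, abs_of_nonneg (sub_nonneg.2 (hmono h)), abs_sub_comm,
          abs_of_nonneg (sub_nonneg.2 h)]
        exact key s t h
      · rw [abs_of_nonneg (sub_nonneg.2 (hmono h)), abs_of_nonneg (sub_nonneg.2 h)]
        exact key t s h
    exact this.continuous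
  have hleft : g (-1) = 0 := by
    have : unitMeasure (E ∩ Set.Iic (-1)) = 0 := by
      rw [unitMeasure, Measure.restrict_apply (hE.inter measurableSet_Iic)]
      convert measure_empty (μ := (volume : Measure ℝ))
      ext z
      simp only [Set.mem_inter_iff, Set.mem_Iic, Set.mem_Ico, Set.mem_empty_iff_false, iff_false]
      rintro ⟨⟨-, h⟩, h', -⟩
      linarith
    simp [hg, measureReal_def, this]
  have hright : g 1 = unitMeasure.real E := by
    have h : unitMeasure (E ∩ Set.Iic 1) = unitMeasure E := by
      rw [unitMeasure, Measure.restrict_apply (hE.inter measurableSet_Iic),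
        Measure.restrict_apply hE]
      congr 1
      ext z
      simp only [Set.mem_inter_iff, Set.mem_Iic, Set.mem_Ico]
      constructor
      · rintro ⟨⟨h, -⟩, h'⟩
        exact ⟨h, h'⟩
      · rintro ⟨h, h'⟩
        exact ⟨⟨h, h'.2.le⟩, h'⟩
    simp [hg, measureReal_def, h]
  obtain ⟨t, -, ht⟩ := intermediate_value_Icc (by norm_num : (-1 : ℝ) ≤ 1) hcont.continuousOn
    (show δ ∈ Set.Icc (g (-1)) (g 1) by rw [hleft, hright]; exact ⟨h0, h1⟩)
  exact ⟨E ∩ Set.Iic t, Set.inter_subset_left, hE.inter measurableSet_Iic, ht⟩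

lemma integrable_intCast {μ : Measure ℝ} [IsFiniteMeasure μ] {X : ℝ → ℤ} (hX : Measurable X)
    {a b : ℤ} (ha : ∀ ω, a ≤ X ω) (hb : ∀ ω, X ω ≤ b) : Integrable (fun ω => (X ω : ℝ)) μ := by
  refine Integrable.of_bound (C := max |(a : ℝ)| |(b : ℝ)|) ?_ ?_
  · exact (measurable_from_top.comp hX).aestronglyMeasurable
  · refine Filter.Eventually.of_forall fun ω => ?_
    exact abs_le_max_abs_abs (by exact_mod_cast ha ω) (by exact_mod_cast hb ω)

lemma integrable_indicator_one {μ : Measure ℝ} [IsFiniteMeasure μ] {A : Set ℝ}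
    (hA : MeasurableSet A) : Integrable (A.indicator fun _ => (1 : ℝ)) μ :=
  (integrable_const 1).indicator hA

lemma integral_indicator_real_one {μ : Measure ℝ} {A : Set ℝ}
    (hA : MeasurableSet A) : ∫ ω, A.indicator (fun _ => (1 : ℝ)) ω ∂μ = μ.real A := by
  rw [integral_indicator hA]
  simp

lemma intCast_indicator_one (A : Set ℝ) (ω : ℝ) :
    ((A.indicator (fun _ => (1 : ℤ)) ω : ℤ) : ℝ) = A.indicator (fun _ => (1 : ℝ)) ω := by
  by_cases h : ω ∈ A <;> simp [h]

/-- A two-valued function can be raised to any admissible mean. -/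
lemma exists_raise {X : ℝ → ℤ} (hX : Measurable X) {lo : ℤ} (hlo : ∀ ω, lo ≤ X ω)
    (hhi : ∀ ω, X ω ≤ lo + 1) {y : ℝ} (h1 : ∫ ω, (X ω : ℝ) ∂unitMeasure ≤ y)
    (h2 : y ≤ lo + 1) :
    ∃ Y : ℝ → ℤ, Measurable Y ∧ (∀ ω, X ω ≤ Y ω) ∧ (∀ ω, Y ω ≤ lo + 1) ∧
      ∫ ω, (Y ω : ℝ) ∂unitMeasure = y := by
  have hE : MeasurableSet {ω | X ω = lo} := hX (measurableSet_singleton lo)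
  have hXi : Integrable (fun ω => (X ω : ℝ)) unitMeasure := integrable_intCast hX hlo hhi
  -- Adding one unit exactly where `X = lo` would already lift the mean to at least `lo + 1 ≥ y`, so
  -- this set is large enough to absorb the missing mass.
  have h3 : y - ∫ ω, (X ω : ℝ) ∂unitMeasure ≤ unitMeasure.real {ω | X ω = lo} := by
    have h4 : (lo : ℝ) + 1 ≤
        ∫ ω, ((X ω : ℝ) + Set.indicator {ω | X ω = lo} (fun _ => (1 : ℝ)) ω) ∂unitMeasure := by
      have : ∫ _ω, ((lo : ℝ) + 1) ∂unitMeasure = (lo : ℝ) + 1 := by simp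
      rw [← this]
      refine integral_mono (integrable_const _) (hXi.add (integrable_indicator_one hE)) ?_
      intro ω
      by_cases h : X ω = lo
      · simp [h]
      · have h5 : lo + 1 ≤ X ω := by have := hlo ω; omega
        have h6 : (lo : ℝ) + 1 ≤ X ω := by exact_mod_cast h5
        simpa [h] using h6
    rw [integral_add hXi (integrable_indicator_one hE), integral_indicator_real_one hE] at h4
    linarith
  obtain ⟨A, hAE, hA, hμ⟩ := exists_subset_unitMeasure_eq hE (sub_nonneg.2 h1) h3
  refine ⟨fun ω => X ω + A.indicator (fun _ => (1 : ℤ)) ω,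
    hX.add (measurable_const.indicator hA), fun ω => ?_, fun ω => ?_, ?_⟩
  · by_cases h : ω ∈ A <;> simp [h]
  · by_cases h : ω ∈ A
    · have : X ω = lo := hAE h
      simp [h, this]
    · simpa [h] using hhi ω
  · have : ∀ ω, ((X ω + A.indicator (fun _ => (1 : ℤ)) ω : ℤ) : ℝ) =
        (X ω : ℝ) + A.indicator (fun _ => (1 : ℝ)) ω := fun ω => by
      rw [Int.cast_add, intCast_indicator_one]
    simp only [this]
    rw [integral_add hXi (integrable_indicator_one hA), integral_indicator_real_one hA, hμ]
    ring

/-- A two-valued function can be lowered to any admissible mean. -/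
lemma exists_lower {X : ℝ → ℤ} (hX : Measurable X) {lo : ℤ} (hlo : ∀ ω, lo ≤ X ω)
    (hhi : ∀ ω, X ω ≤ lo + 1) {y : ℝ} (h1 : y ≤ ∫ ω, (X ω : ℝ) ∂unitMeasure)
    (h2 : (lo : ℝ) ≤ y) :
    ∃ Y : ℝ → ℤ, Measurable Y ∧ (∀ ω, Y ω ≤ X ω) ∧ (∀ ω, lo ≤ Y ω) ∧
      ∫ ω, (Y ω : ℝ) ∂unitMeasure = y := by
  obtain ⟨Y, hY, hXY, hYl, hm⟩ := exists_raise (X := fun ω => -X ω) hX.neg (lo := -lo - 1)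
    (fun ω => by have := hhi ω; omega) (fun ω => by have := hlo ω; omega) (y := -y)
    (by simp only [Int.cast_neg, integral_neg]; linarith) (by push_cast; linarith)
  refine ⟨fun ω => -Y ω, hY.neg, fun ω => by have := hXY ω; dsimp only; omega,
    fun ω => by have := hYl ω; dsimp only; omega, ?_⟩
  simp only [Int.cast_neg, integral_neg, hm, neg_neg]

/-- `X` takes the values `⌊x⌋` and `⌊x⌋ + 1`, with mean `x`. -/
structure IsRounding (x : ℝ) (X : ℝ → ℤ) : Prop where
  measurable : Measurable X
  floor_le : ∀ ω, ⌊x⌋ ≤ X ω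
  le_floor : ∀ ω, X ω ≤ ⌊x⌋ + 1
  mean : ∫ ω, (X ω : ℝ) ∂unitMeasure = x

lemma IsRounding.integrable {x : ℝ} {X : ℝ → ℤ} (h : IsRounding x X) :
    Integrable (fun ω => (X ω : ℝ)) unitMeasure :=
  integrable_intCast h.measurable h.floor_le h.le_floor

/-- A rounding of `x` can be turned into a rounding of `y` by changing it by `|y - x|` on
average. -/
lemma IsRounding.exists_move {x : ℝ} {X : ℝ → ℤ} (h : IsRounding x X) (y : ℝ) :
    ∃ Y, IsRounding y Y ∧ ∫ ω, |(Y ω : ℝ) - X ω| ∂unitMeasure = |y - x| := by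
  rcases le_total x y with hxy | hxy
  · have hfl : ⌊x⌋ ≤ ⌊y⌋ := Int.floor_le_floor hxy
    -- `B` first brings `X` monotonically into the two-value band of `y`: nothing is needed if the
    -- floors agree, and otherwise `X ≤ ⌊x⌋ + 1 ≤ ⌊y⌋`, so the constant `⌊y⌋` serves. As every
    -- change is upward, the mean of `|Y - X|` is the difference of the means.
    obtain ⟨B, hB, hXB, hBl, hBh, hBm⟩ : ∃ B : ℝ → ℤ, Measurable B ∧ (∀ ω, X ω ≤ B ω) ∧
        (∀ ω, ⌊y⌋ ≤ B ω) ∧ (∀ ω, B ω ≤ ⌊y⌋ + 1) ∧ ∫ ω, (B ω : ℝ) ∂unitMeasure ≤ y := by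
      rcases hfl.eq_or_lt with he | hlt
      · exact ⟨X, h.measurable, fun _ => le_rfl, fun ω => he ▸ h.floor_le ω,
          fun ω => he ▸ h.le_floor ω, h.mean.le.trans hxy⟩
      · refine ⟨fun _ => ⌊y⌋, measurable_const, fun ω => ?_, fun _ => le_rfl, fun _ => by simp, ?_⟩
        · have := h.le_floor ω; dsimp only; omega
        · simpa using Int.floor_le y
    obtain ⟨Y, hY, hBY, hYh, hYm⟩ := exists_raise hB hBl hBh hBm (Int.lt_floor_add_one y).le
    have hr : IsRounding y Y := ⟨hY, fun ω => (hBl ω).trans (hBY ω), hYh, hYm⟩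
    refine ⟨Y, hr, ?_⟩
    have : ∀ ω, |(Y ω : ℝ) - X ω| = (Y ω : ℝ) - X ω := fun ω =>
      abs_of_nonneg (sub_nonneg.2 (by exact_mod_cast (hXB ω).trans (hBY ω)))
    simp only [this]
    rw [integral_sub hr.integrable h.integrable, hYm, h.mean, abs_of_nonneg (sub_nonneg.2 hxy)]
  · have hfl : ⌊y⌋ ≤ ⌊x⌋ := Int.floor_le_floor hxy
    obtain ⟨B, hB, hXB, hBl, hBh, hBm⟩ : ∃ B : ℝ → ℤ, Measurable B ∧ (∀ ω, B ω ≤ X ω) ∧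
        (∀ ω, ⌊y⌋ ≤ B ω) ∧ (∀ ω, B ω ≤ ⌊y⌋ + 1) ∧ y ≤ ∫ ω, (B ω : ℝ) ∂unitMeasure := by
      rcases hfl.eq_or_lt with he | hlt
      · exact ⟨X, h.measurable, fun _ => le_rfl, fun ω => he ▸ h.floor_le ω,
          fun ω => he ▸ h.le_floor ω, hxy.trans h.mean.ge⟩
      · refine ⟨fun _ => ⌊y⌋ + 1, measurable_const, fun ω => ?_, fun _ => by simp,
          fun _ => le_rfl, ?_⟩
        · have := h.floor_le ω; dsimp only; omega
        · simpa using (Int.lt_floor_add_one y).le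
    obtain ⟨Y, hY, hBY, hYh, hYm⟩ := exists_lower hB hBl hBh hBm (Int.floor_le y)
    have hr : IsRounding y Y := ⟨hY, hYh, fun ω => (hBY ω).trans (hBh ω), hYm⟩
    refine ⟨Y, hr, ?_⟩
    have : ∀ ω, |(Y ω : ℝ) - X ω| = (X ω : ℝ) - Y ω := fun ω => by
      rw [abs_sub_comm]
      exact abs_of_nonneg (sub_nonneg.2 (by exact_mod_cast (hBY ω).trans (hXB ω)))
    simp only [this]
    rw [integral_sub h.integrable hr.integrable, hYm, h.mean, abs_sub_comm,
      abs_of_nonneg (sub_nonneg.2 hxy)]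

/-- Moving units of a rounding from places with positive excess `e` to places with negative
excess, as long as possible. -/
lemma IsRounding.exists_swap {x : ℝ} {Z : ℝ → ℤ} (h : IsRounding x Z) {e : ℝ → ℤ}
    (he : Measurable e) :
    ∃ δ : ℝ → ℤ, IsRounding x (fun ω => Z ω + δ ω) ∧ (∀ ω, |e ω + δ ω| + |δ ω| ≤ |e ω|) ∧
      ((∀ᵐ ω ∂unitMeasure, 0 < e ω + δ ω → Z ω + δ ω = ⌊x⌋) ∨
        (∀ᵐ ω ∂unitMeasure, e ω + δ ω < 0 → Z ω + δ ω = ⌊x⌋ + 1)) := by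
  -- `E₁` is where lowering `Z` helps and is admissible, `E₂` where raising it is. Changing `Z` on
  -- subsets of equal measure preserves the mean, and the smaller of the two sets is used up, which
  -- gives the final alternative.
  set E₁ : Set ℝ := {ω | 0 < e ω} ∩ {ω | Z ω = ⌊x⌋ + 1} with hE₁
  set E₂ : Set ℝ := {ω | e ω < 0} ∩ {ω | Z ω = ⌊x⌋} with hE₂
  have hm₁ : MeasurableSet E₁ :=
    (he measurableSet_Ioi).inter (h.measurable (measurableSet_singleton _))
  have hm₂ : MeasurableSet E₂ :=
    (he measurableSet_Iio).inter (h.measurable (measurableSet_singleton _))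
  set m := min (unitMeasure.real E₁) (unitMeasure.real E₂) with hm
  have hm0 : 0 ≤ m := le_min measureReal_nonneg measureReal_nonneg
  obtain ⟨A, hAE, hA, hAm⟩ := exists_subset_unitMeasure_eq hm₁ hm0 (min_le_left _ _)
  obtain ⟨B, hBE, hB, hBm⟩ := exists_subset_unitMeasure_eq hm₂ hm0 (min_le_right _ _)
  have hAB : ∀ ω ∈ A, ω ∉ B := fun ω ha hb => by
    have h1 : 0 < e ω := (hAE ha).1
    have h2 : e ω < 0 := (hBE hb).1
    omega
  set δ : ℝ → ℤ := fun ω =>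
    B.indicator (fun _ => (1 : ℤ)) ω - A.indicator (fun _ => (1 : ℤ)) ω with hδ
  have hδA : ∀ ω ∈ A, δ ω = -1 := fun ω ha => by simp [hδ, ha, hAB ω ha]
  have hδB : ∀ ω ∈ B, δ ω = 1 := fun ω hb => by
    have : ω ∉ A := fun ha => hAB ω ha hb
    simp [hδ, hb, this]
  have hδ0 : ∀ ω, ω ∉ A → ω ∉ B → δ ω = 0 := fun ω ha hb => by simp [hδ, ha, hb]
  have hδm : Measurable δ := (measurable_const.indicator hB).sub (measurable_const.indicator hA)
  refine ⟨δ, ⟨h.measurable.add hδm, fun ω => ?_, fun ω => ?_, ?_⟩, fun ω => ?_, ?_⟩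
  · have h1 := h.floor_le ω
    by_cases ha : ω ∈ A
    · have h2 : Z ω = ⌊x⌋ + 1 := (hAE ha).2
      rw [hδA ω ha]; omega
    · by_cases hb : ω ∈ B
      · rw [hδB ω hb]; omega
      · rw [hδ0 ω ha hb]; omega
  · have h1 := h.le_floor ω
    by_cases ha : ω ∈ A
    · rw [hδA ω ha]; omega
    · by_cases hb : ω ∈ B
      · have h2 : Z ω = ⌊x⌋ := (hBE hb).2
        rw [hδB ω hb]; omega
      · rw [hδ0 ω ha hb]; omega
  · have h1 : ∀ ω, ((Z ω + δ ω : ℤ) : ℝ) = (Z ω : ℝ) +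
        (B.indicator (fun _ => (1 : ℝ)) ω - A.indicator (fun _ => (1 : ℝ)) ω) := fun ω => by
      rw [Int.cast_add, hδ, Int.cast_sub, intCast_indicator_one, intCast_indicator_one]
    simp only [h1]
    rw [integral_add (g := fun ω => B.indicator (fun _ => (1 : ℝ)) ω -
        A.indicator (fun _ => (1 : ℝ)) ω) h.integrable
      ((integrable_indicator_one hB).sub (integrable_indicator_one hA)),
      integral_sub (integrable_indicator_one hB) (integrable_indicator_one hA),
      integral_indicator_real_one hB, integral_indicator_real_one hA, hAm, hBm, h.mean]
    ring
  · by_cases ha : ω ∈ A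
    · have h1 : 0 < e ω := (hAE ha).1
      rw [hδA ω ha, abs_of_nonneg (by omega : 0 ≤ e ω + -1), abs_of_pos h1]
      norm_num
    · by_cases hb : ω ∈ B
      · have h1 : e ω < 0 := (hBE hb).1
        rw [hδB ω hb, abs_of_nonpos (by omega : e ω + 1 ≤ 0), abs_of_neg h1]
        norm_num
      · rw [hδ0 ω ha hb]; simp
  · rcases le_total (unitMeasure.real E₁) (unitMeasure.real E₂) with hle | hle
    · left
      have hnull : unitMeasure (E₁ \ A) = 0 := by
        have h1 : unitMeasure.real (E₁ \ A) = 0 := by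
          rw [measureReal_sdiff hAE hA, hAm, hm, min_eq_left hle, sub_self]
        exact (measureReal_eq_zero_iff).1 h1
      have hae : ∀ᵐ ω ∂unitMeasure, ω ∉ E₁ \ A := measure_eq_zero_iff_ae_notMem.1 hnull
      filter_upwards [hae] with ω hω hpos
      by_cases ha : ω ∈ A
      · have h2 : Z ω = ⌊x⌋ + 1 := (hAE ha).2
        rw [hδA ω ha, h2]; ring
      · by_cases hb : ω ∈ B
        · have h1 : e ω < 0 := (hBE hb).1
          rw [hδB ω hb] at hpos; omega
        · rw [hδ0 ω ha hb] at hpos ⊢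
          have h3 : ω ∉ E₁ := fun h' => hω ⟨h', ha⟩
          have h4 : Z ω ≠ ⌊x⌋ + 1 := fun h' => h3 ⟨by simpa using hpos, h'⟩
          have := h.floor_le ω
          have := h.le_floor ω
          omega
    · right
      have hnull : unitMeasure (E₂ \ B) = 0 := by
        have h1 : unitMeasure.real (E₂ \ B) = 0 := by
          rw [measureReal_sdiff hBE hB, hBm, hm, min_eq_right hle, sub_self]
        exact (measureReal_eq_zero_iff).1 h1
      have hae : ∀ᵐ ω ∂unitMeasure, ω ∉ E₂ \ B := measure_eq_zero_iff_ae_notMem.1 hnull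
      filter_upwards [hae] with ω hω hneg
      by_cases ha : ω ∈ A
      · have h1 : 0 < e ω := (hAE ha).1
        rw [hδA ω ha] at hneg; omega
      · by_cases hb : ω ∈ B
        · have h2 : Z ω = ⌊x⌋ := (hBE hb).2
          rw [hδB ω hb, h2]
        · rw [hδ0 ω ha hb] at hneg ⊢
          have h3 : ω ∉ E₂ := fun h' => hω ⟨h', hb⟩
          have h4 : Z ω ≠ ⌊x⌋ := fun h' => h3 ⟨by simpa using hneg, h'⟩
          have := h.floor_le ω
          have := h.le_floor ω
          omega

/-- Roundings of the coordinates with the correct expected sum can be changed so that their sum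
is the given one. -/
lemma exists_rounding_sum_eq {ι : Type*} [DecidableEq ι] (G : Finset ι) {x : ι → ℝ}
    {Y : ι → ℝ → ℤ} (hY : ∀ i, IsRounding (x i) (Y i)) {N : ℝ → ℤ} (hN : Measurable N) {M : ℤ}
    (hlo : ∀ᵐ ω ∂unitMeasure, M ≤ N ω ∧ N ω ≤ M + 1)
    (hNi : Integrable (fun ω => (N ω : ℝ)) unitMeasure)
    (hmean : ∫ ω, (N ω : ℝ) ∂unitMeasure = ∑ i ∈ G, x i) :
    ∃ Z : ι → ℝ → ℤ, (∀ i, IsRounding (x i) (Z i)) ∧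
      (∀ᵐ ω ∂unitMeasure, ∑ i ∈ G, Z i ω = N ω) ∧
      ∀ ω, ∑ i ∈ G, |Z i ω - Y i ω| ≤ |∑ i ∈ G, Y i ω - N ω| := by
  -- Coordinates are treated one at a time. Since `|e + δ| + |δ| ≤ |e|`, the excess only shrinks
  -- towards zero and never changes sign, so the alternatives reached for earlier coordinates
  -- survive, and the total change is paid by the decrease of the excess.
  have key : ∀ F : Finset ι, F ⊆ G → ∃ Z : ι → ℝ → ℤ, (∀ i, IsRounding (x i) (Z i)) ∧
      (∀ ω, ∑ i ∈ G, |Z i ω - Y i ω| + |∑ i ∈ G, Z i ω - N ω| ≤ |∑ i ∈ G, Y i ω - N ω|) ∧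
      ∀ i ∈ F, (∀ᵐ ω ∂unitMeasure, 0 < ∑ j ∈ G, Z j ω - N ω → Z i ω = ⌊x i⌋) ∨
        (∀ᵐ ω ∂unitMeasure, ∑ j ∈ G, Z j ω - N ω < 0 → Z i ω = ⌊x i⌋ + 1) := by
    intro F
    induction F using Finset.induction_on with
    | empty => exact fun _ => ⟨Y, hY, fun ω => by simp, by simp⟩
    | insert i F hiF ih =>
      intro hF
      obtain ⟨Z, hZ, hc, hs⟩ := ih ((Finset.subset_insert i F).trans hF)
      have hiG : i ∈ G := hF (Finset.mem_insert_self i F)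
      have hem : Measurable fun ω => ∑ j ∈ G, Z j ω - N ω :=
        (Finset.measurable_fun_sum G fun j _ => (hZ j).measurable).sub hN
      obtain ⟨δ, hδ, hδe, hδs⟩ := (hZ i).exists_swap hem
      set Z' : ι → ℝ → ℤ := Function.update Z i (fun ω => Z i ω + δ ω) with hZ'
      have hself : ∀ ω, Z' i ω = Z i ω + δ ω := fun ω => by simp [hZ']
      have hne : ∀ j ≠ i, Z' j = Z j := fun j hj => by simp [hZ', hj]
      have hsum : ∀ ω, ∑ j ∈ G, Z' j ω = ∑ j ∈ G, Z j ω + δ ω := fun ω => by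
        rw [← Finset.add_sum_erase G _ hiG, ← Finset.add_sum_erase G (fun j => Z j ω) hiG, hself,
          Finset.sum_congr rfl fun j hj => by rw [hne j (Finset.ne_of_mem_erase hj)]]
        ring
      have hex : ∀ ω, ∑ j ∈ G, Z' j ω - N ω = (∑ j ∈ G, Z j ω - N ω) + δ ω := fun ω => by
        rw [hsum]; ring
      have habs : ∀ ω, ∑ j ∈ G, |Z' j ω - Y j ω| ≤ ∑ j ∈ G, |Z j ω - Y j ω| + |δ ω| := fun ω => by
        rw [← Finset.add_sum_erase G _ hiG,
          ← Finset.add_sum_erase G (fun j => |Z j ω - Y j ω|) hiG, hself,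
          Finset.sum_congr rfl fun j hj => by rw [hne j (Finset.ne_of_mem_erase hj)]]
        have : |Z i ω + δ ω - Y i ω| ≤ |Z i ω - Y i ω| + |δ ω| := by
          rw [add_sub_right_comm]
          exact abs_add_le _ _
        linarith
      refine ⟨Z', fun j => ?_, fun ω => ?_, fun j hj => ?_⟩
      · rcases eq_or_ne j i with rfl | hj
        · convert hδ using 1
          simp [hZ']
        · rw [hne j hj]; exact hZ j
      · have h1 := hδe ω
        have h2 := hc ω
        have h3 := habs ω
        rw [hex]
        linarith
      · rcases eq_or_ne j i with rfl | hji
        · simp only [hex, hself]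
          exact hδs
        · have hjF : j ∈ F := (Finset.mem_insert.1 hj).resolve_left hji
          simp only [hex]
          rw [hne j hji]
          rcases hs j hjF with h | h
          · left
            filter_upwards [h] with ω hω hpos
            refine hω ?_
            have h1 := hδe ω
            simp only [abs] at h1
            grind
          · right
            filter_upwards [h] with ω hω hneg
            refine hω ?_
            have h1 := hδe ω
            simp only [abs] at h1
            grind
  obtain ⟨Z, hZ, hc, hs⟩ := key G subset_rfl
  refine ⟨Z, hZ, ?_, fun ω => (le_add_of_nonneg_right (abs_nonneg _)).trans (hc ω)⟩
  set e : ℝ → ℤ := fun ω => ∑ i ∈ G, Z i ω - N ω with he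
  have hei : Integrable (fun ω => (e ω : ℝ)) unitMeasure := by
    simp only [he, Int.cast_sub, Int.cast_sum]
    exact (integrable_finsetSum G fun i _ => (hZ i).integrable).sub hNi
  have hint : ∫ ω, (e ω : ℝ) ∂unitMeasure = 0 := by
    simp only [he, Int.cast_sub, Int.cast_sum]
    rw [integral_sub (integrable_finsetSum G fun i _ => (hZ i).integrable) hNi,
      integral_finsetSum G fun i _ => (hZ i).integrable, hmean]
    simp [(hZ _).mean]
  -- Conditional form of both alternatives: it holds almost everywhere whichever alternative is
  -- true, so all coordinates can be evaluated at common points.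
  have hall : ∀ᵐ ω ∂unitMeasure, (M ≤ N ω ∧ N ω ≤ M + 1) ∧ ∀ i ∈ G,
      ((∀ᵐ ω ∂unitMeasure, 0 < e ω → Z i ω = ⌊x i⌋) → 0 < e ω → Z i ω = ⌊x i⌋) ∧
      ((∀ᵐ ω ∂unitMeasure, e ω < 0 → Z i ω = ⌊x i⌋ + 1) → e ω < 0 → Z i ω = ⌊x i⌋ + 1) := by
    refine hlo.and ((Filter.eventually_all_finset G).2 fun i _ => Filter.Eventually.and ?_ ?_)
    · by_cases h : ∀ᵐ ω ∂unitMeasure, 0 < e ω → Z i ω = ⌊x i⌋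
      · filter_upwards [h] with ω hω _ using hω
      · exact Filter.Eventually.of_forall fun ω h' => absurd h' h
    · by_cases h : ∀ᵐ ω ∂unitMeasure, e ω < 0 → Z i ω = ⌊x i⌋ + 1
      · filter_upwards [h] with ω hω _ using hω
      · exact Filter.Eventually.of_forall fun ω h' => absurd h' h
  -- If the excess were positive at `ω₁` and negative at `ω₂`, saturation would give `Z i ω₁ ≤ Z i
  -- ω₂` for all `i`. But the sum at `ω₁` is at least `M + 1` and the one at `ω₂` at most `M`. An
  -- excess of one sign with mean zero vanishes almost everywhere.
  have hdich : (∀ᵐ ω ∂unitMeasure, e ω ≤ 0) ∨ ∀ᵐ ω ∂unitMeasure, 0 ≤ e ω := by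
    by_contra hcon
    push Not at hcon
    obtain ⟨h1, h2⟩ := hcon
    obtain ⟨ω₁, hω₁, ⟨hM₁, hG₁⟩⟩ := (h1.and_eventually hall).exists
    obtain ⟨ω₂, hω₂, ⟨hM₂, hG₂⟩⟩ := (h2.and_eventually hall).exists
    have hle : ∑ i ∈ G, Z i ω₁ ≤ ∑ i ∈ G, Z i ω₂ := Finset.sum_le_sum fun i hi => by
      rcases hs i hi with h | h
      · rw [(hG₁ i hi).1 h hω₁]; exact (hZ i).floor_le ω₂
      · rw [(hG₂ i hi).2 h hω₂]; exact (hZ i).le_floor ω₁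
    simp only [he] at hω₁ hω₂
    omega
  have hzero : ∀ᵐ ω ∂unitMeasure, e ω = 0 := by
    rcases hdich with h | h
    · have h1 : 0 ≤ᵐ[unitMeasure] fun ω => -(e ω : ℝ) := by
        filter_upwards [h] with ω hω
        have : (e ω : ℝ) ≤ 0 := by exact_mod_cast hω
        simpa using this
      have h2 := (integral_eq_zero_iff_of_nonneg_ae h1 hei.neg).1 (by
        simp only [integral_neg, hint, neg_zero])
      filter_upwards [h2] with ω hω
      simpa using hω
    · have h1 : 0 ≤ᵐ[unitMeasure] fun ω => (e ω : ℝ) := by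
        filter_upwards [h] with ω hω
        simpa using hω
      have h2 := (integral_eq_zero_iff_of_nonneg_ae h1 hei).1 hint
      filter_upwards [h2] with ω hω
      simpa using hω
  filter_upwards [hzero] with ω hω
  simp only [he] at hω
  omega

/-- As `θ` runs through `[0, 1)`, the floor jumps at most once, at `1 - Int.fract s`. -/
lemma floor_add_ae_eq (s : ℝ) : (fun θ : ℝ => (⌊s + θ⌋ : ℝ)) =ᵐ[unitMeasure]
    fun θ => (⌊s⌋ : ℝ) + (Set.Ici (1 - Int.fract s)).indicator (fun _ => (1 : ℝ)) θ := by
  filter_upwards [ae_restrict_mem (measurableSet_Ico : MeasurableSet (Set.Ico (0 : ℝ) 1))]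
    with θ hθ
  have h1 := Int.floor_add_fract s
  have h2 := Int.fract_lt_one s
  have h3 := Int.fract_nonneg s
  by_cases h : 1 - Int.fract s ≤ θ
  · have : ⌊s + θ⌋ = ⌊s⌋ + 1 := by
      rw [Int.floor_eq_iff]
      push_cast
      constructor <;> linarith [hθ.1, hθ.2]
    simp [h, this]
  · have : ⌊s + θ⌋ = ⌊s⌋ := by
      rw [Int.floor_eq_iff]
      constructor <;> linarith [hθ.1, hθ.2]
    simp [h, this]

lemma integrable_floor_add (s : ℝ) : Integrable (fun θ : ℝ => (⌊s + θ⌋ : ℝ)) unitMeasure :=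
  ((integrable_const _).add (integrable_indicator_one measurableSet_Ici)).congr
    (floor_add_ae_eq s).symm

/-- Rounding with a uniformly random offset preserves the mean. -/
lemma integral_floor_add (s : ℝ) : ∫ θ, (⌊s + θ⌋ : ℝ) ∂unitMeasure = s := by
  rw [integral_congr_ae (floor_add_ae_eq s),
    integral_add (integrable_const _) (integrable_indicator_one measurableSet_Ici),
    integral_indicator_real_one measurableSet_Ici]
  have h3 := Int.fract_nonneg s
  have h4 := Int.fract_lt_one s
  have h : unitMeasure.real (Set.Ici (1 - Int.fract s)) = Int.fract s := by
    rw [measureReal_def, unitMeasure, Measure.restrict_apply measurableSet_Ici]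
    have : Set.Ici (1 - Int.fract s) ∩ Set.Ico 0 1 = Set.Ico (1 - Int.fract s) 1 := by
      ext z
      simp only [Set.mem_inter_iff, Set.mem_Ici, Set.mem_Ico]
      constructor
      · rintro ⟨h, h', h''⟩
        exact ⟨h, h''⟩
      · rintro ⟨h, h'⟩
        exact ⟨h, by linarith, h'⟩
    rw [this, Real.volume_Ico, sub_sub_cancel, ENNReal.toReal_ofReal h3]
  rw [h]
  simp [Int.floor_add_fract]

/-- The common offset couples the two roundings monotonically: their difference has the same sign
for every `θ`, so the absolute value can be taken outside the mean. -/
lemma integral_abs_floor_sub (s t : ℝ) :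
    ∫ θ, |(⌊s + θ⌋ : ℝ) - ⌊t + θ⌋| ∂unitMeasure = |s - t| := by
  wlog h : t ≤ s generalizing s t with H
  · rw [abs_sub_comm, ← H t s (by linarith)]
    simp only [abs_sub_comm]
  · have : ∀ θ : ℝ, |(⌊s + θ⌋ : ℝ) - ⌊t + θ⌋| = (⌊s + θ⌋ : ℝ) - ⌊t + θ⌋ := fun θ => by
      refine abs_of_nonneg (sub_nonneg.2 ?_)
      exact_mod_cast Int.floor_le_floor (by linarith : t + θ ≤ s + θ)
    simp only [this]
    rw [integral_sub (integrable_floor_add s) (integrable_floor_add t), integral_floor_add,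
      integral_floor_add, abs_of_nonneg (sub_nonneg.2 h)]

/-! ### Rounding by weight levels with a common random offset -/

section Levels

variable {ι : Type*} [Fintype ι] (lev : ι → ℕ)

/-- The total amount of all coordinates of level at least `g`. -/
def tailSum (x : ι → ℝ) (g : ℕ) : ℝ := ∑ i with g ≤ lev i, x i

/-- The integral amount of level `g`, by rounding the tail sums with a common offset. -/
noncomputable def levelCount (x : ι → ℝ) (g : ℕ) (θ : ℝ) : ℤ :=
  ⌊tailSum lev x g + θ⌋ - ⌊tailSum lev x (g + 1) + θ⌋

lemma tailSum_eq (x : ι → ℝ) (g : ℕ) :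
    tailSum lev x g = ∑ i with lev i = g, x i + tailSum lev x (g + 1) := by
  classical
  rw [tailSum, tailSum, ← Finset.sum_union]
  · congr 1
    ext i
    simp only [Finset.mem_filter, Finset.mem_univ, true_and, Finset.mem_union]
    omega
  · rw [Finset.disjoint_left]
    simp only [Finset.mem_filter, Finset.mem_univ, true_and]
    omega

lemma measurable_levelCount (x : ι → ℝ) (g : ℕ) : Measurable (levelCount lev x g) :=
  (Int.measurable_floor.comp (measurable_const.add measurable_id)).sub
    (Int.measurable_floor.comp (measurable_const.add measurable_id))

/-- `⌊a + b⌋ - ⌊b⌋` is `⌊a⌋` or `⌊a⌋ + 1`. That a level total takes only two adjacent values is the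
hypothesis of `exists_rounding_sum_eq`. -/
lemma levelCount_bounds (x : ι → ℝ) (g : ℕ) (θ : ℝ) :
    ⌊∑ i with lev i = g, x i⌋ ≤ levelCount lev x g θ ∧
      levelCount lev x g θ ≤ ⌊∑ i with lev i = g, x i⌋ + 1 := by
  rw [levelCount, tailSum_eq, add_assoc]
  have h1 := Int.le_floor_add (∑ i with lev i = g, x i) (tailSum lev x (g + 1) + θ)
  have h2 := Int.le_floor_add_floor (∑ i with lev i = g, x i) (tailSum lev x (g + 1) + θ)
  constructor <;> omega

lemma integrable_levelCount (x : ι → ℝ) (g : ℕ) :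
    Integrable (fun θ => (levelCount lev x g θ : ℝ)) unitMeasure := by
  simp only [levelCount, Int.cast_sub]
  exact (integrable_floor_add _).sub (integrable_floor_add _)

lemma integral_levelCount (x : ι → ℝ) (g : ℕ) :
    ∫ θ, (levelCount lev x g θ : ℝ) ∂unitMeasure = ∑ i with lev i = g, x i := by
  simp only [levelCount, Int.cast_sub]
  rw [integral_sub (integrable_floor_add _) (integrable_floor_add _), integral_floor_add,
    integral_floor_add, tailSum_eq lev x g]
  ring

/-- A random integral point `X` that rounds the fractional point `x`, and whose amounts on the
levels are the ones given by `levelCount`. -/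
structure IsLevelRounding (x : ι → ℝ) (X : ι → ℝ → ℤ) : Prop where
  rounding : ∀ i, IsRounding (x i) (X i)
  level : ∀ g, ∀ᵐ θ ∂unitMeasure, ∑ i with lev i = g, X i θ = levelCount lev x g θ

/-- The level counts telescope to `⌊k + θ⌋ - ⌊θ⌋`, which is `k` because `k` is an integer. -/
lemma IsLevelRounding.sum_eq {x : ι → ℝ} {X : ι → ℝ → ℤ} (h : IsLevelRounding lev x X) {k : ℕ}
    (hk : ∑ i, x i = k) : ∀ᵐ θ ∂unitMeasure, ∑ i, X i θ = k := by
  obtain ⟨L, hL⟩ : ∃ L, ∀ i, lev i < L :=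
    ⟨∑ i, lev i + 1, fun i => Nat.lt_succ_of_le
      (Finset.single_le_sum (f := lev) (fun _ _ => Nat.zero_le _) (Finset.mem_univ i))⟩
  filter_upwards [ae_all_iff.2 h.level] with θ hθ
  have h1 : ∑ i, X i θ = ∑ g ∈ Finset.range L, ∑ i with lev i = g, X i θ :=
    (Finset.sum_fiberwise_of_maps_to (fun i _ => Finset.mem_range.2 (hL i)) _).symm
  have h2 : tailSum lev x L = 0 := by
    rw [tailSum, Finset.sum_eq_zero]
    intro i hi
    have := hL i
    simp only [Finset.mem_filter] at hi
    omega
  have h3 : tailSum lev x 0 = k := by simp [tailSum, hk]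
  rw [h1, Finset.sum_congr rfl fun g _ => hθ g]
  have h4 := Finset.sum_range_sub' (fun g => ⌊tailSum lev x g + θ⌋) L
  simp only [levelCount]
  rw [h4, h2, h3, zero_add, add_comm, Int.floor_add_natCast]
  ring

lemma abs_tailSum_sub_le (x y : ι → ℝ) (g : ℕ) :
    |tailSum lev y g - tailSum lev x g| ≤ tailSum lev (fun i => |y i - x i|) g := by
  rw [tailSum, tailSum, tailSum, ← Finset.sum_sub_distrib]
  exact Finset.abs_sum_le_sum_abs _ _

variable {lev}

/-- Level roundings can follow a fractional point, within each level at a cost proportional to the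
fractional movement on this and the higher levels. -/
lemma IsLevelRounding.exists_step {x : ι → ℝ} {X : ι → ℝ → ℤ} (h : IsLevelRounding lev x X)
    (y : ι → ℝ) : ∃ Y, IsLevelRounding lev y Y ∧
      ∀ g, ∑ i with lev i = g, ∫ θ, |(Y i θ : ℝ) - X i θ| ∂unitMeasure
        ≤ 4 * tailSum lev (fun i => |y i - x i|) g := by
  classical
  choose V hV hVX using fun i => (h.rounding i).exists_move (y i)
  choose Z hZ hZs hZc using fun g : ℕ => exists_rounding_sum_eq (Finset.univ.filter (lev · = g))
    hV (measurable_levelCount lev y g) (Filter.Eventually.of_forall (levelCount_bounds lev y g))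
    (integrable_levelCount lev y g) (integral_levelCount lev y g)
  have hY : IsLevelRounding lev y fun i => Z (lev i) i := by
    refine ⟨fun i => hZ _ i, fun g => ?_⟩
    filter_upwards [hZs g] with θ hθ
    rw [← hθ]
    refine Finset.sum_congr rfl fun i hi => ?_
    rw [(Finset.mem_filter.1 hi).2]
  refine ⟨_, hY, fun g => ?_⟩
  have hint : ∀ i, Integrable (fun θ => |(Z (lev i) i θ : ℝ) - X i θ|) unitMeasure := fun i =>
    ((hY.rounding i).integrable.sub (h.rounding i).integrable).abs
  have hVi : ∀ i, Integrable (fun θ => |(V i θ : ℝ) - X i θ|) unitMeasure := fun i =>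
    ((hV i).integrable.sub (h.rounding i).integrable).abs
  have hfl : ∀ g, Integrable (fun θ : ℝ => |(⌊tailSum lev y g + θ⌋ : ℝ) - ⌊tailSum lev x g + θ⌋|)
      unitMeasure := fun g => ((integrable_floor_add _).sub (integrable_floor_add _)).abs
  rw [← integral_finsetSum _ fun i _ => hint i]
  -- Repairing the sum of `V` costs its mismatch with the new level count. As `X` matched the old
  -- count, the mismatch is at most the movement from `X` to `V` plus the change of the count; the
  -- movement is thus paid twice.
  have hpt : ∀ᵐ θ ∂unitMeasure, ∑ i with lev i = g, |(Z (lev i) i θ : ℝ) - X i θ| ≤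
      2 * ∑ i with lev i = g, |(V i θ : ℝ) - X i θ| +
        (|(⌊tailSum lev y g + θ⌋ : ℝ) - ⌊tailSum lev x g + θ⌋| +
        |(⌊tailSum lev y (g + 1) + θ⌋ : ℝ) - ⌊tailSum lev x (g + 1) + θ⌋|) := by
    filter_upwards [h.level g] with θ hX
    have h1 : ∑ i with lev i = g, |Z (lev i) i θ - X i θ| ≤
        ∑ i with lev i = g, |Z g i θ - V i θ| + ∑ i with lev i = g, |V i θ - X i θ| := by
      rw [← Finset.sum_add_distrib]
      refine Finset.sum_le_sum fun i hi => ?_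
      rw [(Finset.mem_filter.1 hi).2]
      exact abs_sub_le _ _ _
    have h2 := hZc g θ
    have h3 : |∑ i with lev i = g, V i θ - ∑ i with lev i = g, X i θ| ≤
        ∑ i with lev i = g, |V i θ - X i θ| := by
      rw [← Finset.sum_sub_distrib]
      exact Finset.abs_sum_le_sum_abs _ _
    have h4 : |∑ i with lev i = g, V i θ - levelCount lev y g θ| ≤
        |∑ i with lev i = g, V i θ - ∑ i with lev i = g, X i θ| +
        (|⌊tailSum lev y g + θ⌋ - ⌊tailSum lev x g + θ⌋| +
        |⌊tailSum lev y (g + 1) + θ⌋ - ⌊tailSum lev x (g + 1) + θ⌋|) := by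
      rw [hX, levelCount, levelCount]
      grind
    have h5 : ∑ i with lev i = g, |Z (lev i) i θ - X i θ| ≤
      2 * ∑ i with lev i = g, |V i θ - X i θ| +
        (|⌊tailSum lev y g + θ⌋ - ⌊tailSum lev x g + θ⌋| +
        |⌊tailSum lev y (g + 1) + θ⌋ - ⌊tailSum lev x (g + 1) + θ⌋|) := by linarith
    exact_mod_cast h5
  have hsum : Integrable (fun θ => ∑ i with lev i = g, |(V i θ : ℝ) - X i θ|) unitMeasure :=
    integrable_finsetSum _ fun i _ => hVi i
  refine (integral_mono_ae (integrable_finsetSum _ fun i _ => hint i)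
    ((hsum.const_mul 2).add ((hfl g).add (hfl (g + 1)))) hpt).trans ?_
  have e1 : ∫ θ, (2 * ∑ i with lev i = g, |(V i θ : ℝ) - X i θ| +
        (|(⌊tailSum lev y g + θ⌋ : ℝ) - ⌊tailSum lev x g + θ⌋| +
        |(⌊tailSum lev y (g + 1) + θ⌋ : ℝ) - ⌊tailSum lev x (g + 1) + θ⌋|)) ∂unitMeasure =
      2 * ∑ i with lev i = g, |y i - x i| + (|tailSum lev y g - tailSum lev x g| +
        |tailSum lev y (g + 1) - tailSum lev x (g + 1)|) := by
    rw [integral_add (hsum.const_mul 2) (g := fun θ =>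
        (|(⌊tailSum lev y g + θ⌋ : ℝ) - ⌊tailSum lev x g + θ⌋| +
        |(⌊tailSum lev y (g + 1) + θ⌋ : ℝ) - ⌊tailSum lev x (g + 1) + θ⌋|))
        ((hfl g).add (hfl (g + 1))), integral_add (hfl g) (hfl (g + 1)),
      integral_const_mul, integral_finsetSum _ fun i _ => hVi i, integral_abs_floor_sub,
      integral_abs_floor_sub]
    simp only [hVX]
  have e2 := abs_tailSum_sub_le lev x y g
  have e3 := abs_tailSum_sub_le lev x y (g + 1)
  have e4 := tailSum_eq lev (fun i => |y i - x i|) g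
  have e5 : 0 ≤ ∑ i with lev i = g, |y i - x i| := Finset.sum_nonneg fun _ _ => abs_nonneg _
  have e6 : 0 ≤ tailSum lev (fun i => |y i - x i|) (g + 1) :=
    Finset.sum_nonneg fun _ _ => abs_nonneg _
  refine e1.le.trans ?_
  linarith

/-- With levels that group the weights by powers of two, following a fractional point costs only
a constant factor. -/
lemma IsLevelRounding.exists_step_weighted {x : ι → ℝ} {X : ι → ℝ → ℤ}
    (h : IsLevelRounding lev x X) {w : ι → ℝ} {u : ℝ} (hu : 0 < u)
    (hlo : ∀ i, u * 2 ^ lev i ≤ w i) (hhi : ∀ i, w i ≤ 2 * (u * 2 ^ lev i)) (y : ι → ℝ) :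
    ∃ Y, IsLevelRounding lev y Y ∧
      ∑ i, w i * ∫ θ, |(Y i θ : ℝ) - X i θ| ∂unitMeasure ≤ 16 * ∑ i, w i * |y i - x i| := by
  classical
  obtain ⟨Y, hY, hc⟩ := h.exists_step y
  refine ⟨Y, hY, ?_⟩
  obtain ⟨L, hL⟩ : ∃ L, ∀ i, lev i < L :=
    ⟨∑ i, lev i + 1, fun i => Nat.lt_succ_of_le
      (Finset.single_le_sum (f := lev) (fun _ _ => Nat.zero_le _) (Finset.mem_univ i))⟩
  have h0 : ∀ i, 0 ≤ ∫ θ, |(Y i θ : ℝ) - X i θ| ∂unitMeasure := fun i =>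
    integral_nonneg fun _ => abs_nonneg _
  calc ∑ i, w i * ∫ θ, |(Y i θ : ℝ) - X i θ| ∂unitMeasure
      ≤ ∑ i, 2 * (u * 2 ^ lev i) * ∫ θ, |(Y i θ : ℝ) - X i θ| ∂unitMeasure :=
        Finset.sum_le_sum fun i _ => mul_le_mul_of_nonneg_right (hhi i) (h0 i)
    _ = ∑ g ∈ Finset.range L, ∑ i with lev i = g,
          2 * (u * 2 ^ lev i) * ∫ θ, |(Y i θ : ℝ) - X i θ| ∂unitMeasure :=
        (Finset.sum_fiberwise_of_maps_to (fun i _ => Finset.mem_range.2 (hL i)) _).symm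
    _ ≤ ∑ g ∈ Finset.range L, 2 * (u * 2 ^ g) * (4 * tailSum lev (fun i => |y i - x i|) g) := by
        refine Finset.sum_le_sum fun g _ => ?_
        rw [Finset.sum_congr rfl fun i hi => by rw [(Finset.mem_filter.1 hi).2],
          ← Finset.mul_sum]
        exact mul_le_mul_of_nonneg_left (hc g) (by positivity)
    _ = ∑ j, 8 * u * |y j - x j| * ∑ g ∈ Finset.range L with g ≤ lev j, (2 : ℝ) ^ g := by
        simp only [tailSum, Finset.sum_filter, Finset.mul_sum]
        rw [Finset.sum_comm]
        refine Finset.sum_congr rfl fun j _ => Finset.sum_congr rfl fun g _ => ?_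
        split_ifs <;> ring
    _ ≤ ∑ j, 16 * (w j * |y j - x j|) := by
        refine Finset.sum_le_sum fun j _ => ?_
        -- Coordinate `j` is charged by every level up to its own; the geometric series makes this
        -- comparable to its own level alone.
        have h1 : ∑ g ∈ Finset.range L with g ≤ lev j, (2 : ℝ) ^ g ≤ 2 * 2 ^ lev j := by
          calc ∑ g ∈ Finset.range L with g ≤ lev j, (2 : ℝ) ^ g
              ≤ ∑ g ∈ Finset.range (lev j + 1), (2 : ℝ) ^ g := by
                refine Finset.sum_le_sum_of_subset_of_nonneg ?_ fun _ _ _ => by positivity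
                intro g hg
                have := (Finset.mem_filter.1 hg).2
                exact Finset.mem_range.2 (by omega)
            _ ≤ 2 * 2 ^ lev j := by
                rw [geom_sum_eq (by norm_num)]
                rw [pow_succ]
                norm_num
                linarith
        calc 8 * u * |y j - x j| * ∑ g ∈ Finset.range L with g ≤ lev j, (2 : ℝ) ^ g
            ≤ 8 * u * |y j - x j| * (2 * 2 ^ lev j) :=
              mul_le_mul_of_nonneg_left h1 (by positivity)
          _ = 16 * ((u * 2 ^ lev j) * |y j - x j|) := by ring
          _ ≤ 16 * (w j * |y j - x j|) := by
              have := mul_le_mul_of_nonneg_right (hlo j) (abs_nonneg (y j - x j))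
              linarith
    _ = 16 * ∑ i, w i * |y i - x i| := by rw [Finset.mul_sum]

end Levels

lemma exists_levels {ι : Type*} [Fintype ι] {w : ι → ℝ} (hw : ∀ i, 0 < w i) :
    ∃ (u : ℝ) (lev : ι → ℕ), 0 < u ∧ (∀ i, u * 2 ^ lev i ≤ w i) ∧
      ∀ i, w i ≤ 2 * (u * 2 ^ lev i) := by
  obtain ⟨u, hu, huw⟩ : ∃ u > 0, ∀ i, u ≤ w i := by
    rcases isEmpty_or_nonempty ι with hι | hι
    · exact ⟨1, one_pos, fun i => isEmptyElim i⟩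
    · obtain ⟨i, hi⟩ := Finite.exists_min w
      exact ⟨w i, hw i, hi⟩
  have : ∀ i, ∃ n : ℕ, (2 : ℝ) ^ n ≤ w i / u ∧ w i / u < 2 ^ (n + 1) := fun i =>
    exists_nat_pow_near ((one_le_div hu).2 (huw i)) (by norm_num)
  choose lev h1 h2 using this
  refine ⟨u, lev, hu, fun i => ?_, fun i => ?_⟩
  · have := (le_div_iff₀ hu).1 (h1 i)
    linarith
  · have := (div_lt_iff₀ hu).1 (h2 i)
    rw [pow_succ] at this
    linarith

/-- Randomized online rounding: a fractional division of `k` units that is revealed online can be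
rounded to integral divisions of `k` units, at most a constant factor more expensive in
expectation. -/
theorem exists_online_rounding {ι α : Type*} [Fintype ι] {w : ι → ℝ} (hw : ∀ i, 0 < w i)
    {k : ℕ} (x : List α → ι → ℝ) (hx : ∀ l, ∑ i, x l i = k) (X₀ : ι → ℤ)
    (hX₀ : ∀ i, x [] i = X₀ i) :
    ∃ X : List α → ι → ℝ → ℤ, (∀ l i, Measurable (X l i)) ∧ (∀ l i ω, ⌊x l i⌋ ≤ X l i ω) ∧
      (∀ l, ∀ᵐ ω ∂unitMeasure, ∑ i, X l i ω = k) ∧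
      (∀ l i, Integrable (fun ω => (X l i ω : ℝ)) unitMeasure) ∧
      ∀ l a, ∑ i, w i * ∫ ω, |(X (l ++ [a]) i ω : ℝ) - X l i ω| ∂unitMeasure
        ≤ 16 * ∑ i, w i * |x (l ++ [a]) i - x l i| := by
  obtain ⟨u, lev, hu, hlo, hhi⟩ := exists_levels hw
  have hstep : ∀ (y z : ι → ℝ) (Y : {Y // IsLevelRounding lev y Y}),
      ∃ Z : {Z // IsLevelRounding lev z Z},
        ∑ i, w i * ∫ ω, |(Z.1 i ω : ℝ) - Y.1 i ω| ∂unitMeasure ≤ 16 * ∑ i, w i * |z i - y i| :=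
    fun y z Y => by
      obtain ⟨Z, hZ, hc⟩ := Y.2.exists_step_weighted hu hlo hhi z
      exact ⟨⟨Z, hZ⟩, hc⟩
  choose S hS using hstep
  -- At an integral point all tail sums are integers, so the offset cancels and the constant
  -- rounding has the right level counts.
  have hinit : IsLevelRounding lev (x []) (fun i _ => X₀ i) := by
    refine ⟨fun i => ⟨measurable_const, fun _ => by simp [hX₀], fun _ => by simp [hX₀], by
      simp [hX₀]⟩, fun g => ?_⟩
    refine Filter.Eventually.of_forall fun θ => ?_
    have ht : ∀ g, tailSum lev (x []) g = ((∑ i with g ≤ lev i, X₀ i : ℤ) : ℝ) := fun g => by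
      simp [tailSum, hX₀]
    have h1 := tailSum_eq lev (x []) g
    rw [ht, ht] at h1
    have h2 : (∑ i with lev i = g, x [] i) = ((∑ i with lev i = g, X₀ i : ℤ) : ℝ) := by
      simp [hX₀]
    rw [h2] at h1
    rw [levelCount, ht, ht, Int.floor_intCast_add, Int.floor_intCast_add]
    have h3 : (∑ i with g ≤ lev i, X₀ i) =
        ∑ i with lev i = g, X₀ i + ∑ i with g + 1 ≤ lev i, X₀ i := by exact_mod_cast h1
    omega
  -- Histories grow at their end, hence the recursion on the reversed list. Each state is a function
  -- of the previous state and the two fractional points, so for fixed `ω` the result is an online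
  -- strategy.
  let F : (l : List α) → {Y // IsLevelRounding lev (x l.reverse) Y} := fun l =>
    List.rec (motive := fun l => {Y // IsLevelRounding lev (x l.reverse) Y})
      ⟨_, hinit⟩ (fun a l Y => S _ (x (a :: l).reverse) Y) l
  have hF : ∀ a l, F (a :: l) = S _ _ (F l) := fun a l => rfl
  let Z : List α → ι → ℝ → ℤ := fun l => (F l).1
  have hr : ∀ l l', l'.reverse = l → IsLevelRounding lev (x l) (Z l') := by
    rintro _ l rfl
    exact (F l).2
  replace hr : ∀ l, IsLevelRounding lev (x l) (Z l.reverse) := fun l => hr _ _ l.reverse_reverse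
  refine ⟨fun l => Z l.reverse, fun l i => ((hr l).rounding i).measurable,
    fun l i => ((hr l).rounding i).floor_le, fun l => (hr l).sum_eq lev (hx l),
    fun l i => ((hr l).rounding i).integrable, fun l a => ?_⟩
  have h1 : ∑ i, w i * ∫ ω, |(Z (a :: l.reverse) i ω : ℝ) - Z l.reverse i ω| ∂unitMeasure ≤
      16 * ∑ i, w i * |x (a :: l.reverse).reverse i - x l.reverse.reverse i| :=
    hS (x l.reverse.reverse) (x (a :: l.reverse).reverse) (F l.reverse)
  simpa using h1

/-! ### Farthest-in-future caching with all cache sizes at once -/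

section Chain

variable {P : Type*}

/-- An increasing chain of subsets of `K`, one of each size. -/
structure IsChain (K : Finset P) (T : ℕ → Finset P) : Prop where
  subset : ∀ j, T j ⊆ K
  mono : Monotone T
  card : ∀ j, (T j).card = min j K.card

lemma IsChain.zero {K : Finset P} {T : ℕ → Finset P} (h : IsChain K T) : T 0 = ∅ := by
  have := h.card 0
  simpa using this

lemma IsChain.eq_of_card_le {K : Finset P} {T : ℕ → Finset P} (h : IsChain K T) {j : ℕ}
    (hj : K.card ≤ j) : T j = K :=
  Finset.eq_of_subset_of_card_le (h.subset j) (by rw [h.card, min_eq_right hj])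

lemma IsChain.card_of_notMem {K : Finset P} {T : ℕ → Finset P} (h : IsChain K T) {j : ℕ} {p : P}
    (hp : p ∈ K) (hpj : p ∉ T j) : (T j).card = j := by
  have h1 : ¬ K.card ≤ j := fun h' => hpj (h.eq_of_card_le h' ▸ hp)
  rw [h.card, min_eq_left (by omega)]

/-- `S` has at most `d` more pages than `T` among those that are requested soon. -/
def Dominated (r : P → ℕ) (S T : Finset P) (d : ℕ) : Prop :=
  ∀ τ, (S.filter (r · ≤ τ)).card ≤ (T.filter (r · ≤ τ)).card + d

lemma dominated_card (r : P → ℕ) (S T : Finset P) : Dominated r S T S.card := fun _ =>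
  (Finset.card_filter_le _ _).trans (Nat.le_add_left _ _)

variable [LinearOrder P]

/-- `x` is the last element of `T` with respect to `R`, with ties broken by the order of `P`. -/
def IsFarthest (R : P → P → Prop) (T : Finset P) (x : P) : Prop :=
  x ∈ T ∧ ∀ y ∈ T, y ≠ x → R y x ∨ ¬ R x y ∧ y < x

open Classical in
/-- Serving a request to `p` in the caches of all sizes, evicting the farthest page on a fault. -/
noncomputable def chainStep (R : P → P → Prop) (p : P) (T : ℕ → Finset P) (j : ℕ) : Finset P :=
  if j = 0 ∨ p ∈ T j then T j else insert p ((T j).filter fun q => ¬ IsFarthest R (T j) q)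

/-- Initial segments of an enumeration of `K`. Any starting chain will do, since its quality affects
only the additive constant. -/
lemma exists_isChain (K : Finset P) : ∃ T, IsChain K T := by
  refine ⟨fun j => (K.sort (· ≤ ·)).take j |>.toFinset, fun j q hq => ?_, fun i j hij q hq => ?_,
    fun j => ?_⟩
  · have := List.mem_of_mem_take (List.mem_toFinset.1 hq)
    simpa using this
  · have := List.mem_toFinset.1 hq
    exact List.mem_toFinset.2 ((List.take_subset_take_left _ hij) this)
  · rw [List.toFinset_card_of_nodup ((K.sort_nodup (· ≤ ·)).sublist (List.take_sublist _ _))]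
    simp

/-- The maximum of the pairs `(r q, q)` in lexicographic order. Ties do occur: pages that are never
requested again share the same value of `List.idxOf`. -/
lemma exists_isFarthest {K : Finset P} {R : P → P → Prop} {r : P → ℕ}
    (hR : ∀ q ∈ K, ∀ q' ∈ K, R q q' ↔ r q < r q') {T : Finset P} (hT : T ⊆ K)
    (hne : T.Nonempty) :
    ∃ x, IsFarthest R T x ∧ ∀ y ∈ T, r y ≤ r x := by
  obtain ⟨x, hx, hmax⟩ := Finset.exists_max_image T (fun q => toLex (r q, q)) hne
  have hlex : ∀ y ∈ T, r y < r x ∨ r y = r x ∧ y ≤ x := fun y hy => by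
    have := hmax y hy
    rwa [Prod.Lex.toLex_le_toLex] at this
  refine ⟨x, ⟨hx, fun y hy hyx => ?_⟩, fun y hy => ?_⟩
  · rw [hR y (hT hy) x (hT hx), hR x (hT hx) y (hT hy)]
    rcases hlex y hy with h | ⟨h, h'⟩
    · exact Or.inl h
    · exact Or.inr ⟨by omega, lt_of_le_of_ne h' hyx⟩
  · rcases hlex y hy with h | ⟨h, -⟩ <;> omega

lemma IsFarthest.eq {R : P → P → Prop} {T : Finset P} {x y : P} (hx : IsFarthest R T x)
    (hy : IsFarthest R T y) {r : P → ℕ} (hR : ∀ q ∈ T, ∀ q' ∈ T, R q q' ↔ r q < r q') :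
    x = y := by
  by_contra hne
  have h1 := hx.2 y hy.1 (Ne.symm hne)
  have h2 := hy.2 x hx.1 hne
  rw [hR y hy.1 x hx.1, hR x hx.1 y hy.1] at h1
  rw [hR y hy.1 x hx.1, hR x hx.1 y hy.1] at h2
  rcases h1 with h1 | ⟨h1, h1'⟩ <;> rcases h2 with h2 | ⟨h2, h2'⟩
  · omega
  · omega
  · omega
  · exact absurd h1' (not_lt.2 h2'.le)

lemma chainStep_of_mem {R : P → P → Prop} {p : P} {T : ℕ → Finset P} {j : ℕ} (h : p ∈ T j) :
    chainStep R p T j = T j := if_pos (Or.inr h)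

lemma mem_chainStep {R : P → P → Prop} {p : P} {T : ℕ → Finset P} {j : ℕ} (h : 1 ≤ j) :
    p ∈ chainStep R p T j := by
  classical
  rw [chainStep]
  split_ifs with h1
  · exact h1.resolve_left (by omega)
  · exact Finset.mem_insert_self _ _

lemma chainStep_subset (R : P → P → Prop) (p : P) (T : ℕ → Finset P) (j : ℕ) :
    chainStep R p T j ⊆ insert p (T j) := by
  classical
  rw [chainStep]
  split_ifs with h1
  · exact Finset.subset_insert _ _
  · exact Finset.insert_subset_insert _ (Finset.filter_subset _ _)

/-- On a fault exactly the farthest page is evicted. -/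
lemma IsChain.chainStep_of_notMem {K : Finset P} {T : ℕ → Finset P} (h : IsChain K T)
    {R : P → P → Prop} {r : P → ℕ} (hR : ∀ q ∈ K, ∀ q' ∈ K, R q q' ↔ r q < r q') {p : P}
    (hp : p ∈ K) {j : ℕ} (hj : 1 ≤ j) (hpj : p ∉ T j) :
    ∃ x ∈ T j, (∀ y ∈ T j, r y ≤ r x) ∧ chainStep R p T j = insert p ((T j).erase x) := by
  classical
  have hne : (T j).Nonempty := by
    rw [← Finset.card_pos, h.card_of_notMem hp hpj]; exact hj
  obtain ⟨x, hx, hmax⟩ := exists_isFarthest hR (h.subset j) hne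
  refine ⟨x, hx.1, hmax, ?_⟩
  rw [chainStep, if_neg (by rintro (h | h) <;> [omega; exact hpj h])]
  congr 1
  ext q
  rw [Finset.mem_filter, Finset.mem_erase]
  constructor
  · rintro ⟨h1, h2⟩
    exact ⟨fun he => h2 (he ▸ hx), h1⟩
  · rintro ⟨h1, h2⟩
    exact ⟨h2, fun hf => h1 (hf.eq hx fun a ha b hb => hR a (h.subset j ha) b (h.subset j hb))⟩

/-- The stack property of farthest-in-future. The delicate case is a fault in both of two nested
caches, where the smaller one must not keep a page that the larger one evicts. -/
lemma IsChain.step {K : Finset P} {T : ℕ → Finset P} (h : IsChain K T)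
    {R : P → P → Prop} {r : P → ℕ} (hR : ∀ q ∈ K, ∀ q' ∈ K, R q q' ↔ r q < r q') {p : P}
    (hp : p ∈ K) : IsChain K (chainStep R p T) := by
  classical
  refine ⟨fun j => (chainStep_subset R p T j).trans (Finset.insert_subset hp (h.subset j)),
    fun i j hij => ?_, fun j => ?_⟩
  · rcases Nat.eq_zero_or_pos i with rfl | hi
    · rw [chainStep, if_pos (Or.inl rfl), h.zero]
      exact Finset.empty_subset _
    · have hT := h.mono hij
      by_cases h1 : p ∈ T i
      · rw [chainStep_of_mem h1, chainStep_of_mem (hT h1)]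
        exact hT
      · by_cases h2 : p ∈ T j
        · rw [chainStep_of_mem h2]
          exact (chainStep_subset R p T i).trans (Finset.insert_subset h2 hT)
        · intro q hq
          rw [chainStep, if_neg (by rintro (h | h) <;> [omega; exact h1 h]),
            Finset.mem_insert, Finset.mem_filter] at hq
          rw [chainStep, if_neg (by rintro (h | h) <;> [omega; exact h2 h]),
            Finset.mem_insert, Finset.mem_filter]
          -- A page that is farthest in the larger cache and lies in the smaller one is farthest
          -- there as well.
          refine hq.imp_right fun ⟨h3, h4⟩ => ⟨hT h3, fun h5 => h4 ⟨h3, fun y hy => h5.2 y (hT hy)⟩⟩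
  · rcases Nat.eq_zero_or_pos j with rfl | hj
    · rw [chainStep, if_pos (Or.inl rfl), h.card]
    · by_cases h1 : p ∈ T j
      · rw [chainStep_of_mem h1, h.card]
      · obtain ⟨x, hx, -, he⟩ := h.chainStep_of_notMem hR hp hj h1
        rw [he, Finset.card_insert_of_notMem (fun h' => h1 (Finset.mem_of_mem_erase h')),
          Finset.card_erase_of_mem hx, ← h.card j, h.card_of_notMem hp h1]
        omega

/-- Fetched pages raise the count on the left by at most their number. When the comparison cache
shrinks, it loses at most as many pages as `S` evicts, because the chain is nested. -/
lemma Dominated.change {K : Finset P} {T : ℕ → Finset P} (h : IsChain K T) {r : P → ℕ}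
    {S S' : Finset P} {d : ℕ} (hd : Dominated r S (T S.card) d) (hS : S ⊆ K) (hS' : S' ⊆ K) :
    Dominated r S' (T S'.card) (d + (S' \ S).card + (S \ S').card) := by
  intro τ
  have h1 : (S'.filter (r · ≤ τ)).card ≤ (S.filter (r · ≤ τ)).card + (S' \ S).card := by
    refine (Finset.card_le_card (t := S.filter (r · ≤ τ) ∪ (S' \ S)) ?_).trans
      (Finset.card_union_le _ _)
    intro q hq
    rw [Finset.mem_filter] at hq
    by_cases h : q ∈ S
    · exact Finset.mem_union_left _ (Finset.mem_filter.2 ⟨h, hq.2⟩)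
    · exact Finset.mem_union_right _ (Finset.mem_sdiff.2 ⟨hq.1, h⟩)
  have h2 : ((T S.card).filter (r · ≤ τ)).card ≤
      ((T S'.card).filter (r · ≤ τ)).card + (T S.card \ T S'.card).card := by
    refine (Finset.card_le_card
      (t := (T S'.card).filter (r · ≤ τ) ∪ (T S.card \ T S'.card)) ?_).trans
      (Finset.card_union_le _ _)
    intro q hq
    rw [Finset.mem_filter] at hq
    by_cases h : q ∈ T S'.card
    · exact Finset.mem_union_left _ (Finset.mem_filter.2 ⟨h, hq.2⟩)
    · exact Finset.mem_union_right _ (Finset.mem_sdiff.2 ⟨hq.1, h⟩)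
  have h3 : (T S.card \ T S'.card).card ≤ (S \ S').card := by
    rcases le_total S.card S'.card with hle | hle
    · rw [Finset.sdiff_eq_empty_iff_subset.2 (h.mono hle)]
      simp
    · rw [Finset.card_sdiff_of_subset (h.mono hle), h.card, h.card,
        min_eq_left (Finset.card_le_card hS), min_eq_left (Finset.card_le_card hS')]
      have := Finset.le_card_sdiff S' S
      omega
  have := hd τ
  omega

/-- The potential decreases when the farthest-in-future cache faults and the other one does not. -/
lemma Dominated.serve {K : Finset P} {T : ℕ → Finset P} (h : IsChain K T)
    {R : P → P → Prop} {r r' : P → ℕ} (hR : ∀ q ∈ K, ∀ q' ∈ K, R q q' ↔ r' q < r' q') {p : P}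
    (hrp : r p = 0) (hr : ∀ q ≠ p, r q = r' q + 1) {S : Finset P} (hS : S ⊆ K) (hp : p ∈ S)
    {d : ℕ} (hd : Dominated r S (T S.card) d) :
    ∃ d', Dominated r' S (chainStep R p T S.card) d' ∧
      d' + (if p ∈ T S.card then 0 else 1) ≤ d := by
  have hcount : ∀ (A : Finset P) (τ : ℕ), p ∈ A → (A.filter (r' · ≤ τ)).card +
      (if r' p ≤ τ then 0 else 1) = (A.filter (r · ≤ τ + 1)).card := by
    intro A τ hpA
    have e1 : A.filter (r · ≤ τ + 1) = insert p ((A.erase p).filter (r' · ≤ τ)) := by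
      ext q
      simp only [Finset.mem_filter, Finset.mem_insert, Finset.mem_erase]
      rcases eq_or_ne q p with rfl | hq
      · simp [hpA, hrp]
      · simp [hq, hr q hq]
    rw [e1, Finset.card_insert_of_notMem (by simp), Finset.filter_erase]
    split_ifs with hτ
    · have hm : p ∈ A.filter (r' · ≤ τ) := Finset.mem_filter.2 ⟨hpA, hτ⟩
      have hc := Finset.card_pos.2 ⟨p, hm⟩
      rw [Finset.card_erase_of_mem hm]
      omega
    · have hm : p ∉ A.filter (r' · ≤ τ) := fun h' => hτ (Finset.mem_filter.1 h').2
      rw [Finset.erase_eq_of_notMem hm]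
  have hcount' : ∀ (A : Finset P) (τ : ℕ), p ∉ A →
      (A.filter (r' · ≤ τ)).card = (A.filter (r · ≤ τ + 1)).card := by
    intro A τ hpA
    congr 1
    refine Finset.filter_congr fun q hq => ?_
    rw [hr q (fun h' => hpA (h' ▸ hq))]
    omega
  have hs : 1 ≤ S.card := Finset.card_pos.2 ⟨p, hp⟩
  by_cases hpT : p ∈ T S.card
  · refine ⟨d, fun τ => ?_, by simp [hpT]⟩
    rw [chainStep_of_mem hpT]
    have h1 := hcount S τ hp
    have h2 := hcount _ τ hpT
    have h3 := hd (τ + 1)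
    omega
  · have hd1 : 1 ≤ d := by
      have h1 := hd 0
      have h2 : (T S.card).filter (r · ≤ 0) = ∅ := by
        refine Finset.filter_eq_empty_iff.2 fun q hq hq0 => ?_
        rw [hr q (fun h' => hpT (h' ▸ hq))] at hq0
        omega
      have h3 : 0 < (S.filter (r · ≤ 0)).card :=
        Finset.card_pos.2 ⟨p, Finset.mem_filter.2 ⟨hp, by simp [hrp]⟩⟩
      rw [h2, Finset.card_empty] at h1
      omega
    refine ⟨d - 1, fun τ => ?_, by simp [hpT]; omega⟩
    obtain ⟨x, hx, hmax, he⟩ := h.chainStep_of_notMem hR (hS hp) hs hpT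
    have hpx : p ∉ (T S.card).erase x := fun h' => hpT (Finset.mem_of_mem_erase h')
    have hTc := h.card_of_notMem (hS hp) hpT
    have h1 := hcount S τ hp
    have h2 := hcount' _ τ hpT
    have h3 := hd (τ + 1)
    have h4 : ((chainStep R p T S.card).filter (r' · ≤ τ)).card =
        (((T S.card).erase x).filter (r' · ≤ τ)).card + (if r' p ≤ τ then 1 else 0) := by
      rw [he, Finset.filter_insert]
      split_ifs with hτ
      · rw [Finset.card_insert_of_notMem fun h' => hpx (Finset.mem_filter.1 h').1]
      · rfl
    -- If the evicted page is counted at `τ`, then so is the whole remaining cache, of size `S.card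
    -- - 1`, and the bound follows from sizes alone. Otherwise the eviction is invisible at `τ`.
    by_cases hxτ : r' x ≤ τ
    · have h5 : ((T S.card).erase x).filter (r' · ≤ τ) = (T S.card).erase x :=
        Finset.filter_true_of_mem fun q hq => (hmax q (Finset.mem_of_mem_erase hq)).trans hxτ
      rw [h5, Finset.card_erase_of_mem hx, hTc] at h4
      have h6 : (S.filter (r · ≤ τ + 1)).card ≤ S.card := Finset.card_filter_le _ _
      have h7 : (S.filter (r' · ≤ τ)).card ≤ S.card := Finset.card_filter_le _ _
      split_ifs at h1 h4 <;> omega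
    · have h5 : ((T S.card).erase x).filter (r' · ≤ τ) = (T S.card).filter (r' · ≤ τ) := by
        have hm : x ∉ (T S.card).filter (r' · ≤ τ) := fun h' => hxτ (Finset.mem_filter.1 h').2
        rw [Finset.filter_erase, Finset.erase_eq_of_notMem hm]
      rw [h5] at h4
      split_ifs at h1 h4 <;> omega

end Chain

/-! ### Trajectories of allocation problems -/

section Alloc

variable {ℓ : ℕ}

lemma allocCost_nil (w : Fin ℓ → ℝ) (x : ℕ → Simplex ℓ) : allocCost w [] x = 0 := by
  simp [allocCost]

lemma allocCost_append_singleton (w : Fin ℓ → ℝ) (σ : List (AllocRequest ℓ)) (r : AllocRequest ℓ)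
    (x : ℕ → Simplex ℓ) : allocCost w (σ ++ [r]) x = allocCost w σ x +
      (moveCost w (x σ.length) (x (σ.length + 1)) + r.cost (coord (x (σ.length + 1)) r.dir)) := by
  have hl : σ.length + 1 = (σ ++ [r]).length := by simp
  rw [allocCost, ← (finCongr hl).sum_comp, Fin.sum_univ_castSucc, allocCost]
  congr 1
  · refine Finset.sum_congr rfl fun t _ => ?_
    simp [List.getElem_append_left]
  · simp

lemma allocCost_congr (w : Fin ℓ → ℝ) (σ : List (AllocRequest ℓ)) {x y : ℕ → Simplex ℓ}
    (h : ∀ t ≤ σ.length, x t = y t) : allocCost w σ x = allocCost w σ y := by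
  refine Finset.sum_congr rfl fun t _ => ?_
  rw [h t t.2.le, h (t + 1) t.2]

/-- The cost of the online algorithm `A` on the requests `σ`. -/
noncomputable def onlineCost (w : Fin ℓ → ℝ) (A : List (AllocRequest ℓ) → Simplex ℓ)
    (σ : List (AllocRequest ℓ)) : ℝ≥0∞ :=
  allocCost w σ fun t => A (σ.take t)

lemma onlineCost_append_singleton (w : Fin ℓ → ℝ) (A : List (AllocRequest ℓ) → Simplex ℓ)
    (σ : List (AllocRequest ℓ)) (r : AllocRequest ℓ) :
    onlineCost w A (σ ++ [r]) = onlineCost w A σ +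
      (moveCost w (A σ) (A (σ ++ [r])) + r.cost (coord (A (σ ++ [r])) r.dir)) := by
  have h1 : (σ ++ [r]).take (σ.length + 1) = σ ++ [r] := List.take_of_length_le (by simp)
  have h2 : (σ ++ [r]).take σ.length = σ := by simp
  rw [onlineCost, allocCost_append_singleton, h1, h2, onlineCost]
  congr 1
  refine allocCost_congr w σ fun t ht => ?_
  rw [List.take_append_of_le_length ht]

/-- Some trajectory serves `σ` from `x₀` at cost at most `v` and ends in `y`. -/
def AllocReach (w : Fin ℓ → ℝ) (x₀ : Simplex ℓ) (σ : List (AllocRequest ℓ)) (y : Simplex ℓ)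
    (v : ℝ) : Prop :=
  ∃ x : ℕ → Simplex ℓ, x 0 = x₀ ∧ x σ.length = y ∧ allocCost w σ x ≤ ENNReal.ofReal v

lemma allocReach_nil (w : Fin ℓ → ℝ) (x₀ : Simplex ℓ) : AllocReach w x₀ [] x₀ 0 :=
  ⟨fun _ => x₀, rfl, rfl, by simp [allocCost_nil]⟩

lemma AllocReach.append {w : Fin ℓ → ℝ} {x₀ y : Simplex ℓ} {σ : List (AllocRequest ℓ)} {v : ℝ}
    (h : AllocReach w x₀ σ y v) (hv : 0 ≤ v) {r : AllocRequest ℓ} {z : Simplex ℓ} {δ : ℝ}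
    (hδ : 0 ≤ δ) (hz : moveCost w y z + r.cost (coord z r.dir) ≤ ENNReal.ofReal δ) :
    AllocReach w x₀ (σ ++ [r]) z (v + δ) := by
  obtain ⟨x, h0, hy, hc⟩ := h
  refine ⟨fun t => if t ≤ σ.length then x t else z, by simp [h0], by simp, ?_⟩
  rw [allocCost_append_singleton, ENNReal.ofReal_add hv hδ]
  refine add_le_add ?_ ?_
  · rw [allocCost_congr w σ (y := x) fun t ht => by simp [ht]]
    exact hc
  · simpa [hy] using hz

lemma AllocReach.opt_le {w : Fin ℓ → ℝ} {x₀ y : Simplex ℓ} {σ : List (AllocRequest ℓ)} {v : ℝ}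
    (h : AllocReach w x₀ σ y v) : allocOpt w x₀ σ ≤ ENNReal.ofReal v := by
  obtain ⟨x, h0, -, hc⟩ := h
  exact (iInf_le _ (⟨x, h0⟩ : {x : ℕ → Simplex ℓ // x 0 = x₀})).trans hc

lemma moveCost_le_sum {w : Fin ℓ → ℝ} (hw : ∀ i, 0 < w i) (x y : Simplex ℓ) :
    moveCost w x y ≤ ENNReal.ofReal (∑ i, w i) := by
  refine ENNReal.ofReal_le_ofReal (Finset.sum_le_sum fun i _ => ?_)
  have h1 := mem_Icc_of_mem_stdSimplex x.2 i
  have h2 := mem_Icc_of_mem_stdSimplex y.2 i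
  have h3 : |y.1 i - x.1 i| ≤ 1 := by
    rw [abs_le]; constructor <;> linarith [h1.1, h1.2, h2.1, h2.2]
  exact mul_le_of_le_one_right (hw i).le h3

lemma moveCost_self (w : Fin ℓ → ℝ) (x : Simplex ℓ) : moveCost w x x = 0 := by
  simp [moveCost]

/-- A sub-probability vector, completed in coordinate `i₀` to a point of the simplex. -/
def fillCoord (i₀ : Fin ℓ) (z : Fin ℓ → ℝ) (i : Fin ℓ) : ℝ :=
  if i = i₀ then 1 - ∑ j ∈ Finset.univ.erase i₀, z j else z i

lemma le_fillCoord (i₀ : Fin ℓ) {z : Fin ℓ → ℝ} (hs : ∑ i, z i ≤ 1) (i : Fin ℓ) :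
    z i ≤ fillCoord i₀ z i := by
  rw [fillCoord]
  split_ifs with h
  · subst h
    rw [← Finset.add_sum_erase _ _ (Finset.mem_univ i)] at hs
    linarith
  · rfl

lemma sum_fillCoord (i₀ : Fin ℓ) (z : Fin ℓ → ℝ) : ∑ i, fillCoord i₀ z i = 1 := by
  rw [← Finset.add_sum_erase _ _ (Finset.mem_univ i₀)]
  have : ∑ i ∈ Finset.univ.erase i₀, fillCoord i₀ z i = ∑ i ∈ Finset.univ.erase i₀, z i :=
    Finset.sum_congr rfl fun i hi => if_neg (Finset.ne_of_mem_erase hi)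
  rw [this, fillCoord, if_pos rfl]
  ring

/-- A sub-probability vector, completed in coordinate `i₀` to a point of the simplex. -/
def fillSimplex (i₀ : Fin ℓ) (z : Fin ℓ → ℝ) (h0 : ∀ i, 0 ≤ z i) (hs : ∑ i, z i ≤ 1) :
    Simplex ℓ :=
  ⟨fillCoord i₀ z, fun i => (h0 i).trans (le_fillCoord i₀ hs i), sum_fillCoord i₀ z⟩

/-- If `i₀` is the cheapest coordinate, then completing at most doubles the movement. -/
lemma sum_abs_fillCoord_sub_le {w : Fin ℓ → ℝ} {i₀ : Fin ℓ} (hw : ∀ i, w i₀ ≤ w i)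
    (h0 : 0 ≤ w i₀) (z z' : Fin ℓ → ℝ) :
    ∑ i, w i * |fillCoord i₀ z' i - fillCoord i₀ z i| ≤ 2 * ∑ i, w i * |z' i - z i| := by
  have h1 : ∑ i ∈ Finset.univ.erase i₀, w i * |fillCoord i₀ z' i - fillCoord i₀ z i| =
      ∑ i ∈ Finset.univ.erase i₀, w i * |z' i - z i| :=
    Finset.sum_congr rfl fun i hi => by
      rw [fillCoord, fillCoord, if_neg (Finset.ne_of_mem_erase hi),
        if_neg (Finset.ne_of_mem_erase hi)]
  have h2 : w i₀ * |fillCoord i₀ z' i₀ - fillCoord i₀ z i₀| ≤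
      ∑ i ∈ Finset.univ.erase i₀, w i * |z' i - z i| := by
    rw [fillCoord, fillCoord, if_pos rfl, if_pos rfl, sub_sub_sub_cancel_left,
      ← Finset.sum_sub_distrib]
    refine (mul_le_mul_of_nonneg_left (Finset.abs_sum_le_sum_abs _ _) h0).trans ?_
    rw [Finset.mul_sum]
    refine Finset.sum_le_sum fun i _ => ?_
    rw [abs_sub_comm]
    exact mul_le_mul_of_nonneg_right (hw i) (abs_nonneg _)
  have h3 : 0 ≤ w i₀ * |z' i₀ - z i₀| := mul_nonneg h0 (abs_nonneg _)
  rw [← Finset.add_sum_erase _ _ (Finset.mem_univ i₀),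
    ← Finset.add_sum_erase _ (fun i => w i * |z' i - z i|) (Finset.mem_univ i₀), h1]
  linarith

end Alloc

/-! ### Simulating paging by soft allocation -/

/-- For classes other than the requested one, serving a request merely brings all next requests one
step closer. -/
lemma Dominated.shift {P : Type*} {r r' : P → ℕ} {S T : Finset P} {d : ℕ}
    (hd : Dominated r S T d) (hS : ∀ q ∈ S, r q = r' q + 1) (hT : ∀ q ∈ T, r q = r' q + 1) :
    Dominated r' S T d := fun τ => by
  have h1 : S.filter (r' · ≤ τ) = S.filter (r · ≤ τ + 1) :=
    Finset.filter_congr fun q hq => by rw [hS q hq]; omega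
  have h2 : T.filter (r' · ≤ τ) = T.filter (r · ≤ τ + 1) :=
    Finset.filter_congr fun q hq => by rw [hT q hq]; omega
  rw [h1, h2]
  exact hd _

/-- The soft threshold request that charges `ε` in coordinate `c` below `θ`. -/
noncomputable def softRequest {ℓ : ℕ} (c : Fin ℓ) (ε θ : ℝ) : AllocRequest ℓ :=
  ⟨c, fun z => if (z : ℝ) < θ then ENNReal.ofReal ε else 0⟩

lemma isSoftThreshold_softRequest {ℓ : ℕ} (c : Fin ℓ) {ε θ : ℝ} (hε : 0 < ε) (hθ : 0 < θ) :
    IsSoftThreshold (softRequest c ε θ) := ⟨ε, θ, hε, hθ, fun _ => rfl⟩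

namespace PagingInstance

variable {ℓ : ℕ} (I : PagingInstance ℓ)

/-- The pages of class `c`. -/
def classPages (c : Fin ℓ) : Finset I.Page := Finset.univ.filter (I.cls · = c)

/-- The pages of class `c` in the cache `S`. -/
def part (S : Finset I.Page) (c : Fin ℓ) : Finset I.Page := S.filter (I.cls · = c)

/-- The total weight of the pages that are fetched when the cache changes from `S` to `S'`. -/
noncomputable def fetchWeight (S S' : Finset I.Page) : ℝ := ∑ p ∈ S' \ S, I.weight (I.cls p)

lemma fetchWeight_nonneg (S S' : Finset I.Page) : 0 ≤ I.fetchWeight S S' :=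
  Finset.sum_nonneg fun _ _ => (I.weight_pos _).le

lemma cost_eq (T : ℕ) (S : ℕ → Finset I.Page) :
    I.cost T S = ENNReal.ofReal (∑ t ∈ Finset.range T, I.fetchWeight (S t) (S (t + 1))) := by
  rw [cost, ENNReal.ofReal_sum_of_nonneg fun t _ => I.fetchWeight_nonneg _ _]
  refine Finset.sum_congr rfl fun t _ => ?_
  rw [fetchWeight, ENNReal.ofReal_sum_of_nonneg fun p _ => (I.weight_pos _).le]

lemma part_subset (S : Finset I.Page) (c : Fin ℓ) : I.part S c ⊆ I.classPages c := fun p hp => by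
  simp only [part, classPages, Finset.mem_filter, Finset.mem_univ, true_and] at hp ⊢
  exact hp.2

lemma mem_part {S : Finset I.Page} {c : Fin ℓ} {p : I.Page} :
    p ∈ I.part S c ↔ p ∈ S ∧ I.cls p = c := Finset.mem_filter

lemma mem_classPages {c : Fin ℓ} {p : I.Page} : p ∈ I.classPages c ↔ I.cls p = c := by
  simp [classPages]

lemma fetchWeight_eq (S S' : Finset I.Page) : I.fetchWeight S S' =
    ∑ c, I.weight c * (I.part S' c \ I.part S c).card := by
  rw [fetchWeight, ← Finset.sum_fiberwise _ I.cls]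
  refine Finset.sum_congr rfl fun c _ => ?_
  rw [Finset.sum_congr rfl fun p hp => by rw [(Finset.mem_filter.1 hp).2], Finset.sum_const,
    nsmul_eq_mul, mul_comm]
  congr 3
  ext p
  simp only [part, Finset.mem_filter, Finset.mem_sdiff]
  tauto

lemma sum_card_part (S : Finset I.Page) : ∑ c, (I.part S c).card = S.card :=
  (Finset.card_eq_sum_card_fiberwise (fun _ _ => Finset.mem_univ _)).symm

lemma card_part_eq (S S' : Finset I.Page) (c : Fin ℓ) :
    (I.part S' c).card + (I.part S c \ I.part S' c).card =
      (I.part S c).card + (I.part S' c \ I.part S c).card := by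
  have h1 := Finset.card_sdiff_add_card (I.part S c) (I.part S' c)
  have h2 := Finset.card_sdiff_add_card (I.part S' c) (I.part S c)
  rw [Finset.union_comm] at h2
  omega

lemma observations_length (σ : List I.Page) : (I.observations σ).length = σ.length := by
  induction σ with
  | nil => rfl
  | cons p σ ih => simp [observations, ih]

lemma observations_take_succ (σ : List I.Page) (t : ℕ) (ht : t < σ.length) :
    (I.observations σ).take (t + 1) =
      (I.observations σ).take t ++ [(σ[t], I.Earlier (σ.drop (t + 1)))] := by
  induction σ generalizing t with
  | nil => simp at ht
  | cons p σ ih =>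
    cases t with
    | zero => simp [observations]
    | succ t => simp [observations, ih t (by simpa using ht)]

lemma earlier_iff {fut : List I.Page} {c : Fin ℓ} : ∀ q ∈ I.classPages c, ∀ q' ∈ I.classPages c,
    I.Earlier fut q q' ↔ fut.idxOf q < fut.idxOf q' := fun q hq q' hq' => by
  rw [mem_classPages] at hq hq'
  simp [Earlier, hq, hq']

/-- The smallest size at which page `p` is contained in the caches `T`. -/
noncomputable def position (T : Fin ℓ → ℕ → Finset I.Page) (p : I.Page) : ℕ :=
  sInf {j | p ∈ T (I.cls p) j}

/-- The two requests by which a request to page `p` is simulated. -/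
noncomputable def simRequests (T : Fin ℓ → ℕ → Finset I.Page) (p : I.Page) (ε : ℝ) :
    List (AllocRequest ℓ) :=
  [softRequest (I.cls p) (I.weight (I.cls p)) (I.position T p / I.k),
    softRequest (I.cls p) ε (1 / I.k)]

/-- One step of the simulation: update the caches of the requested class, and issue the
corresponding allocation requests. -/
noncomputable def simStep (E : ℕ → ℝ)
    (s : (Fin ℓ → ℕ → Finset I.Page) × List (AllocRequest ℓ)) (o : I.Observation) :
    (Fin ℓ → ℕ → Finset I.Page) × List (AllocRequest ℓ) :=
  (Function.update s.1 (I.cls o.1) (chainStep o.2 o.1 (s.1 (I.cls o.1))),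
    s.2 ++ I.simRequests s.1 o.1 (E s.2.length))

/-- The state of the simulation after the observations `h`. -/
noncomputable def sim (E : ℕ → ℝ) (T₀ : Fin ℓ → ℕ → Finset I.Page) (h : List I.Observation) :
    (Fin ℓ → ℕ → Finset I.Page) × List (AllocRequest ℓ) :=
  h.foldl (I.simStep E) (T₀, [])

/-- The state of the simulation after the first `t` requests of `σ`. -/
noncomputable def simAt (E : ℕ → ℝ) (T₀ : Fin ℓ → ℕ → Finset I.Page) (σ : List I.Page) (t : ℕ) :
    (Fin ℓ → ℕ → Finset I.Page) × List (AllocRequest ℓ) :=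
  I.sim E T₀ ((I.observations σ).take t)

lemma simAt_succ (E : ℕ → ℝ) (T₀ : Fin ℓ → ℕ → Finset I.Page) (σ : List I.Page) (t : ℕ)
    (ht : t < σ.length) : I.simAt E T₀ σ (t + 1) =
      I.simStep E (I.simAt E T₀ σ t) (σ[t], I.Earlier (σ.drop (t + 1))) := by
  simp [simAt, sim, I.observations_take_succ σ t ht]

lemma isChain_simAt (E : ℕ → ℝ) {T₀ : Fin ℓ → ℕ → Finset I.Page}
    (hT₀ : ∀ c, IsChain (I.classPages c) (T₀ c)) (σ : List I.Page) (t : ℕ) (ht : t ≤ σ.length)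
    (c : Fin ℓ) : IsChain (I.classPages c) ((I.simAt E T₀ σ t).1 c) := by
  induction t with
  | zero => exact hT₀ c
  | succ t ih =>
    rw [I.simAt_succ E T₀ σ t ht, simStep]
    rcases eq_or_ne c (I.cls σ[t]) with rfl | hc
    · simp only [Function.update_self]
      exact (ih (by omega)).step I.earlier_iff (I.mem_classPages.2 rfl)
    · simp only [Function.update_of_ne hc]
      exact ih (by omega)

lemma mem_of_position_le {T : Fin ℓ → ℕ → Finset I.Page} {p : I.Page}
    (hT : IsChain (I.classPages (I.cls p)) (T (I.cls p))) {j : ℕ} (h : I.position T p ≤ j) :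
    p ∈ T (I.cls p) j := by
  have hne : {j | p ∈ T (I.cls p) j}.Nonempty :=
    ⟨(I.classPages (I.cls p)).card, by
      change p ∈ T (I.cls p) _
      rw [hT.eq_of_card_le le_rfl]; exact I.mem_classPages.2 rfl⟩
  exact hT.mono h (Nat.sInf_mem hne)

lemma position_le {T : Fin ℓ → ℕ → Finset I.Page} {p : I.Page} {j : ℕ}
    (h : p ∈ T (I.cls p) j) : I.position T p ≤ j := Nat.sInf_le h

lemma position_pos {T : Fin ℓ → ℕ → Finset I.Page} {p : I.Page}
    (hT : IsChain (I.classPages (I.cls p)) (T (I.cls p))) : 0 < I.position T p := by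
  by_contra h
  have := I.mem_of_position_le hT (not_lt.1 h)
  rw [hT.zero] at this
  simp at this

/-- The fractions of the cache slots used by the classes. -/
noncomputable def share (S : Finset I.Page) (i : Fin ℓ) : ℝ := (I.part S i).card / I.k

lemma k_pos' : (0 : ℝ) < I.k := by exact_mod_cast I.k_pos

lemma share_nonneg (S : Finset I.Page) (i : Fin ℓ) : 0 ≤ I.share S i := by
  unfold share; positivity

lemma sum_share_le {S : Finset I.Page} (h : S.card ≤ I.k) : ∑ i, I.share S i ≤ 1 := by
  simp only [share]
  rw [← Finset.sum_div, div_le_one I.k_pos', ← Nat.cast_sum, sum_card_part]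
  exact_mod_cast h

open Classical in
/-- The division of the cache among the classes given by `S`; unused slots go to class `i₀`. -/
noncomputable def division (i₀ : Fin ℓ) (S : Finset I.Page) : Simplex ℓ :=
  if h : S.card ≤ I.k then fillSimplex i₀ (I.share S) (I.share_nonneg S) (I.sum_share_le h)
  else ⟨Pi.single i₀ 1, single_mem_stdSimplex ℝ i₀⟩

lemma division_val (i₀ : Fin ℓ) {S : Finset I.Page} (h : S.card ≤ I.k) :
    (I.division i₀ S).1 = fillCoord i₀ (I.share S) := by
  rw [division, dif_pos h]; rfl

/-- With weights scaled by `k`, one slot of class `i` costs `I.weight i` to move. Leaving the unused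
slots with a cheapest class accounts for the factor 2. -/
lemma moveCost_division_le {i₀ : Fin ℓ} (hi₀ : ∀ i, I.weight i₀ ≤ I.weight i)
    {S S' : Finset I.Page} (h : S.card ≤ I.k) (h' : S'.card ≤ I.k) :
    moveCost (fun i => I.k * I.weight i) (I.division i₀ S) (I.division i₀ S') ≤
      ENNReal.ofReal (2 * ∑ i, I.weight i * |((I.part S' i).card : ℝ) - (I.part S i).card|) := by
  refine ENNReal.ofReal_le_ofReal ?_
  rw [I.division_val i₀ h, I.division_val i₀ h']
  refine (sum_abs_fillCoord_sub_le (w := fun i => I.k * I.weight i)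
    (fun i => mul_le_mul_of_nonneg_left (hi₀ i) I.k_pos'.le)
    (mul_nonneg I.k_pos'.le (I.weight_pos _).le) _ _).trans (le_of_eq ?_)
  congr 1
  refine Finset.sum_congr rfl fun i _ => ?_
  rw [share, share, ← sub_div, abs_div, abs_of_pos I.k_pos']
  have := I.k_pos'.ne'
  field_simp

/-- The allocation requests of the simulation can be served at a cost that is proportional to
the cost of any way to serve the page requests. -/
lemma exists_allocReach (E : ℕ → ℝ) {T₀ : Fin ℓ → ℕ → Finset I.Page}
    (hT₀ : ∀ c, IsChain (I.classPages c) (T₀ c)) {i₀ : Fin ℓ}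
    (hi₀ : ∀ i, I.weight i₀ ≤ I.weight i) {σ : List I.Page} {S : ℕ → Finset I.Page}
    (hS : I.Serves σ S) (t : ℕ) (ht : t ≤ σ.length) :
    ∃ (d : Fin ℓ → ℕ) (v : ℝ), 0 ≤ v ∧
      (∀ c, Dominated (fun q => (σ.drop t).idxOf q) (I.part (S t) c)
        ((I.simAt E T₀ σ t).1 c (I.part (S t) c).card) (d c)) ∧
      AllocReach (fun i => I.k * I.weight i) (I.division i₀ I.init) (I.simAt E T₀ σ t).2
        (I.division i₀ (S t)) v ∧
      v + ∑ c, I.weight c * (d c + 3 * (I.part (S t) c).card) ≤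
        ∑ c, I.weight c * (4 * (I.part I.init c).card) +
          6 * ∑ s ∈ Finset.range t, I.fetchWeight (S s) (S (s + 1)) := by
  have hcard : ∀ t ≤ σ.length, (S t).card ≤ I.k := by
    intro t ht
    cases t with
    | zero => rw [hS.1]; exact I.init_card
    | succ t => exact (hS.2 ⟨t, ht⟩).2
  induction t with
  | zero =>
    refine ⟨fun c => (I.part (S 0) c).card, 0, le_rfl, fun c => dominated_card _ _ _, ?_, ?_⟩
    · rw [hS.1]
      exact allocReach_nil _ _
    · rw [hS.1, zero_add, Finset.range_zero, Finset.sum_empty, mul_zero, add_zero]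
      exact le_of_eq (Finset.sum_congr rfl fun c _ => by ring)
  | succ t ih =>
    obtain ⟨d, v, hv, hd, hr, hb⟩ := ih (by omega)
    have ht' : t < σ.length := ht
    have hT := I.isChain_simAt E hT₀ σ t ht'.le
    rw [I.simAt_succ E T₀ σ t ht', simStep]
    set T := (I.simAt E T₀ σ t).1 with hTdef
    set ρ := (I.simAt E T₀ σ t).2 with hρ
    set p := σ[t] with hp
    set c := I.cls p with hc
    set fut := σ.drop (t + 1) with hfut
    set S' := S (t + 1) with hS'
    have hpS' : p ∈ S' := (hS.2 ⟨t, ht'⟩).1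
    have hcard' : S'.card ≤ I.k := hcard _ ht
    have hdrop : σ.drop t = p :: fut := List.drop_eq_getElem_cons ht'
    have hidx : ∀ q ≠ p, (σ.drop t).idxOf q = fut.idxOf q + 1 := fun q hq => by
      rw [hdrop, List.idxOf_cons_ne _ (Ne.symm hq)]
    set f : Fin ℓ → ℕ := fun c => (I.part S' c \ I.part (S t) c).card with hf
    set e : Fin ℓ → ℕ := fun c => (I.part (S t) c \ I.part S' c).card with he
    have hd1 : ∀ c, Dominated (fun q => (σ.drop t).idxOf q) (I.part S' c)
        (T c (I.part S' c).card) (d c + f c + e c) := fun c =>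
      (hd c).change (hT c) (I.part_subset _ _) (I.part_subset _ _)
    obtain ⟨d', hd', hdle⟩ := (hd1 c).serve (R := I.Earlier fut) (r' := fun q => fut.idxOf q)
      (hT c) I.earlier_iff (by simp [hdrop]) hidx (I.part_subset _ _)
      (I.mem_part.2 ⟨hpS', rfl⟩)
    set fault : ℕ := if p ∈ T c (I.part S' c).card then 0 else 1 with hfault
    set d2 : Fin ℓ → ℕ := Function.update (fun c => d c + f c + e c) c d' with hd2
    set s := (I.part S' c).card with hs
    have hs1 : 1 ≤ s := Finset.card_pos.2 ⟨p, I.mem_part.2 ⟨hpS', rfl⟩⟩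
    have hle : (s : ℝ) / I.k ≤ (I.division i₀ S').1 c := by
      rw [I.division_val i₀ hcard']
      exact le_fillCoord i₀ (I.sum_share_le hcard') c
    set m : ℝ := 2 * ∑ i, I.weight i * |((I.part S' i).card : ℝ) - (I.part (S t) i).card| with hm
    have hm0 : 0 ≤ m := mul_nonneg zero_le_two
      (Finset.sum_nonneg fun i _ => mul_nonneg (I.weight_pos i).le (abs_nonneg _))
    have hW : 0 < I.weight c := I.weight_pos c
    -- The first request is paid for by the move and by a possible fault of the farthest-in-future
    -- cache with as many slots as the schedule uses. The second is free, since the schedule holds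
    -- `p` and so gives its class at least one slot.
    refine ⟨d2, v + (m + I.weight c * fault) + 0, by positivity, fun c' => ?_, ?_, ?_⟩
    · rcases eq_or_ne c' c with rfl | hne
      · simp only [hd2, Function.update_self]
        exact hd'
      · simp only [hd2, Function.update_of_ne hne]
        refine (hd1 c').shift (fun q hq => hidx q ?_) (fun q hq => hidx q ?_)
        · rintro rfl
          exact hne ((I.mem_part.1 hq).2.symm)
        · rintro rfl
          exact hne (I.mem_classPages.1 ((hT c').subset _ hq)).symm
    · have hsplit : ρ ++ I.simRequests T p (E ρ.length) =
          (ρ ++ [softRequest c (I.weight c) (I.position T p / I.k)]) ++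
            [softRequest c (E ρ.length) (1 / I.k)] := by
        simp [simRequests, hc]
      rw [hsplit]
      refine (hr.append (z := I.division i₀ S') hv (by positivity) ?_).append (by positivity)
        le_rfl ?_
      · rw [ENNReal.ofReal_add hm0 (by positivity)]
        refine add_le_add (I.moveCost_division_le hi₀ (hcard _ ht'.le) hcard') ?_
        simp only [softRequest, coord]
        split_ifs with hlt
        · have h1 : p ∉ T c s := fun h => by
            have h2 : (I.position T p : ℝ) ≤ s := by exact_mod_cast I.position_le h
            have h3 := div_le_div_of_nonneg_right h2 I.k_pos'.le
            linarith
          simp [hfault, h1]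
        · exact zero_le
      · rw [moveCost_self, zero_add]
        simp only [softRequest, coord]
        rw [if_neg]
        · exact zero_le
        · have h1 : (1 : ℝ) ≤ s := by exact_mod_cast hs1
          have h3 := div_le_div_of_nonneg_right h1 I.k_pos'.le
          linarith
    · rw [Finset.sum_range_succ]
      have hfw : I.fetchWeight (S t) S' = ∑ c, I.weight c * f c := I.fetchWeight_eq _ _
      have hflt : I.weight c * (fault : ℝ) = ∑ c', I.weight c' * (if c' = c then (fault : ℝ) else 0) := by
        simp
      rw [← hS', hfw]
      -- Per class, with `f` fetches and `e` evictions: movement is at most `2 (f + e)`, and fault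
      -- plus new lag exceed the old lag by at most `f + e`. As the new size plus `e` equals the old
      -- size plus `f`, three times the size in the potential turns `3 (f + e)` into `6 f`, so
      -- evictions are paid for by fetches.
      have key : ∑ c', I.weight c' * (2 * |((I.part S' c').card : ℝ) - (I.part (S t) c').card| +
          (if c' = c then (fault : ℝ) else 0) + (d2 c' + 3 * (I.part S' c').card)) ≤
          ∑ c', I.weight c' * (d c' + 3 * (I.part (S t) c').card + 6 * f c') := by
        refine Finset.sum_le_sum fun c' _ => mul_le_mul_of_nonneg_left ?_ (I.weight_pos c').le
        have h1 : ((I.part S' c').card : ℝ) + e c' = (I.part (S t) c').card + f c' := by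
          exact_mod_cast I.card_part_eq (S t) S' c'
        have h2 : (if c' = c then (fault : ℝ) else 0) + d2 c' ≤ d c' + f c' + e c' := by
          rcases eq_or_ne c' c with rfl | hne
          · simp only [hd2, Function.update_self, if_true]
            have : d' + fault ≤ d c + f c + e c := hdle
            have h' : (d' : ℝ) + fault ≤ d c + f c + e c := by exact_mod_cast this
            linarith
          · simp [hd2, hne]
        have h3 : |((I.part S' c').card : ℝ) - (I.part (S t) c').card| ≤ f c' + e c' := by
          rw [abs_le]
          have h4 : (0 : ℝ) ≤ f c' := Nat.cast_nonneg _
          have h5 : (0 : ℝ) ≤ e c' := Nat.cast_nonneg _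
          constructor <;> linarith
        linarith
      simp only [mul_add, Finset.sum_add_distrib, ← hflt] at key hb ⊢
      have e1 : ∀ g : Fin ℓ → ℝ, ∑ i, I.weight i * (6 * g i) = 6 * ∑ i, I.weight i * g i :=
        fun g => by
          rw [Finset.mul_sum]; exact Finset.sum_congr rfl fun i _ => by ring
      have e2 : ∀ g : Fin ℓ → ℝ, ∑ i, I.weight i * (2 * g i) = 2 * ∑ i, I.weight i * g i :=
        fun g => by
          rw [Finset.mul_sum]; exact Finset.sum_congr rfl fun i _ => by ring
      rw [e1, e2, ← hm] at key
      linarith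

end PagingInstance

/-! ### Feasibility of the simulation and the cost of its steps -/

namespace PagingInstance

variable {ℓ : ℕ} (I : PagingInstance ℓ)

lemma simAt_requests_succ (E : ℕ → ℝ) (T₀ : Fin ℓ → ℕ → Finset I.Page) (σ : List I.Page) (t : ℕ)
    (ht : t < σ.length) : (I.simAt E T₀ σ (t + 1)).2 = (I.simAt E T₀ σ t).2 ++
      I.simRequests (I.simAt E T₀ σ t).1 σ[t] (E (I.simAt E T₀ σ t).2.length) := by
  rw [I.simAt_succ E T₀ σ t ht, simStep]

lemma simRequests_eq (ρ : List (AllocRequest ℓ)) (T : Fin ℓ → ℕ → Finset I.Page) (p : I.Page)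
    (ε : ℝ) : ρ ++ I.simRequests T p ε =
      (ρ ++ [softRequest (I.cls p) (I.weight (I.cls p)) (I.position T p / I.k)]) ++
        [softRequest (I.cls p) ε (1 / I.k)] := by
  simp [simRequests]

lemma length_simAt_requests (E : ℕ → ℝ) (T₀ : Fin ℓ → ℕ → Finset I.Page) (σ : List I.Page) (t : ℕ)
    (ht : t ≤ σ.length) : (I.simAt E T₀ σ t).2.length = 2 * t := by
  induction t with
  | zero => rfl
  | succ t ih =>
    rw [I.simAt_requests_succ E T₀ σ t ht, List.length_append, ih (by omega)]
    simp [simRequests]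
    ring

lemma isSoftThreshold_simAt {E : ℕ → ℝ} (hE : ∀ n, 0 < E n) {T₀ : Fin ℓ → ℕ → Finset I.Page}
    (hT₀ : ∀ c, IsChain (I.classPages c) (T₀ c)) (σ : List I.Page) (t : ℕ) (ht : t ≤ σ.length) :
    ∀ r ∈ (I.simAt E T₀ σ t).2, IsSoftThreshold r := by
  induction t with
  | zero => simp [simAt, sim]
  | succ t ih =>
    intro r hr
    rw [I.simAt_requests_succ E T₀ σ t ht, List.mem_append] at hr
    rcases hr with hr | hr
    · exact ih (by omega) r hr
    · have hk := I.k_pos'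
      have hpos := I.position_pos (p := σ[t]) (I.isChain_simAt E hT₀ σ t (by omega) _)
      have hpos' : (0 : ℝ) < I.position (I.simAt E T₀ σ t).1 σ[t] := by exact_mod_cast hpos
      simp only [simRequests, List.mem_cons, List.not_mem_nil, or_false] at hr
      rcases hr with rfl | rfl
      · exact isSoftThreshold_softRequest _ (I.weight_pos _) (by positivity)
      · exact isSoftThreshold_softRequest _ (hE _) (by positivity)

/-- The requests of the simulation can be served by always moving everything to the requested
class. -/
lemma exists_allocReach_vertex (E : ℕ → ℝ) (T₀ : Fin ℓ → ℕ → Finset I.Page) (x₀ : Simplex ℓ)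
    (σ : List I.Page) (t : ℕ) (ht : t ≤ σ.length) :
    ∃ y v, 0 ≤ v ∧ AllocReach (fun i => I.k * I.weight i) x₀ (I.simAt E T₀ σ t).2 y v ∧
      v ≤ (∑ i, I.k * I.weight i + ∑ i, I.weight i) * t := by
  induction t with
  | zero => exact ⟨x₀, 0, le_rfl, allocReach_nil _ _, by simp⟩
  | succ t ih =>
    obtain ⟨y, v, hv, hr, hb⟩ := ih (by omega)
    have hw : ∀ i, 0 < I.k * I.weight i := fun i => mul_pos I.k_pos' (I.weight_pos i)
    have h0 : 0 ≤ ∑ i, I.weight i := Finset.sum_nonneg fun i _ => (I.weight_pos i).le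
    have h1 : 0 ≤ ∑ i, I.k * I.weight i := Finset.sum_nonneg fun i _ => (hw i).le
    set c := I.cls σ[t] with hc
    have hk1 : (1 : ℝ) ≤ I.k := by exact_mod_cast I.k_pos
    rw [I.simAt_requests_succ E T₀ σ t ht, simRequests_eq]
    refine ⟨⟨Pi.single c 1, single_mem_stdSimplex ℝ c⟩,
      v + (∑ i, I.k * I.weight i + ∑ i, I.weight i) + 0, by positivity, ?_, ?_⟩
    · refine (hr.append (z := ⟨Pi.single c 1, single_mem_stdSimplex ℝ c⟩) hv (by positivity)
        ?_).append (by positivity) le_rfl ?_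
      · rw [ENNReal.ofReal_add h1 h0]
        refine add_le_add (moveCost_le_sum hw _ _) ?_
        simp only [softRequest]
        split_ifs
        · exact ENNReal.ofReal_le_ofReal
            (Finset.single_le_sum (fun i _ => (I.weight_pos i).le) (Finset.mem_univ _))
        · exact zero_le
      · rw [moveCost_self, zero_add]
        simp only [softRequest, coord]
        rw [if_neg]
        · exact zero_le
        · simp only [hc, Pi.single_eq_same, not_lt]
          rw [div_le_one I.k_pos']
          exact hk1
    · push_cast
      linarith

/-- The cost that is charged for violating the requirement that the requested class holds a slot
is prohibitive. -/
lemma one_div_le_of_competitive {φ a : ℝ≥0} {E : ℕ → ℝ}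
    (hE : ∀ n, E n = φ * (∑ i, I.k * I.weight i + ∑ i, I.weight i) * (n + 1) + a + 1)
    {T₀ : Fin ℓ → ℕ → Finset I.Page} (hT₀ : ∀ c, IsChain (I.classPages c) (T₀ c))
    {x₀ : Simplex ℓ} {A : List (AllocRequest ℓ) → Simplex ℓ}
    (hA : ∀ ρ : List (AllocRequest ℓ), (∀ r ∈ ρ, IsSoftThreshold r) →
      onlineCost (fun i => I.k * I.weight i) A ρ ≤
        φ * allocOpt (fun i => I.k * I.weight i) x₀ ρ + a)
    (σ : List I.Page) (t : ℕ) (ht : t < σ.length) :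
    1 / (I.k : ℝ) ≤ (A (I.simAt E T₀ σ (t + 1)).2).1 (I.cls σ[t]) := by
  set K := ∑ i, I.k * I.weight i + ∑ i, I.weight i with hK
  have hK0 : 0 ≤ K := add_nonneg
    (Finset.sum_nonneg fun i _ => mul_nonneg I.k_pos'.le (I.weight_pos i).le)
    (Finset.sum_nonneg fun i _ => (I.weight_pos i).le)
  have hEpos : ∀ n, 0 < E n := fun n => by rw [hE]; positivity
  by_contra hlt
  rw [not_le] at hlt
  have h1 := hA _ (I.isSoftThreshold_simAt hEpos hT₀ σ (t + 1) ht)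
  obtain ⟨y, v, hv, hr, hb⟩ := I.exists_allocReach_vertex E T₀ x₀ σ (t + 1) ht
  have h2 : ENNReal.ofReal (E (2 * t)) ≤
      onlineCost (fun i => I.k * I.weight i) A (I.simAt E T₀ σ (t + 1)).2 := by
    have hlen := I.length_simAt_requests E T₀ σ t ht.le
    rw [I.simAt_requests_succ E T₀ σ t ht, simRequests_eq] at hlt ⊢
    rw [onlineCost_append_singleton]
    refine le_add_left (le_add_left ?_)
    simp only [softRequest, coord] at hlt ⊢
    rw [if_pos hlt, hlen]
  have h3 : (φ : ℝ≥0∞) * allocOpt (fun i => I.k * I.weight i) x₀ (I.simAt E T₀ σ (t + 1)).2 + a ≤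
      ENNReal.ofReal (φ * (K * (t + 1)) + a) := by
    rw [ENNReal.ofReal_add (by positivity) (by positivity), ENNReal.ofReal_mul (by positivity),
      ENNReal.ofReal_coe_nnreal, ENNReal.ofReal_coe_nnreal]
    gcongr
    refine hr.opt_le.trans (ENNReal.ofReal_le_ofReal ?_)
    exact_mod_cast hb
  have h4 := (ENNReal.ofReal_le_ofReal_iff (by positivity)).1 ((h2.trans h1).trans h3)
  rw [hE] at h4
  -- `E` is evaluated at the number `2 * t` of earlier allocation requests, which still dominates
  -- the bound for `t + 1` served pages; the summand `1` in `E` makes the contradiction strict.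
  have h5 : (φ : ℝ) * (K * (t + 1)) ≤ φ * K * ((2 * t : ℕ) + 1) := by
    rw [mul_assoc]
    have : (0 : ℝ) ≤ t := Nat.cast_nonneg _
    push_cast
    gcongr
    linarith
  linarith

/-- The cache that consists of `n c` pages of class `c`, according to the caches `T c` of all
sizes. -/
def pool (T : Fin ℓ → ℕ → Finset I.Page) (n : Fin ℓ → ℕ) : Finset I.Page :=
  Finset.univ.biUnion fun c => T c (n c)

lemma part_pool {T : Fin ℓ → ℕ → Finset I.Page} (hT : ∀ c, IsChain (I.classPages c) (T c))
    (n : Fin ℓ → ℕ) (c : Fin ℓ) : I.part (I.pool T n) c = T c (n c) := by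
  ext p
  simp only [pool, mem_part, Finset.mem_biUnion, Finset.mem_univ, true_and]
  constructor
  · rintro ⟨⟨c', h⟩, rfl⟩
    rwa [← I.mem_classPages.1 ((hT c').subset _ h)] at h
  · intro h
    exact ⟨⟨c, h⟩, I.mem_classPages.1 ((hT c).subset _ h)⟩

lemma card_pool_le {T : Fin ℓ → ℕ → Finset I.Page} (hT : ∀ c, IsChain (I.classPages c) (T c))
    (n : Fin ℓ → ℕ) : (I.pool T n).card ≤ ∑ c, n c :=
  Finset.card_biUnion_le.trans (Finset.sum_le_sum fun c _ => by
    rw [(hT c).card]; exact min_le_left _ _)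

/-- Because the caches are nested, a change of the number of slots fetches no more pages than there
are new slots. -/
lemma card_sdiff_le_abs {K : Finset I.Page} {T : ℕ → Finset I.Page} (hT : IsChain K T) (m n : ℕ) :
    ((T n \ T m).card : ℝ) ≤ |(n : ℝ) - m| := by
  rcases le_total n m with h | h
  · rw [Finset.sdiff_eq_empty_iff_subset.2 (hT.mono h)]
    simp
  · rw [Finset.card_sdiff_of_subset (hT.mono h), hT.card, hT.card]
    have h1 : min n K.card - min m K.card ≤ n - m := by omega
    have h2 : ((n - m : ℕ) : ℝ) = n - m := Nat.cast_sub h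
    rw [abs_of_nonneg (by rw [← h2]; positivity), ← h2]
    exact_mod_cast h1

open Classical in
/-- The cost of one step of the simulation: the number of slots of the classes changes from `n` to
`m`, the request to `p` is served, and then the number of slots changes to `n'`. -/
lemma fetchWeight_pool_le {T T' : Fin ℓ → ℕ → Finset I.Page}
    (hT : ∀ c, IsChain (I.classPages c) (T c)) (hT' : ∀ c, IsChain (I.classPages c) (T' c))
    {R : I.Page → I.Page → Prop} {p : I.Page}
    (hTT' : T' = Function.update T (I.cls p) (chainStep R p (T (I.cls p))))
    (n m n' : Fin ℓ → ℕ) :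
    I.fetchWeight (I.pool T n) (I.pool T' n') ≤
      ∑ c, I.weight c * |(m c : ℝ) - n c| + ∑ c, I.weight c * |(n' c : ℝ) - m c| +
        if p ∈ T (I.cls p) (m (I.cls p)) then 0 else I.weight (I.cls p) := by
  have hfault : (if p ∈ T (I.cls p) (m (I.cls p)) then 0 else I.weight (I.cls p)) =
      ∑ c, I.weight c * (if c = I.cls p then
        (if p ∈ T (I.cls p) (m (I.cls p)) then (0 : ℝ) else 1) else 0) := by
    simp
  rw [hfault, fetchWeight_eq, ← Finset.sum_add_distrib, ← Finset.sum_add_distrib]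
  refine Finset.sum_le_sum fun c _ => ?_
  rw [← mul_add, ← mul_add, part_pool I hT, part_pool I hT']
  refine mul_le_mul_of_nonneg_left ?_ (I.weight_pos c).le
  have h1 := I.card_sdiff_le_abs (hT c) (n c) (m c)
  have h2 := I.card_sdiff_le_abs (hT' c) (m c) (n' c)
  have h3 : ((T' c (m c) \ T c (m c)).card : ℝ) ≤
      if c = I.cls p then (if p ∈ T (I.cls p) (m (I.cls p)) then (0 : ℝ) else 1) else 0 := by
    split_ifs with hc hp
    · subst hc
      rw [hTT', Function.update_self, chainStep_of_mem hp]
      simp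
    · subst hc
      have : T' (I.cls p) (m (I.cls p)) \ T (I.cls p) (m (I.cls p)) ⊆ {p} := by
        rw [hTT', Function.update_self]
        intro q hq
        rw [Finset.mem_sdiff] at hq
        exact Finset.mem_singleton.2
          ((Finset.mem_insert.1 (chainStep_subset R p _ _ hq.1)).resolve_right hq.2)
      exact_mod_cast (Finset.card_le_card this).trans (by simp)
    · rw [hTT', Function.update_of_ne hc]
      simp
  have h4 : (T' c (n' c) \ T c (n c)).card ≤ (T' c (n' c) \ T' c (m c)).card +
      (T' c (m c) \ T c (m c)).card + (T c (m c) \ T c (n c)).card := by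
    refine (Finset.card_le_card ?_).trans ((Finset.card_union_le _ _).trans
      (Nat.add_le_add_right (Finset.card_union_le _ _) _))
    intro q
    simp only [Finset.mem_sdiff, Finset.mem_union]
    tauto
  have h5 : ((T' c (n' c) \ T c (n c)).card : ℝ) ≤ (T' c (n' c) \ T' c (m c)).card +
      (T' c (m c) \ T c (m c)).card + (T c (m c) \ T c (n c)).card := by exact_mod_cast h4
  linarith

end PagingInstance

/-! ### The randomized paging algorithm -/

namespace PagingInstance

variable {ℓ : ℕ} (I : PagingInstance ℓ)

open Classical in
/-- The cache `C h` after the observations `h`, replaced by a trivial one if it is not valid. -/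
noncomputable def patchedCache (h : List I.Observation) (C : Finset I.Page) : Finset I.Page :=
  if hne : h = [] then I.init
  else if (h.getLast hne).1 ∈ C ∧ C.card ≤ I.k then C else {(h.getLast hne).1}

/-- The online algorithm that uses the caches `C h` where they are valid. -/
noncomputable def patchedAlgorithm (C : List I.Observation → Finset I.Page) : I.DetAlgorithm where
  cache h := I.patchedCache h (C h)
  cache_nil := by simp [patchedCache]
  serves h o := by
    rw [patchedCache, dif_neg (by simp)]
    split_ifs with h1
    · simpa using h1.1
    · simp
  card_le h o := by
    rw [patchedCache, dif_neg (by simp)]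
    split_ifs with h1
    · exact h1.2
    · simpa using Nat.succ_le_of_lt I.k_pos

lemma patchedCache_append {h : List I.Observation} {o : I.Observation} {C : Finset I.Page}
    (h1 : o.1 ∈ C) (h2 : C.card ≤ I.k) : I.patchedCache (h ++ [o]) C = C := by
  rw [patchedCache, dif_neg (by simp), if_pos ⟨by simpa using h1, h2⟩]

lemma fetchWeight_le_sum (S S' : Finset I.Page) :
    I.fetchWeight S S' ≤ ∑ p, I.weight (I.cls p) :=
  Finset.sum_le_sum_of_subset_of_nonneg (Finset.subset_univ _) fun _ _ _ => (I.weight_pos _).le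

/-- Changing the initial cache content changes the cost by a bounded amount. -/
lemma sum_fetchWeight_le (T : ℕ) {S S' : ℕ → Finset I.Page}
    (h : ∀ t < T, S (t + 1) = S' (t + 1)) :
    ∑ t ∈ Finset.range T, I.fetchWeight (S t) (S (t + 1)) ≤
      ∑ t ∈ Finset.range T, I.fetchWeight (S' t) (S' (t + 1)) + ∑ p, I.weight (I.cls p) := by
  have h0 : 0 ≤ ∑ p, I.weight (I.cls p) := Finset.sum_nonneg fun p _ => (I.weight_pos _).le
  cases T with
  | zero => simpa using h0
  | succ T =>
    rw [Finset.sum_range_succ', Finset.sum_range_succ']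
    have h1 : ∑ t ∈ Finset.range T, I.fetchWeight (S (t + 1)) (S (t + 1 + 1)) =
        ∑ t ∈ Finset.range T, I.fetchWeight (S' (t + 1)) (S' (t + 1 + 1)) :=
      Finset.sum_congr rfl fun t ht => by
        have := Finset.mem_range.1 ht
        rw [h t (by omega), h (t + 1) (by omega)]
    rw [h1]
    have h2 := I.fetchWeight_le_sum (S 0) (S (0 + 1))
    have h3 := I.fetchWeight_nonneg (S' 0) (S' (0 + 1))
    linarith

/-- The caches of the simulation, for a randomized integral allocation `X`. -/
noncomputable def simCache (E : ℕ → ℝ) (T₀ : Fin ℓ → ℕ → Finset I.Page)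
    (X : List (AllocRequest ℓ) → Fin ℓ → ℝ → ℤ) (ω : ℝ) (h : List I.Observation) :
    Finset I.Page :=
  I.pool (I.sim E T₀ h).1 fun c => (X (I.sim E T₀ h).2 c ω).toNat

lemma measurableSet_simCache (E : ℕ → ℝ) (T₀ : Fin ℓ → ℕ → Finset I.Page)
    {X : List (AllocRequest ℓ) → Fin ℓ → ℝ → ℤ} (hX : ∀ l i, Measurable (X l i))
    (h : List I.Observation) (C : Finset I.Page) :
    MeasurableSet {ω | (I.patchedAlgorithm (I.simCache E T₀ X ω)).cache h = C} := by
  have h1 : Measurable fun ω => fun c => X (I.sim E T₀ h).2 c ω :=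
    measurable_pi_iff.2 fun c => hX _ c
  have h2 : MeasurableSet {n : Fin ℓ → ℤ |
      I.patchedCache h (I.pool (I.sim E T₀ h).1 fun c => (n c).toNat) = C} :=
    MeasurableSet.of_discrete
  exact h1 h2

lemma measurable_fetchWeight_pool (T T' : Fin ℓ → ℕ → Finset I.Page)
    {X X' : Fin ℓ → ℝ → ℤ} (hX : ∀ i, Measurable (X i)) (hX' : ∀ i, Measurable (X' i)) :
    Measurable fun ω => ENNReal.ofReal
      (I.fetchWeight (I.pool T fun c => (X c ω).toNat) (I.pool T' fun c => (X' c ω).toNat)) := by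
  have h1 : Measurable fun ω => fun c => X c ω := measurable_pi_iff.2 fun c => hX c
  have h1' : Measurable fun ω => fun c => X' c ω := measurable_pi_iff.2 fun c => hX' c
  have h2 : Measurable (fun n : (Fin ℓ → ℤ) × (Fin ℓ → ℤ) => ENNReal.ofReal
      (I.fetchWeight (I.pool T fun c => (n.1 c).toNat)
        (I.pool T' fun c => (n.2 c).toNat))) := Measurable.of_discrete
  have h3 := h1.prodMk h1'
  have h4 := h2.comp h3
  simpa only [Function.comp_def] using h4
variable {E : ℕ → ℝ} {T₀ : Fin ℓ → ℕ → Finset I.Page}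

/-- The step is split at the allocation reached after the first of the two requests, because that is
where its service cost is charged. Fetches then come from two changes of the slot numbers, at an
expected factor 16, and from a fault, which is dominated by the service cost for every outcome. -/
lemma simCache_step_le (hT₀ : ∀ c, IsChain (I.classPages c) (T₀ c))
    {A : List (AllocRequest ℓ) → Simplex ℓ} {X : List (AllocRequest ℓ) → Fin ℓ → ℝ → ℤ}
    (hfl : ∀ l i ω, ⌊(I.k : ℝ) * (A l).1 i⌋ ≤ X l i ω)
    (hint : ∀ l i, Integrable (fun ω => (X l i ω : ℝ)) unitMeasure)
    (hstep : ∀ l a, ∑ i, I.weight i * ∫ ω, |(X (l ++ [a]) i ω : ℝ) - X l i ω| ∂unitMeasure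
        ≤ 16 * ∑ i, I.weight i * |(I.k : ℝ) * (A (l ++ [a])).1 i - I.k * (A l).1 i|)
    (σ : List I.Page) (t : ℕ) (ht : t < σ.length) :
    ∫⁻ ω, ENNReal.ofReal (I.fetchWeight (I.simCache E T₀ X ω ((I.observations σ).take t))
      (I.simCache E T₀ X ω ((I.observations σ).take (t + 1)))) ∂unitMeasure +
        16 * onlineCost (fun i => I.k * I.weight i) A (I.simAt E T₀ σ t).2 ≤
      16 * onlineCost (fun i => I.k * I.weight i) A (I.simAt E T₀ σ (t + 1)).2 := by
  have hT := I.isChain_simAt E hT₀ σ t ht.le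
  have hT' := I.isChain_simAt E hT₀ σ (t + 1) ht
  have hreq := I.simAt_requests_succ E T₀ σ t ht
  rw [simRequests_eq] at hreq
  have hTT' : (I.simAt E T₀ σ (t + 1)).1 = Function.update (I.simAt E T₀ σ t).1 (I.cls σ[t])
      (chainStep (I.Earlier (σ.drop (t + 1))) σ[t] ((I.simAt E T₀ σ t).1 (I.cls σ[t]))) := by
    rw [I.simAt_succ E T₀ σ t ht, simStep]
  set T := (I.simAt E T₀ σ t).1 with hTd
  set T' := (I.simAt E T₀ σ (t + 1)).1 with hTd'
  set ρ := (I.simAt E T₀ σ t).2 with hρ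
  set p := σ[t] with hp
  set r₁ : AllocRequest ℓ := softRequest (I.cls p) (I.weight (I.cls p)) (I.position T p / I.k)
    with hr₁
  set r₂ : AllocRequest ℓ := softRequest (I.cls p) (E ρ.length) (1 / I.k) with hr₂
  have hX0 : ∀ l i ω, 0 ≤ X l i ω := fun l i ω =>
    (Int.floor_nonneg.2 (mul_nonneg I.k_pos'.le ((A l).2.1 i))).trans (hfl l i ω)
  have hcast : ∀ l i ω, ((X l i ω).toNat : ℝ) = X l i ω := fun l i ω => by
    exact_mod_cast congrArg (Int.cast : ℤ → ℝ) (Int.toNat_of_nonneg (hX0 l i ω))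
  set F : List (AllocRequest ℓ) → AllocRequest ℓ → ℝ → ℝ := fun l a ω =>
    ∑ i, I.weight i * |(X (l ++ [a]) i ω : ℝ) - X l i ω| with hF
  have hF0 : ∀ l a ω, 0 ≤ F l a ω := fun l a ω =>
    Finset.sum_nonneg fun i _ => mul_nonneg (I.weight_pos i).le (abs_nonneg _)
  have hsi : ∀ l a i, Integrable (fun ω => I.weight i * |(X (l ++ [a]) i ω : ℝ) - X l i ω|)
      unitMeasure := fun l a i => (((hint _ i).sub (hint _ i)).abs).const_mul _
  have hFi : ∀ l a, Integrable (F l a) unitMeasure := fun l a =>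
    integrable_finsetSum _ fun i _ => hsi l a i
  have hFl : ∀ l a, ∫⁻ ω, ENNReal.ofReal (F l a ω) ∂unitMeasure ≤
      16 * moveCost (fun i => I.k * I.weight i) (A l) (A (l ++ [a])) := fun l a => by
    rw [← ofReal_integral_eq_lintegral_ofReal (hFi l a) (Filter.Eventually.of_forall (hF0 l a)),
      moveCost]
    have h16 : (16 : ℝ≥0∞) = ENNReal.ofReal 16 := by norm_num
    rw [h16, ← ENNReal.ofReal_mul (by norm_num)]
    refine ENNReal.ofReal_le_ofReal ?_
    rw [hF, integral_finsetSum _ fun i _ => hsi l a i]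
    simp only [integral_const_mul]
    refine (hstep l a).trans (le_of_eq ?_)
    congr 1
    refine Finset.sum_congr rfl fun i _ => ?_
    rw [← mul_sub, abs_mul, abs_of_pos I.k_pos']
    ring
  have hserv : ∀ ω, ENNReal.ofReal (if p ∈ T (I.cls p) (X (ρ ++ [r₁]) (I.cls p) ω).toNat then 0
      else I.weight (I.cls p)) ≤ r₁.cost (coord (A (ρ ++ [r₁])) r₁.dir) := fun ω => by
    split_ifs with hmem
    · simp
    · simp only [hr₁, softRequest, coord]
      rw [if_pos]
      -- Without a charge the fractional allocation reaches the position of `p`, an integer number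
      -- of slots. The rounding never goes below the floor, so the cache then contains `p`.
      by_contra hge
      rw [not_lt, div_le_iff₀ I.k_pos'] at hge
      refine hmem (I.mem_of_position_le (hT _) ?_)
      have h1 : (I.position T p : ℤ) ≤ ⌊(I.k : ℝ) * (A (ρ ++ [r₁])).1 (I.cls p)⌋ :=
        Int.le_floor.2 (by push_cast; rw [mul_comm]; exact hge)
      have h2 := h1.trans (hfl (ρ ++ [r₁]) (I.cls p) ω)
      exact (Int.le_toNat (hX0 _ _ _)).2 h2
  have hpt : ∀ ω, ENNReal.ofReal (I.fetchWeight
      (I.simCache E T₀ X ω ((I.observations σ).take t))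
      (I.simCache E T₀ X ω ((I.observations σ).take (t + 1)))) ≤
      ENNReal.ofReal (F ρ r₁ ω) + ENNReal.ofReal (F (ρ ++ [r₁]) r₂ ω) +
        r₁.cost (coord (A (ρ ++ [r₁])) r₁.dir) := fun ω => by
    have h1 := I.fetchWeight_pool_le hT hT' hTT' (fun c => (X ρ c ω).toNat)
      (fun c => (X (ρ ++ [r₁]) c ω).toNat) (fun c => (X (ρ ++ [r₁] ++ [r₂]) c ω).toNat)
    simp only [hcast] at h1
    refine (ENNReal.ofReal_le_ofReal (le_trans (le_of_eq ?_) h1)).trans ?_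
    · rw [← hreq]; rfl
    · refine (ENNReal.ofReal_add_le).trans (add_le_add ?_ (hserv ω))
      exact ENNReal.ofReal_add_le
  have hlin : ∫⁻ ω, ENNReal.ofReal (I.fetchWeight
      (I.simCache E T₀ X ω ((I.observations σ).take t))
      (I.simCache E T₀ X ω ((I.observations σ).take (t + 1)))) ∂unitMeasure ≤
      16 * moveCost (fun i => I.k * I.weight i) (A ρ) (A (ρ ++ [r₁])) +
      16 * moveCost (fun i => I.k * I.weight i) (A (ρ ++ [r₁])) (A (ρ ++ [r₁] ++ [r₂])) +
        r₁.cost (coord (A (ρ ++ [r₁])) r₁.dir) := by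
    refine (lintegral_mono hpt).trans ?_
    rw [lintegral_add_right _ measurable_const,
      lintegral_add_left' (hFi _ _).1.aemeasurable.ennreal_ofReal]
    simp only [lintegral_const, measure_univ, mul_one]
    exact add_le_add (add_le_add (hFl _ _) (hFl _ _)) le_rfl
  rw [hreq, onlineCost_append_singleton, onlineCost_append_singleton]
  simp only [mul_add]
  refine (add_le_add hlin le_rfl).trans ?_
  set c₁ := r₁.cost (coord (A (ρ ++ [r₁])) r₁.dir)
  have hc : c₁ ≤ 16 * c₁ := le_mul_of_one_le_left zero_le (by norm_num)
  refine (add_le_add (add_le_add le_rfl hc) le_rfl).trans ?_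
  refine le_add_right (c := 16 * r₂.cost (coord (A (ρ ++ [r₁] ++ [r₂])) r₂.dir)) le_rfl
    |>.trans (le_of_eq ?_)
  ring

/-- The caches of the simulation are valid almost surely. -/
lemma simCache_valid (hT₀ : ∀ c, IsChain (I.classPages c) (T₀ c))
    {A : List (AllocRequest ℓ) → Simplex ℓ} {X : List (AllocRequest ℓ) → Fin ℓ → ℝ → ℤ}
    (hfl : ∀ l i ω, ⌊(I.k : ℝ) * (A l).1 i⌋ ≤ X l i ω) {ω : ℝ} {σ : List I.Page} {t : ℕ}
    (ht : t < σ.length) (hsum : ∑ i, X (I.simAt E T₀ σ (t + 1)).2 i ω = I.k)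
    (hA : 1 / (I.k : ℝ) ≤ (A (I.simAt E T₀ σ (t + 1)).2).1 (I.cls σ[t])) :
    σ[t] ∈ I.simCache E T₀ X ω ((I.observations σ).take (t + 1)) ∧
      (I.simCache E T₀ X ω ((I.observations σ).take (t + 1))).card ≤ I.k := by
  have hT' := I.isChain_simAt E hT₀ σ (t + 1) ht
  have hX0 : ∀ l i ω, 0 ≤ X l i ω := fun l i ω =>
    (Int.floor_nonneg.2 (mul_nonneg I.k_pos'.le ((A l).2.1 i))).trans (hfl l i ω)
  have hdef : I.simCache E T₀ X ω ((I.observations σ).take (t + 1)) =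
      I.pool (I.simAt E T₀ σ (t + 1)).1 fun c => (X (I.simAt E T₀ σ (t + 1)).2 c ω).toNat := rfl
  rw [hdef]
  constructor
  · refine Finset.mem_biUnion.2 ⟨I.cls σ[t], Finset.mem_univ _, ?_⟩
    have h1 : (1 : ℤ) ≤ X (I.simAt E T₀ σ (t + 1)).2 (I.cls σ[t]) ω := by
      refine le_trans (Int.le_floor.2 ?_) (hfl _ _ _)
      have := (div_le_iff₀ I.k_pos').1 hA
      rw [mul_comm]
      exact_mod_cast this
    have h2 : 1 ≤ (X (I.simAt E T₀ σ (t + 1)).2 (I.cls σ[t]) ω).toNat := by omega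
    have h3 : (I.simAt E T₀ σ (t + 1)).1 (I.cls σ[t]) =
        chainStep (I.Earlier (σ.drop (t + 1))) σ[t] ((I.simAt E T₀ σ t).1 (I.cls σ[t])) := by
      rw [I.simAt_succ E T₀ σ t ht, simStep]
      exact Function.update_self _ _ _
    rw [h3]
    exact mem_chainStep h2
  · refine (I.card_pool_le hT' _).trans ?_
    have h1 : ((∑ c, (X (I.simAt E T₀ σ (t + 1)).2 c ω).toNat : ℕ) : ℤ) = I.k := by
      rw [Nat.cast_sum, ← hsum]
      exact Finset.sum_congr rfl fun c _ => Int.toNat_of_nonneg (hX0 _ _ _)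
    exact_mod_cast h1.le

end PagingInstance

/-- A competitive algorithm for soft allocation yields one for interleaved myopic paging. -/
theorem wimpCompetitive_of_soft {ℓ : ℕ} (hℓ : 1 ≤ ℓ) {φ : ℝ≥0} (h : SoftAllocCompetitive ℓ φ) :
    WIMPCompetitive ℓ (96 * φ) := by
  intro I
  have : Nonempty (Fin ℓ) := ⟨⟨0, hℓ⟩⟩
  obtain ⟨i₀, hi₀⟩ := Finite.exists_min I.weight
  have hw : ∀ i, 0 < (I.k : ℝ) * I.weight i := fun i => mul_pos I.k_pos' (I.weight_pos i)
  obtain ⟨A, hA0, a, hA⟩ := h (fun i => I.k * I.weight i) hw (I.division i₀ I.init)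
  choose T₀ hT₀ using fun c => exists_isChain (I.classPages c)
  set E : ℕ → ℝ := fun n => φ * (∑ i, I.k * I.weight i + ∑ i, I.weight i) * (n + 1) + a + 1
    with hE
  have hEpos : ∀ n, 0 < E n := fun n => by
    have h1 : 0 ≤ ∑ i, I.k * I.weight i := Finset.sum_nonneg fun i _ => (hw i).le
    have h2 : 0 ≤ ∑ i, I.weight i := Finset.sum_nonneg fun i _ => (I.weight_pos i).le
    simp only [hE]
    positivity
  -- The initial division consists of whole slots, so the rounding can start deterministically.
  have hX₀ : ∃ X₀ : Fin ℓ → ℤ, ∀ i, (I.k : ℝ) * (A []).1 i = X₀ i := by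
    have hk := I.k_pos'.ne'
    refine ⟨fun i => if i = i₀ then I.k - ∑ j ∈ Finset.univ.erase i₀, ((I.part I.init j).card : ℤ)
      else (I.part I.init i).card, fun i => ?_⟩
    rw [hA0, I.division_val i₀ I.init_card, fillCoord]
    dsimp only
    by_cases hi : i = i₀
    · rw [if_pos hi, if_pos hi]
      push_cast
      simp only [PagingInstance.share]
      rw [← Finset.sum_div]
      field_simp
    · rw [if_neg hi, if_neg hi]
      simp only [PagingInstance.share]
      push_cast
      field_simp
  obtain ⟨X₀, hX₀⟩ := hX₀
  obtain ⟨X, hXm, hXfl, hXs, hXi, hXc⟩ := exists_online_rounding (w := I.weight) I.weight_pos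
    (k := I.k) (fun l i => (I.k : ℝ) * (A l).1 i)
    (fun l => by rw [← Finset.mul_sum, (A l).2.2, mul_one]) X₀ hX₀
  set Wall : ℝ := ∑ p, I.weight (I.cls p) with hWall
  have hWall0 : 0 ≤ Wall := Finset.sum_nonneg fun p _ => (I.weight_pos _).le
  set K₀ : ℝ := ∑ c, I.weight c * (4 * (I.part I.init c).card) with hK₀
  have hK₀0 : 0 ≤ K₀ := Finset.sum_nonneg fun c _ => mul_nonneg (I.weight_pos c).le (by positivity)
  refine ⟨ℝ, inferInstance, unitMeasure, inferInstance,
    fun ω => I.patchedAlgorithm (I.simCache E T₀ X ω),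
    fun h C => I.measurableSet_simCache E T₀ hXm h C,
    16 * φ * K₀.toNNReal + 16 * a + Wall.toNNReal, fun σ => ?_⟩
  have hone := fun t ht => I.one_div_le_of_competitive (E := E) (fun n => rfl) hT₀ hA σ t ht
  -- Patching acts only on a null set of outcomes, apart from time 0, where the simulated cache may
  -- differ from `I.init`. This affects only the first fetch and costs at most `Wall`.
  have hvalid : ∀ᵐ ω ∂unitMeasure, (I.patchedAlgorithm (I.simCache E T₀ X ω)).cost σ ≤
      ENNReal.ofReal (∑ t ∈ Finset.range σ.length, I.fetchWeight
        (I.simCache E T₀ X ω ((I.observations σ).take t))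
        (I.simCache E T₀ X ω ((I.observations σ).take (t + 1)))) + ENNReal.ofReal Wall := by
    filter_upwards [ae_all_iff.2 fun t => hXs (I.simAt E T₀ σ t).2] with ω hω
    rw [PagingInstance.DetAlgorithm.cost, I.cost_eq, ← ENNReal.ofReal_add
      (Finset.sum_nonneg fun t _ => I.fetchWeight_nonneg _ _) hWall0]
    refine ENNReal.ofReal_le_ofReal (I.sum_fetchWeight_le σ.length
      (S' := fun t => I.simCache E T₀ X ω ((I.observations σ).take t)) fun t ht => ?_)
    obtain ⟨h1, h2⟩ := I.simCache_valid hT₀ hXfl ht (hω (t + 1)) (hone t ht)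
    have h3 := I.observations_take_succ σ t ht
    change I.patchedCache _ _ = _
    rw [h3] at h1 h2 ⊢
    exact I.patchedCache_append h1 h2
  have hsum : ∀ t ≤ σ.length, ∫⁻ ω, ENNReal.ofReal (∑ s ∈ Finset.range t, I.fetchWeight
        (I.simCache E T₀ X ω ((I.observations σ).take s))
        (I.simCache E T₀ X ω ((I.observations σ).take (s + 1)))) ∂unitMeasure ≤
      16 * onlineCost (fun i => I.k * I.weight i) A (I.simAt E T₀ σ t).2 := by
    intro t ht
    induction t with
    | zero => simp
    | succ t ih =>
      refine le_trans ?_ (I.simCache_step_le hT₀ hXfl hXi hXc σ t ht)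
      simp only [Finset.sum_range_succ]
      refine le_trans ?_ (add_le_add le_rfl (ih (by omega)))
      rw [add_comm (∫⁻ ω, _ ∂unitMeasure)]
      refine le_trans (lintegral_mono fun ω => ENNReal.ofReal_add_le) ?_
      simp only [PagingInstance.simCache]
      rw [lintegral_add_right _ (I.measurable_fetchWeight_pool _ _ (hXm _) (hXm _))]
  have hopt : allocOpt (fun i => I.k * I.weight i) (I.division i₀ I.init)
      (I.simAt E T₀ σ σ.length).2 ≤ ENNReal.ofReal K₀ + 6 * I.opt σ := by
    rw [PagingInstance.opt, ENNReal.mul_iInf_of_ne (by norm_num) (by norm_num), ENNReal.add_iInf]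
    refine le_iInf fun S => ?_
    obtain ⟨d, v, hv, -, hr, hb⟩ := I.exists_allocReach E hT₀ hi₀ S.2 σ.length le_rfl
    refine hr.opt_le.trans ?_
    have h6 : (6 : ℝ≥0∞) = ENNReal.ofReal 6 := by norm_num
    have h0 : 0 ≤ ∑ s ∈ Finset.range σ.length, I.fetchWeight (S.1 s) (S.1 (s + 1)) :=
      Finset.sum_nonneg fun t _ => I.fetchWeight_nonneg _ _
    rw [I.cost_eq, h6, ← ENNReal.ofReal_mul (by norm_num),
      ← ENNReal.ofReal_add hK₀0 (by positivity)]
    refine ENNReal.ofReal_le_ofReal (le_trans ?_ hb)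
    exact le_add_of_nonneg_right (Finset.sum_nonneg fun c _ =>
      mul_nonneg (I.weight_pos c).le (by positivity))
  have hcomp := hA _ (I.isSoftThreshold_simAt hEpos hT₀ σ σ.length le_rfl)
  calc ∫⁻ ω, (I.patchedAlgorithm (I.simCache E T₀ X ω)).cost σ ∂unitMeasure
      ≤ ∫⁻ ω, (ENNReal.ofReal (∑ t ∈ Finset.range σ.length, I.fetchWeight
        (I.simCache E T₀ X ω ((I.observations σ).take t))
        (I.simCache E T₀ X ω ((I.observations σ).take (t + 1)))) + ENNReal.ofReal Wall)
          ∂unitMeasure := lintegral_mono_ae hvalid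
    _ ≤ 16 * onlineCost (fun i => I.k * I.weight i) A (I.simAt E T₀ σ σ.length).2 +
          ENNReal.ofReal Wall := by
        rw [lintegral_add_right _ measurable_const]
        simp only [lintegral_const, measure_univ, mul_one]
        exact add_le_add (hsum _ le_rfl) le_rfl
    _ ≤ 16 * (φ * (ENNReal.ofReal K₀ + 6 * I.opt σ) + a) + ENNReal.ofReal Wall := by
        refine add_le_add (mul_le_mul_right ?_ _) le_rfl
        exact hcomp.trans (add_le_add (mul_le_mul_right hopt _) le_rfl)
    _ = ((96 * φ : ℝ≥0) : ℝ≥0∞) * I.opt σ +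
          ((16 * φ * K₀.toNNReal + 16 * a + Wall.toNNReal : ℝ≥0) : ℝ≥0∞) := by
        push_cast
        rw [ENNReal.ofReal, ENNReal.ofReal]
        ring

namespace PagingInstance

variable {ℓ : ℕ} (I : PagingInstance ℓ)

/-! ### Request sequences whose observations do not reveal the future -/

/-- A numbering of the pages of each class by the numbers below the cache size. -/
structure Numbering where
  /-- the page of a class with a given number -/
  page : Fin ℓ → ℕ → I.Page
  /-- the number of a page -/
  idx : I.Page → ℕ
  idx_lt : ∀ p, idx p < I.k
  page_idx : ∀ p, page (I.cls p) (idx p) = p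
  cls_page : ∀ i q, q < I.k → I.cls (page i q) = i
  idx_page : ∀ i q, q < I.k → idx (page i q) = q

namespace Numbering

variable {I} (G : I.Numbering)

/-- One round of requests to the first `m` pages of class `i`. -/
def block (i : Fin ℓ) (m : ℕ) : List I.Page := (List.range (min m I.k)).map (G.page i)

/-- The concatenation of rounds of requests; `(i, j)` stands for a round of requests to the
first `j + 1` pages of class `i`. -/
def flat (β : List (Fin ℓ × ℕ)) : List I.Page := β.flatMap fun r => G.block r.1 (r.2 + 1)

lemma mem_block {i : Fin ℓ} {m : ℕ} {p : I.Page} :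
    p ∈ G.block i m ↔ I.cls p = i ∧ G.idx p < m := by
  simp only [block, List.mem_map, List.mem_range, lt_min_iff]
  constructor
  · rintro ⟨q, ⟨h1, h2⟩, rfl⟩
    exact ⟨G.cls_page i q h2, by rwa [G.idx_page i q h2]⟩
  · rintro ⟨rfl, h⟩
    exact ⟨G.idx p, ⟨h, G.idx_lt p⟩, G.page_idx p⟩

lemma nodup_block (i : Fin ℓ) (m : ℕ) : (G.block i m).Nodup := by
  refine (List.nodup_map_iff_inj_on List.nodup_range).2 fun a ha b hb hab => ?_
  have ha' := (lt_min_iff.1 (List.mem_range.1 ha)).2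
  have hb' := (lt_min_iff.1 (List.mem_range.1 hb)).2
  rw [← G.idx_page i a ha', hab, G.idx_page i b hb']

lemma idxOf_block {i : Fin ℓ} {m : ℕ} {p : I.Page} (hp : p ∈ G.block i m) :
    (G.block i m).idxOf p = G.idx p := by
  obtain ⟨h1, h2⟩ := G.mem_block.1 hp
  have hlen : G.idx p < (G.block i m).length := by
    simp [block, h2, G.idx_lt p]
  have hget : (G.block i m)[G.idx p] = p := by
    simp [block, ← h1, G.page_idx p]
  calc (G.block i m).idxOf p = (G.block i m).idxOf ((G.block i m)[G.idx p]) := by rw [hget]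
    _ = G.idx p := (G.nodup_block i m).idxOf_getElem _ _

lemma flat_append (β γ : List (Fin ℓ × ℕ)) : G.flat (β ++ γ) = G.flat β ++ G.flat γ := by
  simp [flat]

lemma flat_cons (r : Fin ℓ × ℕ) (β : List (Fin ℓ × ℕ)) :
    G.flat (r :: β) = G.block r.1 (r.2 + 1) ++ G.flat β := by
  simp [flat]

/-- Within each class, the pages occur in `L` for the first time in the order of their numbers. -/
def Ordered (L : List I.Page) : Prop :=
  ∀ p q, I.cls p = I.cls q → G.idx p < G.idx q → L.idxOf p < L.idxOf q

/-- A round runs through an initial segment of its class in increasing order, so a round containing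
`q` contains `p` before it. -/
lemma idxOf_flat_lt (β : List (Fin ℓ × ℕ)) {p q : I.Page} (hc : I.cls p = I.cls q)
    (hlt : G.idx p < G.idx q) (hq : q ∈ G.flat β) : (G.flat β).idxOf p < (G.flat β).idxOf q := by
  induction β with
  | nil => simp [flat] at hq
  | cons r β ih =>
    rw [flat_cons] at hq ⊢
    rw [List.idxOf_append, List.idxOf_append]
    by_cases hqb : q ∈ G.block r.1 (r.2 + 1)
    · obtain ⟨h1, h2⟩ := G.mem_block.1 hqb
      have hpb : p ∈ G.block r.1 (r.2 + 1) := G.mem_block.2 ⟨hc.trans h1, hlt.trans h2⟩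
      rw [if_pos hqb, if_pos hpb, G.idxOf_block hqb, G.idxOf_block hpb]
      exact hlt
    · have hqβ : q ∈ G.flat β := (List.mem_append.1 hq).resolve_left hqb
      rw [if_neg hqb]
      split_ifs with hpb
      · have := List.idxOf_lt_length_iff.2 hpb
        omega
      · have := ih hqβ
        omega

/-- A round of requests to all pages. -/
def finale : List (Fin ℓ × ℕ) := (List.finRange ℓ).map fun i => (i, I.k - 1)

/-- The final round requests every page once more. Without it, pages that are never requested again
would be tied and the order would depend on the future. -/
lemma ordered_flat_append_finale (β : List (Fin ℓ × ℕ)) :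
    G.Ordered (G.flat β ++ G.flat (finale (I := I))) := by
  intro p q hc hlt
  rw [← flat_append]
  refine G.idxOf_flat_lt _ hc hlt ?_
  rw [flat_append, List.mem_append]
  right
  refine List.mem_flatMap.2 ⟨(I.cls q, I.k - 1), ?_, ?_⟩
  · simp [finale]
  · have := G.idx_lt q
    exact G.mem_block.2 ⟨rfl, by simp; omega⟩

/-- Two pages that both occur in `P` are compared inside `P`, a page in `P` precedes one outside it,
and two pages outside `P` follow the numbering. None of this depends on the continuation. -/
lemma earlier_append_eq (P : List I.Page) {L L' : List I.Page} (hL : G.Ordered L)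
    (hL' : G.Ordered L') : I.Earlier (P ++ L) = I.Earlier (P ++ L') := by
  have key : ∀ {L : List I.Page}, G.Ordered L → ∀ p q, I.cls p = I.cls q →
      (L.idxOf p < L.idxOf q ↔ G.idx p < G.idx q) := by
    intro L hL p q hc
    refine ⟨fun h => ?_, hL p q hc⟩
    by_contra hle
    rcases (not_lt.1 hle).eq_or_lt with he | hlt
    · have : p = q := by rw [← G.page_idx p, ← G.page_idx q, hc, he]
      subst this
      exact lt_irrefl _ h
    · exact lt_asymm h (hL q p hc.symm hlt)
  funext p q
  simp only [Earlier, eq_iff_iff, and_congr_right_iff]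
  intro hc
  rw [List.idxOf_append, List.idxOf_append, List.idxOf_append, List.idxOf_append]
  have hlp : p ∈ P → P.idxOf p < P.length := fun h => List.idxOf_lt_length_iff.2 h
  have hlq : q ∈ P → P.idxOf q < P.length := fun h => List.idxOf_lt_length_iff.2 h
  split_ifs with h1 h2 h2
  · rfl
  · have := hlp h1
    constructor <;> intro <;> omega
  · have := hlq h2
    constructor <;> intro <;> omega
  · rw [Nat.add_lt_add_iff_right, Nat.add_lt_add_iff_right, key hL p q hc, key hL' p q hc]

lemma observations_take_append_eq (P : List I.Page) {L L' : List I.Page} (hL : G.Ordered L)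
    (hL' : G.Ordered L') : (I.observations (P ++ L)).take P.length =
      (I.observations (P ++ L')).take P.length := by
  induction P with
  | nil => simp
  | cons p P ih =>
    simp only [List.cons_append, observations, List.length_cons, List.take_succ_cons, ih,
      G.earlier_append_eq P hL hL']

/-- The observations along the rounds `β`, if sufficiently many requests follow. -/
def history (β : List (Fin ℓ × ℕ)) : List I.Observation :=
  (I.observations (G.flat β ++ G.flat (finale (I := I)))).take (G.flat β).length

lemma length_history (β : List (Fin ℓ × ℕ)) : (G.history β).length = (G.flat β).length := by
  simp [history, observations_length]

/-- Further rounds extend a history without rewriting it, so the behaviour of a paging algorithm on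
the rounds so far is well defined before the later rounds are known. -/
lemma history_append (β γ : List (Fin ℓ × ℕ)) :
    ∃ h, G.history (β ++ γ) = G.history β ++ h ∧ h.length = (G.flat γ).length ∧
      h.map Prod.fst = G.flat γ := by
  have h1 : (G.history (β ++ γ)).take (G.flat β).length = G.history β := by
    rw [history, history, List.take_take, min_eq_left (by simp [flat_append]), flat_append,
      List.append_assoc]
    refine G.observations_take_append_eq _ ?_ (G.ordered_flat_append_finale [])
    exact G.ordered_flat_append_finale γ
  have hfst : ∀ σ : List I.Page, (I.observations σ).map Prod.fst = σ := fun σ => by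
    induction σ with
    | nil => rfl
    | cons p σ ih => simp [observations, ih]
  refine ⟨(G.history (β ++ γ)).drop (G.flat β).length, ?_, ?_, ?_⟩
  · rw [← h1, List.take_append_drop]
  · simp [length_history, flat_append]
  · rw [List.map_drop, history, List.map_take, hfst, flat_append]
    simp [List.drop_take]

lemma exists_observations_eq (β : List (Fin ℓ × ℕ)) :
    ∃ h, I.observations (G.flat β ++ G.flat (finale (I := I))) = G.history β ++ h :=
  ⟨_, (List.take_append_drop _ _).symm⟩

end Numbering

/-- The instance in which every class has `k` pages. -/
def gridInstance {w : Fin ℓ → ℝ} (hw : ∀ i, 0 < w i) (hinj : Function.Injective w) {k : ℕ}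
    (hk : 0 < k) (N : Fin ℓ → ℕ) (hN : ∑ i, N i ≤ k) : PagingInstance ℓ where
  n := ℓ * k
  cls p := (finProdFinEquiv.symm p).1
  weight := w
  weight_pos := hw
  weight_injective := hinj
  k := k
  k_pos := hk
  init := Finset.univ.filter fun p => (finProdFinEquiv.symm p).2.1 < N (finProdFinEquiv.symm p).1
  init_card := by
    refine le_trans ?_ hN
    rw [Finset.card_eq_sum_card_fiberwise (f := fun p : Fin (ℓ * k) => (finProdFinEquiv.symm p).1)
      (t := Finset.univ) (fun _ _ => Finset.mem_univ _)]
    refine Finset.sum_le_sum fun i _ => ?_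
    refine (Finset.card_le_card_of_injOn (t := Finset.range (N i))
      (fun p => (finProdFinEquiv.symm p).2.1) ?_ ?_).trans (by simp)
    · intro p hp
      simp only [Finset.coe_filter, Finset.mem_filter, Finset.mem_univ, true_and,
        Set.mem_ofPred_eq] at hp
      simp only [Finset.coe_range, Set.mem_Iio]
      rw [← hp.2]
      exact hp.1
    · intro p hp q hq hpq
      simp only [Finset.coe_filter, Finset.mem_filter, Finset.mem_univ, true_and,
        Set.mem_ofPred_eq] at hp hq
      refine finProdFinEquiv.symm.injective (Prod.ext (hp.2.trans hq.2.symm) (Fin.ext hpq))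

/-- The numbering of the pages of `gridInstance`. -/
def gridNumbering {w : Fin ℓ → ℝ} (hw : ∀ i, 0 < w i) (hinj : Function.Injective w) {k : ℕ}
    (hk : 0 < k) (N : Fin ℓ → ℕ) (hN : ∑ i, N i ≤ k) :
    (gridInstance hw hinj hk N hN).Numbering where
  page i q := finProdFinEquiv (i, if h : q < k then ⟨q, h⟩ else ⟨0, hk⟩)
  idx p := ((finProdFinEquiv (m := ℓ) (n := k)).symm p).2.1
  idx_lt p := ((finProdFinEquiv (m := ℓ) (n := k)).symm p).2.2
  page_idx p := by
    simp only [gridInstance, Fin.is_lt, dite_true]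
    exact Equiv.apply_symm_apply _ p
  cls_page i q h := by simp [gridInstance]
  idx_page i q h := by
    have h' : q < k := h
    simp [h']

end PagingInstance

namespace PagingInstance

variable {ℓ : ℕ} (I : PagingInstance ℓ)

/-! ### Costs of paging algorithms and schedules -/

/-- The total weight of all pages. -/
def totalWeight : ℝ := ∑ p, I.weight (I.cls p)

lemma totalWeight_nonneg : 0 ≤ I.totalWeight :=
  Finset.sum_nonneg fun _ _ => (I.weight_pos _).le

lemma fetchWeight_le (S S' : Finset I.Page) : I.fetchWeight S S' ≤ I.totalWeight :=
  I.fetchWeight_le_sum S S'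

lemma fetchWeight_self (S : Finset I.Page) : I.fetchWeight S S = 0 := by
  simp [fetchWeight]

/-- Some way to serve `σ` at cost at most `v` ends with the cache content `C`. -/
def ServeReach (σ : List I.Page) (C : Finset I.Page) (v : ℝ) : Prop :=
  ∃ S, I.Serves σ S ∧ S σ.length = C ∧
    ∑ t ∈ Finset.range σ.length, I.fetchWeight (S t) (S (t + 1)) ≤ v

variable {I}

lemma serveReach_nil : I.ServeReach [] I.init 0 :=
  ⟨fun _ => I.init, ⟨rfl, fun t => absurd t.2 (by simp)⟩, rfl, by simp⟩

lemma ServeReach.append {σ : List I.Page} {C : Finset I.Page} {v : ℝ} (h : I.ServeReach σ C v)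
    {p : I.Page} {C' : Finset I.Page} (hp : p ∈ C') (hC' : C'.card ≤ I.k) :
    I.ServeReach (σ ++ [p]) C' (v + I.fetchWeight C C') := by
  obtain ⟨S, hS, hC, hc⟩ := h
  refine ⟨fun t => if t ≤ σ.length then S t else C', ⟨by simpa using hS.1, fun t => ?_⟩,
    by simp, ?_⟩
  · have ht : t.1 < σ.length + 1 := by simpa using t.2
    rcases (Nat.lt_succ_iff_lt_or_eq.1 ht) with h | h
    · have := hS.2 ⟨t, h⟩
      simpa [Nat.succ_le_of_lt h, List.getElem_append_left h] using this
    · simpa [h] using ⟨hp, hC'⟩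
  · rw [List.length_append, List.length_singleton, Finset.sum_range_succ]
    refine add_le_add (le_trans (le_of_eq ?_) hc) (le_of_eq ?_)
    · refine Finset.sum_congr rfl fun t ht => ?_
      have := Finset.mem_range.1 ht
      dsimp only
      rw [if_pos (by omega), if_pos (by omega)]
    · simp [hC]

/-- The cache is changed once, before the first request of `L`; afterwards every requested page is
present. -/
lemma ServeReach.append_list {σ : List I.Page} {C : Finset I.Page} {v : ℝ}
    (h : I.ServeReach σ C v) {L : List I.Page} (hL : L ≠ []) {C' : Finset I.Page}
    (hp : ∀ p ∈ L, p ∈ C') (hC' : C'.card ≤ I.k) :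
    I.ServeReach (σ ++ L) C' (v + I.fetchWeight C C') := by
  induction L using List.reverseRecOn with
  | nil => exact absurd rfl hL
  | append_singleton L p ih =>
    rcases eq_or_ne L [] with rfl | hne
    · exact h.append (hp p (by simp)) hC'
    · have h1 := ih hne fun q hq => hp q (by simp [hq])
      have h2 := h1.append (hp p (by simp)) hC'
      rwa [fetchWeight_self, add_zero, List.append_assoc] at h2

lemma ServeReach.exists_append {σ : List I.Page} {C : Finset I.Page} {v : ℝ}
    (h : I.ServeReach σ C v) (L : List I.Page) :
    ∃ C', I.ServeReach (σ ++ L) C' (v + L.length * I.totalWeight) := by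
  induction L using List.reverseRecOn with
  | nil => exact ⟨C, by simpa using h⟩
  | append_singleton L p ih =>
    obtain ⟨C', hC'⟩ := ih
    obtain ⟨S, hS, hC, hc⟩ := hC'.append (Finset.mem_singleton_self p)
      (by simpa using Nat.succ_le_of_lt I.k_pos)
    rw [List.append_assoc] at hS hC hc
    refine ⟨_, S, hS, hC, hc.trans ?_⟩
    have := I.fetchWeight_le C' {p}
    simp only [List.length_append, List.length_singleton]
    push_cast
    linarith

lemma ServeReach.opt_le {σ : List I.Page} {C : Finset I.Page} {v : ℝ} (h : I.ServeReach σ C v) :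
    I.opt σ ≤ ENNReal.ofReal v := by
  obtain ⟨S, hS, -, hc⟩ := h
  refine (iInf_le _ (⟨S, hS⟩ : {S : ℕ → Finset I.Page // I.Serves σ S})).trans ?_
  rw [I.cost_eq]
  exact ENNReal.ofReal_le_ofReal hc

namespace DetAlgorithm

variable (D : I.DetAlgorithm)

/-- The cost of an algorithm along the observations `h`. -/
noncomputable def runCost (h : List I.Observation) : ℝ :=
  ∑ t ∈ Finset.range h.length, I.fetchWeight (D.cache (h.take t)) (D.cache (h.take (t + 1)))

lemma cost_eq_runCost (σ : List I.Page) :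
    D.cost σ = ENNReal.ofReal (D.runCost (I.observations σ)) := by
  rw [cost, I.cost_eq, runCost, observations_length]

lemma runCost_nonneg (h : List I.Observation) : 0 ≤ D.runCost h :=
  Finset.sum_nonneg fun _ _ => I.fetchWeight_nonneg _ _

lemma runCost_le (h : List I.Observation) : D.runCost h ≤ h.length * I.totalWeight := by
  refine (Finset.sum_le_sum fun t _ => I.fetchWeight_le _ _).trans (le_of_eq ?_)
  simp

lemma runCost_append_singleton (h : List I.Observation) (o : I.Observation) :
    D.runCost (h ++ [o]) = D.runCost h + I.fetchWeight (D.cache h) (D.cache (h ++ [o])) := by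
  rw [runCost, List.length_append, List.length_singleton, Finset.sum_range_succ, runCost]
  congr 1
  · refine Finset.sum_congr rfl fun t ht => ?_
    have := Finset.mem_range.1 ht
    rw [List.take_append_of_le_length (by omega), List.take_append_of_le_length (by omega)]
  · rw [List.take_of_length_le (i := h.length + 1) (by simp), List.take_left]

lemma fetchWeight_mono {S U U' : Finset I.Page} (h : U ⊆ U') :
    I.fetchWeight S U ≤ I.fetchWeight S U' :=
  Finset.sum_le_sum_of_subset_of_nonneg (Finset.sdiff_subset_sdiff h subset_rfl)
    fun _ _ _ => (I.weight_pos _).le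

/-- All pages that appear in the cache have to be fetched, unless they were there initially. -/
lemma runCost_append_ge (h h' : List I.Observation) {U : Finset I.Page}
    (hU : ∀ p ∈ U, ∃ t ≤ h'.length, p ∈ D.cache (h ++ h'.take t)) :
    D.runCost h + I.fetchWeight (D.cache h) U ≤ D.runCost (h ++ h') := by
  induction h' using List.reverseRecOn generalizing U with
  | nil =>
    have : U ⊆ D.cache h := fun p hp => by
      obtain ⟨t, -, ht⟩ := hU p hp
      simpa using ht
    have h1 : I.fetchWeight (D.cache h) U = 0 := by
      rw [fetchWeight, Finset.sdiff_eq_empty_iff_subset.2 this, Finset.sum_empty]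
    simp [h1]
  | append_singleton h' o ih =>
    set V : Finset I.Page :=
      (Finset.range (h'.length + 1)).biUnion fun t => D.cache (h ++ h'.take t) with hV
    have hV' : ∀ p ∈ V, ∃ t ≤ h'.length, p ∈ D.cache (h ++ h'.take t) := fun p hp => by
      obtain ⟨t, ht, hpt⟩ := Finset.mem_biUnion.1 hp
      exact ⟨t, by have := Finset.mem_range.1 ht; omega, hpt⟩
    have h1 := ih hV'
    have hold : D.cache (h ++ h') ⊆ V := fun p hp =>
      Finset.mem_biUnion.2 ⟨h'.length, by simp, by simpa using hp⟩
    have hUV : U ⊆ V ∪ D.cache (h ++ h' ++ [o]) := fun p hp => by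
      obtain ⟨t, ht, hpt⟩ := hU p hp
      rw [List.length_append, List.length_singleton] at ht
      rcases Nat.le_succ_iff.1 ht with ht | rfl
      · rw [List.take_append_of_le_length ht] at hpt
        exact Finset.mem_union_left _
          (Finset.mem_biUnion.2 ⟨t, Finset.mem_range.2 (by omega), hpt⟩)
      · rw [List.take_of_length_le (by simp), ← List.append_assoc] at hpt
        exact Finset.mem_union_right _ hpt
    have h2 : I.fetchWeight (D.cache h) (V ∪ D.cache (h ++ h' ++ [o])) ≤
        I.fetchWeight (D.cache h) V +
          I.fetchWeight (D.cache (h ++ h')) (D.cache (h ++ h' ++ [o])) := by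
      rw [fetchWeight, fetchWeight, fetchWeight]
      refine le_trans ?_ (Finset.sum_union_inter (f := fun p => I.weight (I.cls p))).le
      refine (Finset.sum_le_sum_of_subset_of_nonneg (t := (V \ D.cache h) ∪
        (D.cache (h ++ h' ++ [o]) \ D.cache (h ++ h'))) ?_
        fun _ _ _ => (I.weight_pos _).le).trans
        (le_add_of_nonneg_right (Finset.sum_nonneg fun _ _ => (I.weight_pos _).le))
      intro p
      have := @hold p
      simp only [Finset.mem_sdiff, Finset.mem_union]
      tauto
    rw [← List.append_assoc, runCost_append_singleton]
    have h3 := fetchWeight_mono (S := D.cache h) hUV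
    linarith

lemma card_cache_le (h : List I.Observation) : (D.cache h).card ≤ I.k := by
  induction h using List.reverseRecOn with
  | nil => rw [D.cache_nil]; exact I.init_card
  | append_singleton h o _ => exact D.card_le h o

end DetAlgorithm

namespace Numbering

variable (G : I.Numbering)

/-- The cache content that consists of the first `N i` pages of each class `i`. -/
def initial (N : Fin ℓ → ℕ) : Finset I.Page := Finset.univ.filter fun p => G.idx p < N (I.cls p)

lemma card_part_le {S : Finset I.Page} {c : Fin ℓ} {a b : ℕ}
    (h : ∀ p ∈ I.part S c, a ≤ G.idx p ∧ G.idx p < b) : (I.part S c).card ≤ b - a := by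
  refine (Finset.card_le_card_of_injOn (t := Finset.Ico a b) G.idx ?_ ?_).trans (by simp)
  · intro p hp
    exact Finset.mem_coe.2 (Finset.mem_Ico.2 (h p hp))
  · intro p hp q hq hpq
    have hp' := (I.mem_part.1 hp).2
    have hq' := (I.mem_part.1 hq).2
    rw [← G.page_idx p, ← G.page_idx q, hp', hq', hpq]

lemma card_initial_le {N : Fin ℓ → ℕ} (hN : ∑ i, N i ≤ I.k) : (G.initial N).card ≤ I.k := by
  rw [← I.sum_card_part]
  refine le_trans (Finset.sum_le_sum fun c _ => ?_) hN
  refine (G.card_part_le (a := 0) (b := N c) fun p hp => ?_).trans (by simp)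
  obtain ⟨h1, rfl⟩ := I.mem_part.1 hp
  simpa [initial] using h1

lemma fetchWeight_initial_le (N N' : Fin ℓ → ℕ) :
    I.fetchWeight (G.initial N) (G.initial N') ≤ ∑ i, I.weight i * |(N' i : ℝ) - N i| := by
  rw [fetchWeight_eq]
  refine Finset.sum_le_sum fun c _ => mul_le_mul_of_nonneg_left ?_ (I.weight_pos c).le
  have h1 : I.part (G.initial N') c \ I.part (G.initial N) c =
      I.part (G.initial N' \ G.initial N) c := by
    ext p
    simp only [Finset.mem_sdiff, mem_part]
    tauto
  have h2 : (I.part (G.initial N' \ G.initial N) c).card ≤ N' c - N c :=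
    G.card_part_le fun p hp => by
      obtain ⟨h3, rfl⟩ := I.mem_part.1 hp
      simpa [initial, and_comm] using h3
  rw [h1]
  refine (Nat.cast_le.2 h2).trans ?_
  rcases le_total (N c) (N' c) with h | h
  · rw [Nat.cast_sub h]
    exact le_abs_self _
  · rw [Nat.sub_eq_zero_of_le h, Nat.cast_zero]
    exact abs_nonneg _

lemma flat_replicate_ne_nil (R : ℕ) (r : Fin ℓ × ℕ) : G.flat (List.replicate (R + 1) r) ≠ [] := by
  rw [List.replicate_succ, flat_cons]
  have h1 : G.block r.1 (r.2 + 1) ≠ [] := by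
    rw [← List.length_pos_iff]
    have := I.k_pos
    simp only [block, List.length_map, List.length_range]
    omega
  simp [h1]

lemma mem_flat_replicate {R : ℕ} {r : Fin ℓ × ℕ} {p : I.Page}
    (h : p ∈ G.flat (List.replicate R r)) : I.cls p = r.1 ∧ G.idx p < r.2 + 1 := by
  obtain ⟨r', hr', hp⟩ := List.mem_flatMap.1 h
  rw [List.eq_of_mem_replicate hr'] at hp
  exact G.mem_block.1 hp

end Numbering

end PagingInstance

/-! ### Allocation with thresholds on a grid -/

section Grid

variable {ℓ : ℕ}

/-- The weighted distance of two points of the simplex. -/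
def weightedDist (w : Fin ℓ → ℝ) (x y : Simplex ℓ) : ℝ := ∑ i, w i * |y.1 i - x.1 i|

lemma weightedDist_nonneg {w : Fin ℓ → ℝ} (hw : ∀ i, 0 < w i) (x y : Simplex ℓ) :
    0 ≤ weightedDist w x y :=
  Finset.sum_nonneg fun i _ => mul_nonneg (hw i).le (abs_nonneg _)

lemma weightedDist_le {w : Fin ℓ → ℝ} (hw : ∀ i, 0 < w i) (x y : Simplex ℓ) :
    weightedDist w x y ≤ ∑ i, w i :=
  (ENNReal.ofReal_le_ofReal_iff (Finset.sum_nonneg fun i _ => (hw i).le)).1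
    (moveCost_le_sum hw x y)

/-- The movement cost of the online algorithm `p` on the requests `ρ`. -/
def pathCost {α : Type*} (w : Fin ℓ → ℝ) (p : List α → Simplex ℓ) (ρ : List α) : ℝ :=
  ∑ t ∈ Finset.range ρ.length, weightedDist w (p (ρ.take t)) (p (ρ.take (t + 1)))

lemma pathCost_append_singleton {α : Type*} (w : Fin ℓ → ℝ) (p : List α → Simplex ℓ) (ρ : List α)
    (r : α) : pathCost w p (ρ ++ [r]) = pathCost w p ρ + weightedDist w (p ρ) (p (ρ ++ [r])) := by
  rw [pathCost, List.length_append, List.length_singleton, Finset.sum_range_succ, pathCost]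
  congr 1
  · refine Finset.sum_congr rfl fun t ht => ?_
    have := Finset.mem_range.1 ht
    rw [List.take_append_of_le_length (by omega), List.take_append_of_le_length (by omega)]
  · rw [List.take_of_length_le (i := ρ.length + 1) (by simp), List.take_left]

/-- Some sequence of divisions of `k` units that starts in `N₀` and gives more than `j` units to
coordinate `i` for each request `(i, j)` of `ρ` ends in `N`, and has cost `v`. -/
inductive GridReach (k : ℕ) (w : Fin ℓ → ℝ) (N₀ : Fin ℓ → ℕ) :
    List (Fin ℓ × ℕ) → (Fin ℓ → ℕ) → ℝ → Prop
  | nil : GridReach k w N₀ [] N₀ 0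
  | append {ρ : List (Fin ℓ × ℕ)} {N N' : Fin ℓ → ℕ} {v : ℝ} {r : Fin ℓ × ℕ} :
      GridReach k w N₀ ρ N v → ∑ i, N' i ≤ k → r.2 + 1 ≤ N' r.1 →
      GridReach k w N₀ (ρ ++ [r]) N' (v + (∑ i, w i * |(N' i : ℝ) - N i|) / k)

lemma GridReach.nonneg {k : ℕ} {w : Fin ℓ → ℝ} (hw : ∀ i, 0 < w i) {N₀ N : Fin ℓ → ℕ}
    {ρ : List (Fin ℓ × ℕ)} {v : ℝ} (h : GridReach k w N₀ ρ N v) : 0 ≤ v := by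
  induction h with
  | nil => exact le_rfl
  | append _ _ _ ih =>
    exact add_nonneg ih (div_nonneg (Finset.sum_nonneg fun i _ =>
      mul_nonneg (hw i).le (abs_nonneg _)) (Nat.cast_nonneg _))

lemma GridReach.sum_le {k : ℕ} {w : Fin ℓ → ℝ} {N₀ N : Fin ℓ → ℕ} (h₀ : ∑ i, N₀ i ≤ k)
    {ρ : List (Fin ℓ × ℕ)} {v : ℝ} (h : GridReach k w N₀ ρ N v) : ∑ i, N i ≤ k := by
  cases h with
  | nil => exact h₀
  | append _ h _ => exact h

end Grid

/-! ### Expected cache contents and expected costs of rounds -/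

namespace PagingInstance

variable {ℓ : ℕ} {I : PagingInstance ℓ}

lemma ServeReach.mono {σ : List I.Page} {C : Finset I.Page} {v v' : ℝ} (h : I.ServeReach σ C v)
    (hv : v ≤ v') : I.ServeReach σ C v' := by
  obtain ⟨S, hS, hC, hc⟩ := h
  exact ⟨S, hS, hC, hc.trans hv⟩

section Expectation

variable {Ω : Type} [MeasurableSpace Ω] {μ : Measure Ω}
  {A : Ω → I.DetAlgorithm}

lemma measurable_cache
    (hA : ∀ (h : List I.Observation) (C : Finset I.Page), MeasurableSet {ω | (A ω).cache h = C})
    (f : Finset I.Page → Finset I.Page → ℝ) (h h' : List I.Observation) :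
    Measurable fun ω => f ((A ω).cache h) ((A ω).cache h') := by
  let _ : MeasurableSpace (Finset I.Page × Finset I.Page) := ⊤
  have h1 : Measurable fun ω => ((A ω).cache h, (A ω).cache h') := by
    refine measurable_to_countable' fun c => ?_
    convert (hA h c.1).inter (hA h' c.2) using 1
    ext ω
    simp [Prod.ext_iff]
  exact (measurable_from_top (f := fun c : Finset I.Page × Finset I.Page => f c.1 c.2)).comp h1

variable (G : I.Numbering) (μ A)

/-- The expected number of pages of class `i` in the cache after the rounds `β`. -/
noncomputable def expCard (i : Fin ℓ) (β : List (Fin ℓ × ℕ)) : ℝ :=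
  ∫ ω, ((I.part ((A ω).cache (G.history β)) i).card : ℝ) ∂μ

/-- The expected cost of the rounds `β`. -/
noncomputable def expCost (β : List (Fin ℓ × ℕ)) : ℝ :=
  ∫ ω, (A ω).runCost (G.history β) ∂μ

variable {μ A}

lemma expCost_nonneg (β : List (Fin ℓ × ℕ)) : 0 ≤ expCost μ A G β :=
  integral_nonneg fun ω => (A ω).runCost_nonneg _

lemma expCard_nonneg (i : Fin ℓ) (β : List (Fin ℓ × ℕ)) : 0 ≤ expCard μ A G i β :=
  integral_nonneg fun _ => Nat.cast_nonneg _

variable [IsProbabilityMeasure μ]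

lemma integrable_card
    (hA : ∀ (h : List I.Observation) (C : Finset I.Page), MeasurableSet {ω | (A ω).cache h = C})
    (i : Fin ℓ) (h : List I.Observation) :
    Integrable (fun ω => ((I.part ((A ω).cache h) i).card : ℝ)) μ := by
  refine Integrable.of_bound (C := I.k)
    (measurable_cache hA (fun C _ => ((I.part C i).card : ℝ)) h h).aestronglyMeasurable ?_
  refine Filter.Eventually.of_forall fun ω => ?_
  rw [Real.norm_of_nonneg (Nat.cast_nonneg _)]
  exact_mod_cast (Finset.card_filter_le _ _).trans ((A ω).card_cache_le h)

lemma integrable_runCost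
    (hA : ∀ (h : List I.Observation) (C : Finset I.Page), MeasurableSet {ω | (A ω).cache h = C})
    (h : List I.Observation) : Integrable (fun ω => (A ω).runCost h) μ := by
  refine Integrable.of_bound (C := h.length * I.totalWeight) ?_ ?_
  · exact (Finset.measurable_fun_sum _ fun t _ =>
      measurable_cache hA I.fetchWeight _ _).aestronglyMeasurable
  · refine Filter.Eventually.of_forall fun ω => ?_
    rw [Real.norm_of_nonneg ((A ω).runCost_nonneg h)]
    exact (A ω).runCost_le h

lemma sum_expCard_le
    (hA : ∀ (h : List I.Observation) (C : Finset I.Page), MeasurableSet {ω | (A ω).cache h = C})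
    (β : List (Fin ℓ × ℕ)) : ∑ i, expCard μ A G i β ≤ I.k := by
  simp only [expCard]
  rw [← integral_finsetSum _ fun i _ => integrable_card hA i _]
  have h1 : ∫ _ω, (I.k : ℝ) ∂μ = I.k := by simp
  rw [← h1]
  refine integral_mono (integrable_finsetSum _ fun i _ => integrable_card hA i _)
    (integrable_const _) fun ω => ?_
  dsimp only
  rw [← Nat.cast_sum, I.sum_card_part]
  exact_mod_cast (A ω).card_cache_le _

/-- Raising the expected number of pages of a class costs at least its weight. -/
lemma expCost_add_le
    (hA : ∀ (h : List I.Observation) (C : Finset I.Page), MeasurableSet {ω | (A ω).cache h = C})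
    (β γ : List (Fin ℓ × ℕ)) :
    expCost μ A G β + ∑ i, I.weight i * ((|expCard μ A G i (β ++ γ) - expCard μ A G i β| +
      (expCard μ A G i (β ++ γ) - expCard μ A G i β)) / 2) ≤ expCost μ A G (β ++ γ) := by
  -- The indicator of a nonnegative change of the mean writes its positive part as a linear
  -- expression. This can be bounded outcome by outcome and then integrated.
  set s : Fin ℓ → ℝ := fun i =>
    if 0 ≤ expCard μ A G i (β ++ γ) - expCard μ A G i β then 1 else 0 with hs
  have hs0 : ∀ i, 0 ≤ s i := fun i => by simp only [hs]; split_ifs <;> norm_num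
  have hs1 : ∀ i, s i ≤ 1 := fun i => by simp only [hs]; split_ifs <;> norm_num
  have h1 : ∀ i, (|expCard μ A G i (β ++ γ) - expCard μ A G i β| +
      (expCard μ A G i (β ++ γ) - expCard μ A G i β)) / 2 =
      s i * (expCard μ A G i (β ++ γ) - expCard μ A G i β) := fun i => by
    simp only [hs]
    split_ifs with h
    · rw [abs_of_nonneg h]; ring
    · rw [abs_of_neg (not_le.1 h)]; ring
  simp only [h1]
  obtain ⟨h', hh', -, -⟩ := G.history_append β γ
  have hpt : ∀ ω, (A ω).runCost (G.history β) + ∑ i, I.weight i * (s i *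
      (((I.part ((A ω).cache (G.history (β ++ γ))) i).card : ℝ) -
        (I.part ((A ω).cache (G.history β)) i).card)) ≤ (A ω).runCost (G.history (β ++ γ)) := by
    intro ω
    have h2 := (A ω).runCost_append_ge (G.history β) h' (U := (A ω).cache (G.history (β ++ γ)))
      fun p hp => ⟨h'.length, le_rfl, by rw [List.take_length, ← hh']; exact hp⟩
    rw [← hh'] at h2
    refine le_trans (add_le_add le_rfl ?_) h2
    rw [fetchWeight_eq]
    refine Finset.sum_le_sum fun i _ => mul_le_mul_of_nonneg_left ?_ (I.weight_pos i).le
    set C := (A ω).cache (G.history β)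
    set C' := (A ω).cache (G.history (β ++ γ))
    have h3 := I.card_part_eq C C' i
    have h4 : ((I.part C' i).card : ℝ) + (I.part C i \ I.part C' i).card =
      (I.part C i).card + (I.part C' i \ I.part C i).card := by exact_mod_cast h3
    have h5 : (0 : ℝ) ≤ (I.part C i \ I.part C' i).card := Nat.cast_nonneg _
    have h6 : (0 : ℝ) ≤ (I.part C' i \ I.part C i).card := Nat.cast_nonneg _
    have h7 : ((I.part C' i).card : ℝ) - (I.part C i).card ≤ (I.part C' i \ I.part C i).card := by
      linarith
    calc s i * (((I.part C' i).card : ℝ) - (I.part C i).card)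
        ≤ s i * (I.part C' i \ I.part C i).card := mul_le_mul_of_nonneg_left h7 (hs0 i)
      _ ≤ (I.part C' i \ I.part C i).card := mul_le_of_le_one_left h6 (hs1 i)
  have hdi : ∀ i, Integrable (fun ω => I.weight i * (s i *
      (((I.part ((A ω).cache (G.history (β ++ γ))) i).card : ℝ) -
        (I.part ((A ω).cache (G.history β)) i).card))) μ := fun i =>
    (((integrable_card hA i _).sub (integrable_card hA i _)).const_mul _).const_mul _
  have h8 := integral_mono ((integrable_runCost hA (G.history β)).add
    (integrable_finsetSum Finset.univ fun i _ => hdi i))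
    (integrable_runCost (μ := μ) hA (G.history (β ++ γ))) hpt
  have h9 : ∫ ω, ((A ω).runCost (G.history β) + ∑ i, I.weight i * (s i *
      (((I.part ((A ω).cache (G.history (β ++ γ))) i).card : ℝ) -
        (I.part ((A ω).cache (G.history β)) i).card))) ∂μ =
      expCost μ A G β + ∑ i, I.weight i *
        (s i * (expCard μ A G i (β ++ γ) - expCard μ A G i β)) := by
    rw [integral_add (integrable_runCost hA _) (integrable_finsetSum Finset.univ fun i _ => hdi i),
      integral_finsetSum _ fun i _ => hdi i]
    congr 1
    refine Finset.sum_congr rfl fun i _ => ?_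
    rw [integral_const_mul, integral_const_mul,
      integral_sub (integrable_card hA i _) (integrable_card hA i _)]
    rfl
  exact h9.ge.trans h8

/-- A round of requests to `j + 1` pages of a class costs at least its weight times the expected
number of missing pages. -/
lemma expCost_round_le
    (hA : ∀ (h : List I.Observation) (C : Finset I.Page), MeasurableSet {ω | (A ω).cache h = C})
    (β : List (Fin ℓ × ℕ)) {i : Fin ℓ} {j : ℕ} (hj : j + 1 ≤ I.k) :
    expCost μ A G β + I.weight i * (j + 1 - expCard μ A G i β) ≤
      expCost μ A G (β ++ [(i, j)]) := by
  obtain ⟨h', hh', -, hfst⟩ := G.history_append β [(i, j)]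
  have hfst' : h'.map Prod.fst = G.block i (j + 1) := by
    rw [hfst]; simp [Numbering.flat]
  set U : Finset I.Page := (G.block i (j + 1)).toFinset with hU
  have hUcard : U.card = j + 1 := by
    rw [hU, List.toFinset_card_of_nodup (G.nodup_block _ _)]
    simp [Numbering.block, hj]
  have hpt : ∀ ω, (A ω).runCost (G.history β) +
      I.weight i * (j + 1 - (I.part ((A ω).cache (G.history β)) i).card) ≤
        (A ω).runCost (G.history (β ++ [(i, j)])) := by
    intro ω
    have h2 := (A ω).runCost_append_ge (G.history β) h' (U := U) fun p hp => by
      rw [hU, List.mem_toFinset, ← hfst'] at hp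
      obtain ⟨t, ht, hpt⟩ := List.getElem_of_mem hp
      rw [List.length_map] at ht
      refine ⟨t + 1, ht, ?_⟩
      rw [List.getElem_map] at hpt
      rw [List.take_succ_eq_append_getElem ht, ← List.append_assoc, ← hpt]
      exact (A ω).serves _ _
    rw [← hh'] at h2
    refine le_trans (add_le_add le_rfl ?_) h2
    rw [fetchWeight_eq]
    refine le_trans ?_ (Finset.single_le_sum
      (fun c _ => mul_nonneg (I.weight_pos c).le (Nat.cast_nonneg _)) (Finset.mem_univ i))
    refine mul_le_mul_of_nonneg_left ?_ (I.weight_pos i).le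
    have hpU : I.part U i = U := Finset.filter_true_of_mem fun p hp =>
      (G.mem_block.1 (List.mem_toFinset.1 hp)).1
    have h3 := Finset.le_card_sdiff (I.part ((A ω).cache (G.history β)) i) U
    rw [hpU]
    have h4 : U.card ≤ (U \ I.part ((A ω).cache (G.history β)) i).card +
      (I.part ((A ω).cache (G.history β)) i).card := by omega
    rw [hUcard] at h4
    have h5 : (j : ℝ) + 1 ≤ (U \ I.part ((A ω).cache (G.history β)) i).card +
      (I.part ((A ω).cache (G.history β)) i).card := by exact_mod_cast h4
    linarith
  have hci : Integrable (fun ω => I.weight i *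
      ((j : ℝ) + 1 - (I.part ((A ω).cache (G.history β)) i).card)) μ :=
    ((integrable_const _).sub (integrable_card hA i _)).const_mul _
  have h8 := integral_mono ((integrable_runCost hA (G.history β)).add hci)
    (integrable_runCost (μ := μ) hA (G.history (β ++ [(i, j)]))) hpt
  have h9 : ∫ ω, ((A ω).runCost (G.history β) + I.weight i *
      ((j : ℝ) + 1 - (I.part ((A ω).cache (G.history β)) i).card)) ∂μ =
      expCost μ A G β + I.weight i * (j + 1 - expCard μ A G i β) := by
    rw [integral_add (integrable_runCost hA _) hci, integral_const_mul,
      integral_sub (integrable_const _) (integrable_card hA i _)]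
    simp [expCost, expCard]
  exact h9.ge.trans h8

/-- Competitiveness is applied to the rounds followed by the final round. The algorithm's cost only
grows with it, and the offline cost of the final round is bounded independently of `β`. -/
lemma expCost_le_of_serveReach
    (hA : ∀ (h : List I.Observation) (C : Finset I.Page), MeasurableSet {ω | (A ω).cache h = C})
    {φ a : ℝ≥0} (hc : ∀ σ : List I.Page, ∫⁻ ω, (A ω).cost σ ∂μ ≤ φ * I.opt σ + a)
    {β : List (Fin ℓ × ℕ)} {C : Finset I.Page} {v : ℝ} (hv : 0 ≤ v)
    (h : I.ServeReach (G.flat β) C v) :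
    expCost μ A G β ≤
      φ * (v + (G.flat (Numbering.finale (I := I))).length * I.totalWeight) + a := by
  obtain ⟨C', hC'⟩ := h.exists_append (G.flat (Numbering.finale (I := I)))
  obtain ⟨h', hh'⟩ := G.exists_observations_eq β
  have h0 := I.totalWeight_nonneg
  have h1 : ENNReal.ofReal (expCost μ A G β) ≤ ENNReal.ofReal
      (φ * (v + (G.flat (Numbering.finale (I := I))).length * I.totalWeight) + a) := by
    rw [expCost, ofReal_integral_eq_lintegral_ofReal (integrable_runCost hA _)
      (Filter.Eventually.of_forall fun ω => (A ω).runCost_nonneg _)]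
    calc _ ≤ ∫⁻ ω, (A ω).cost (G.flat β ++ G.flat (Numbering.finale (I := I))) ∂μ := by
          refine lintegral_mono fun ω => ?_
          dsimp only
          rw [DetAlgorithm.cost_eq_runCost, hh']
          refine ENNReal.ofReal_le_ofReal ?_
          have := (A ω).runCost_append_ge (G.history β) h' (U := ∅) (by simp)
          simpa [fetchWeight] using this
      _ ≤ φ * I.opt (G.flat β ++ G.flat (Numbering.finale (I := I))) + a := hc _
      _ ≤ _ := by
          rw [ENNReal.ofReal_add (by positivity) (by positivity),
            ENNReal.ofReal_mul (by positivity), ENNReal.ofReal_coe_nnreal,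
            ENNReal.ofReal_coe_nnreal]
          gcongr
          exact hC'.opt_le
  exact (ENNReal.ofReal_le_ofReal_iff (by positivity)).1 h1

/-- Repeating a round forces the algorithm to hold the requested pages. -/
lemma exists_rounds
    (hA : ∀ (h : List I.Observation) (C : Finset I.Page), MeasurableSet {ω | (A ω).cache h = C})
    {φ a : ℝ≥0} (hc : ∀ σ : List I.Page, ∫⁻ ω, (A ω).cost σ ∂μ ≤ φ * I.opt σ + a)
    (β : List (Fin ℓ × ℕ)) (r : Fin ℓ × ℕ) :
    ∃ R, r.2 + 1 ≤ I.k → (r.2 : ℝ) ≤ expCard μ A G r.1 (β ++ List.replicate (R + 1) r) := by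
  obtain ⟨i, j⟩ := r
  by_cases hj : j + 1 ≤ I.k
  swap
  · exact ⟨0, fun h => absurd h hj⟩
  by_contra hcon
  push Not at hcon
  have hlt : ∀ R, expCard μ A G i (β ++ List.replicate (R + 1) (i, j)) < j := fun R => (hcon R).2
  -- A round requests `j + 1` pages while fewer than `j` are held on average, so it costs at least
  -- the weight of one page. This is why only `j` units are forced.
  have hgrow : ∀ R : ℕ, R * I.weight i ≤
      expCost μ A G (β ++ List.replicate (R + 1) (i, j)) := by
    intro R
    induction R with
    | zero => simpa using expCost_nonneg G _
    | succ R ih =>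
      have h1 := expCost_round_le (μ := μ) G hA (β ++ List.replicate (R + 1) (i, j)) (i := i) hj
      rw [List.append_assoc, ← List.replicate_succ'] at h1
      have h2 := hlt R
      have h3 : I.weight i * 1 ≤
          I.weight i * (j + 1 - expCard μ A G i (β ++ List.replicate (R + 1) (i, j))) :=
        mul_le_mul_of_nonneg_left (by linarith) (I.weight_pos i).le
      push_cast
      linarith
  obtain ⟨C, hC⟩ := serveReach_nil (I := I) |>.exists_append (G.flat β)
  rw [List.nil_append, zero_add] at hC
  set v := ((G.flat β).length : ℝ) * I.totalWeight with hv
  have h0 := I.totalWeight_nonneg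
  have hv0 : 0 ≤ v := by positivity
  -- Offline, the `j + 1` pages are loaded once and all repetitions are free, so the expected cost
  -- of the algorithm stays bounded in `R`.
  have hbound : ∀ R : ℕ, expCost μ A G (β ++ List.replicate (R + 1) (i, j)) ≤
      φ * ((v + I.totalWeight) +
        (G.flat (Numbering.finale (I := I))).length * I.totalWeight) + a := by
    intro R
    refine expCost_le_of_serveReach G hA hc (by positivity) (C := G.initial (Pi.single i (j + 1)))
      ?_
    rw [Numbering.flat_append]
    refine (hC.append_list (G.flat_replicate_ne_nil R (i, j)) (fun p hp => ?_)
      (G.card_initial_le ?_)).mono (add_le_add le_rfl (I.fetchWeight_le _ _))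
    · obtain ⟨h1, h2⟩ := G.mem_flat_replicate hp
      simp only at h1 h2
      simp [Numbering.initial, h1, h2]
    · rw [Finset.sum_pi_single']
      simpa using hj
  obtain ⟨R, hR⟩ := exists_nat_gt ((φ * ((v + I.totalWeight) +
    (G.flat (Numbering.finale (I := I))).length * I.totalWeight) + a) / I.weight i)
  rw [div_lt_iff₀ (I.weight_pos i)] at hR
  have := hgrow R
  have := hbound R
  linarith

end Expectation

end PagingInstance

/-! ### From paging to allocation on a fixed grid -/

section GridAlgorithm

variable {ℓ : ℕ}

/-- Perturb to `w i * (1 + ε * i)`. For each pair of distinct indices at most one `ε` produces a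
tie, so a small `ε` avoids all of them. -/
lemma exists_injective_weights {w : Fin ℓ → ℝ} (hw : ∀ i, 0 < w i) :
    ∃ w' : Fin ℓ → ℝ, Function.Injective w' ∧ ∀ i, w i ≤ w' i ∧ w' i ≤ 2 * w i := by
  set B : Set ℝ := ⋃ i : Fin ℓ, ⋃ j : Fin ℓ,
    {ε : ℝ | i ≠ j ∧ w i * (1 + ε * i) = w j * (1 + ε * j)} with hB
  have hfin : B.Finite := by
    refine Set.finite_iUnion fun i => Set.finite_iUnion fun j => Set.Subsingleton.finite ?_
    rintro ε ⟨hij, h1⟩ δ ⟨-, h2⟩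
    by_contra hne
    have h3 : (ε - δ) * (w i * i - w j * j) = 0 := by linarith
    have h4 : w i * i - w j * j = 0 := (mul_eq_zero.1 h3).resolve_left (sub_ne_zero.2 hne)
    have h5 : w i = w j := by linear_combination h1 - ε * h4
    have h6 : w j * ((i : ℕ) - (j : ℕ) : ℝ) = 0 := by rw [h5] at h4; linarith
    have h7 := (mul_eq_zero.1 h6).resolve_left (hw j).ne'
    exact hij (Fin.ext (by exact_mod_cast sub_eq_zero.1 h7))
  have hpos : (0 : ℝ) < 1 / (ℓ + 1) := by positivity
  obtain ⟨ε, hε, hεB⟩ := (Set.Ioo_infinite hpos).exists_notMem_finite hfin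
  refine ⟨fun i => w i * (1 + ε * i), fun i j hij => ?_, fun i => ?_⟩
  · by_contra hne
    exact hεB (Set.mem_iUnion.2 ⟨i, Set.mem_iUnion.2 ⟨j, hne, hij⟩⟩)
  · have h1 : 0 ≤ ε * i := mul_nonneg hε.1.le (Nat.cast_nonneg _)
    have h2 : ε * i ≤ 1 := by
      have h3 : (i : ℝ) ≤ ℓ + 1 := by exact_mod_cast i.2.le.trans (Nat.le_succ ℓ)
      calc ε * i ≤ 1 / (ℓ + 1) * (ℓ + 1) :=
            mul_le_mul hε.2.le h3 (Nat.cast_nonneg _) hpos.le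
        _ = 1 := by field_simp
    have h4 := hw i
    constructor <;> nlinarith

namespace PagingInstance

variable {I : PagingInstance ℓ}

/-- The concatenation of the requests `ρ`, each of which is repeated as often as `R` says. -/
def repeatRounds (R : List (Fin ℓ × ℕ) → Fin ℓ × ℕ → ℕ) (ρ : List (Fin ℓ × ℕ)) :
    List (Fin ℓ × ℕ) :=
  ρ.foldl (fun β r => β ++ List.replicate (R β r + 1) r) []

lemma repeatRounds_append_singleton (R : List (Fin ℓ × ℕ) → Fin ℓ × ℕ → ℕ)
    (ρ : List (Fin ℓ × ℕ)) (r : Fin ℓ × ℕ) :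
    repeatRounds R (ρ ++ [r]) =
      repeatRounds R ρ ++ List.replicate (R (repeatRounds R ρ) r + 1) r := by
  simp [repeatRounds]

/-- A division into units is realised by holding the first pages of each class, and repetitions cost
nothing. In the factor `2 * I.k`, the 2 bounds the perturbed weights and `I.k` undoes the
normalization of the grid cost. -/
lemma serveReach_of_gridReach (G : I.Numbering) (R : List (Fin ℓ × ℕ) → Fin ℓ × ℕ → ℕ)
    {w : Fin ℓ → ℝ} (hI : ∀ i, I.weight i ≤ 2 * w i) {N₀ N : Fin ℓ → ℕ}
    (h0 : I.init = G.initial N₀) {ρ : List (Fin ℓ × ℕ)} {v : ℝ} (h : GridReach I.k w N₀ ρ N v) :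
    I.ServeReach (G.flat (repeatRounds R ρ)) (G.initial N) (2 * I.k * v) := by
  have hk : (0 : ℝ) < I.k := Nat.cast_pos.2 I.k_pos
  induction h with
  | nil =>
    rw [← h0, mul_zero]
    exact serveReach_nil
  | @append ρ N N' v r _ hN hr ih =>
    rw [repeatRounds_append_singleton, Numbering.flat_append]
    refine (ih.append_list (G.flat_replicate_ne_nil _ r) (fun p hp => ?_)
      (G.card_initial_le hN)).mono ?_
    · obtain ⟨h1, h2⟩ := G.mem_flat_replicate hp
      simp only [Numbering.initial, Finset.mem_filter, Finset.mem_univ, true_and, h1]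
      exact h2.trans_le hr
    · rw [mul_add]
      refine add_le_add le_rfl ((G.fetchWeight_initial_le N N').trans ?_)
      have h1 : 2 * (I.k : ℝ) * ((∑ i, w i * |(N' i : ℝ) - N i|) / I.k) =
          ∑ i, 2 * w i * |(N' i : ℝ) - N i| := by
        simp only [mul_assoc, ← Finset.mul_sum]
        field_simp
      rw [h1]
      exact Finset.sum_le_sum fun i _ => mul_le_mul_of_nonneg_right (hI i) (abs_nonneg _)

lemma gridInstance_init {w : Fin ℓ → ℝ} (hw : ∀ i, 0 < w i) (hinj : Function.Injective w) {k : ℕ}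
    (hk : 0 < k) (N : Fin ℓ → ℕ) (hN : ∑ i, N i ≤ k) :
    (gridInstance hw hinj hk N hN).init = (gridNumbering hw hinj hk N hN).initial N := rfl

end PagingInstance

open PagingInstance

/-- A competitive paging algorithm yields a competitive algorithm for allocation with thresholds on
a grid. -/
theorem exists_grid_algorithm (hℓ : 1 ≤ ℓ) {φ : ℝ≥0} (h : WIMPCompetitive ℓ φ) {w : Fin ℓ → ℝ}
    (hw : ∀ i, 0 < w i) {k : ℕ} (hk : 0 < k) {N₀ : Fin ℓ → ℕ} (hN : ∑ i, N₀ i ≤ k) :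
    ∃ (p : List (Fin ℓ × ℕ) → Simplex ℓ) (a : ℝ),
      (∀ ρ i j, j + 1 ≤ k → (j : ℝ) / k ≤ (p (ρ ++ [(i, j)])).1 i) ∧
      ∀ ρ N v, GridReach k w N₀ ρ N v → pathCost w p ρ ≤ 8 * φ * v + a := by
  obtain ⟨w', hinj, hw'⟩ := exists_injective_weights hw
  have hpos : ∀ i, 0 < w' i := fun i => (hw i).trans_le (hw' i).1
  set I := gridInstance hpos hinj hk N₀ hN with hI
  set G : I.Numbering := gridNumbering hpos hinj hk N₀ hN with hG
  obtain ⟨Ω, _, μ, _, A, hA, a, hc⟩ := h I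
  have : Nonempty (Fin ℓ) := ⟨⟨0, hℓ⟩⟩
  obtain ⟨i₀, hi₀⟩ := Finite.exists_min w
  choose R hR using exists_rounds (μ := μ) G hA hc
  have hkr : (0 : ℝ) < k := Nat.cast_pos.2 hk
  set z : List (Fin ℓ × ℕ) → Fin ℓ → ℝ :=
    fun ρ i => expCard μ A G i (repeatRounds R ρ) / k with hz
  have hz0 : ∀ ρ i, 0 ≤ z ρ i := fun ρ i => div_nonneg (expCard_nonneg G _ _) hkr.le
  have hzs : ∀ ρ, ∑ i, z ρ i ≤ 1 := fun ρ => by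
    simp only [hz]
    rw [← Finset.sum_div, div_le_one hkr]
    exact sum_expCard_le G hA _
  set p : List (Fin ℓ × ℕ) → Simplex ℓ := fun ρ => fillSimplex i₀ (z ρ) (hz0 ρ) (hzs ρ) with hp
  have hinit : I.init = G.initial N₀ :=
    gridInstance_init hpos hinj hk N₀ hN
  -- Paging pays only for increases, while allocation pays for both directions. Since the absolute
  -- change is twice its positive part minus the change, the weighted content serves as potential.
  -- Filling up the cheapest coordinate doubles the movement, whence `2 / k` and `4 / k`.
  have hpot : ∀ ρ, pathCost w p ρ + 2 / k * ∑ i, w' i * expCard μ A G i (repeatRounds R ρ) ≤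
      4 / k * expCost μ A G (repeatRounds R ρ) +
        2 / k * ∑ i, w' i * expCard μ A G i [] := by
    intro ρ
    induction ρ using List.reverseRecOn with
    | nil =>
      have := expCost_nonneg (μ := μ) (A := A) G []
      have h1 : repeatRounds R [] = [] := rfl
      rw [h1]
      simp only [pathCost, List.length_nil, Finset.range_zero, Finset.sum_empty, zero_add]
      exact le_add_of_nonneg_left (by positivity)
    | append_singleton ρ r ih =>
      rw [pathCost_append_singleton]
      have h1 := expCost_add_le (μ := μ) G hA (repeatRounds R ρ)
        (List.replicate (R (repeatRounds R ρ) r + 1) r)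
      rw [← repeatRounds_append_singleton] at h1
      have h2 : weightedDist w (p ρ) (p (ρ ++ [r])) ≤
          2 * ∑ i, w i * |z (ρ ++ [r]) i - z ρ i| :=
        sum_abs_fillCoord_sub_le hi₀ (hw i₀).le _ _
      have h3 : ∑ i, w i * |z (ρ ++ [r]) i - z ρ i| ≤
          1 / k * ∑ i, w' i * |expCard μ A G i (repeatRounds R (ρ ++ [r])) -
            expCard μ A G i (repeatRounds R ρ)| := by
        rw [Finset.mul_sum]
        refine Finset.sum_le_sum fun i _ => ?_
        simp only [hz]
        rw [← sub_div, abs_div, abs_of_pos hkr, mul_div_assoc', div_eq_inv_mul, ← one_div]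
        exact mul_le_mul_of_nonneg_left
          (mul_le_mul_of_nonneg_right (hw' i).1 (abs_nonneg _)) (by positivity)
      have h4 : ∑ i, I.weight i * ((|expCard μ A G i (repeatRounds R (ρ ++ [r])) -
          expCard μ A G i (repeatRounds R ρ)| + (expCard μ A G i (repeatRounds R (ρ ++ [r])) -
            expCard μ A G i (repeatRounds R ρ))) / 2) =
          1 / 2 * (∑ i, w' i * |expCard μ A G i (repeatRounds R (ρ ++ [r])) -
            expCard μ A G i (repeatRounds R ρ)|) +
          1 / 2 * (∑ i, w' i * expCard μ A G i (repeatRounds R (ρ ++ [r])) -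
            ∑ i, w' i * expCard μ A G i (repeatRounds R ρ)) := by
        rw [← Finset.sum_sub_distrib, ← mul_add, ← Finset.sum_add_distrib, Finset.mul_sum]
        refine Finset.sum_congr rfl fun i _ => ?_
        rw [show I.weight i = w' i from rfl]
        ring
      rw [h4] at h1
      have h5 := mul_le_mul_of_nonneg_left h1 (show (0 : ℝ) ≤ 4 / k by positivity)
      have h6 : 4 / (k : ℝ) = 2 * (2 * (1 / k)) := by ring
      have h7 : 2 / (k : ℝ) = 2 * (1 / k) := by ring
      rw [h6] at h5 ih ⊢
      rw [h7] at ih ⊢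
      linarith
  refine ⟨p, 4 / k * (φ * ((G.flat (Numbering.finale (I := I))).length * I.totalWeight) + a) +
    2 / k * ∑ i, w' i * expCard μ A G i [], fun ρ i j hj => ?_, fun ρ N v hreach => ?_⟩
  · refine le_trans ?_ (le_fillCoord i₀ (hzs _) i)
    simp only [hz]
    rw [repeatRounds_append_singleton]
    exact div_le_div_of_nonneg_right (hR _ (i, j) hj) hkr.le
  · have h1 := hpot ρ
    have hv := hreach.nonneg hw
    have h2 : expCost μ A G (repeatRounds R ρ) ≤ φ * (2 * k * v +
        (G.flat (Numbering.finale (I := I))).length * I.totalWeight) + a :=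
      expCost_le_of_serveReach G hA hc (by positivity)
        (serveReach_of_gridReach G R (fun i => (hw' i).2) hinit hreach)
    have h3 := mul_le_mul_of_nonneg_left h2 (show (0 : ℝ) ≤ 4 / k by positivity)
    have h4 : 0 ≤ 2 / k * ∑ i, w' i * expCard μ A G i (repeatRounds R ρ) :=
      mul_nonneg (by positivity)
        (Finset.sum_nonneg fun i _ => mul_nonneg (hpos i).le (expCard_nonneg G _ _))
    -- The competitive factor 8 arises as `4 / k` times `2 * k`.
    have h5 : 4 / k * (φ * (2 * k * v +
        (G.flat (Numbering.finale (I := I))).length * I.totalWeight) + a) = 8 * φ * v +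
        4 / k * (φ * ((G.flat (Numbering.finale (I := I))).length * I.totalWeight) + a) := by
      field_simp
      ring
    linarith

end GridAlgorithm

/-! ### An additive constant independent of the mesh -/

section Restart

variable {ℓ : ℕ}

lemma weightedDist_triangle {w : Fin ℓ → ℝ} (hw : ∀ i, 0 < w i) (x y z : Simplex ℓ) :
    weightedDist w x z ≤ weightedDist w x y + weightedDist w y z := by
  rw [weightedDist, weightedDist, weightedDist, ← Finset.sum_add_distrib]
  refine Finset.sum_le_sum fun i _ => ?_
  rw [← mul_add, add_comm]
  exact mul_le_mul_of_nonneg_left (abs_sub_le _ _ _) (hw i).le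

lemma weightedDist_self (w : Fin ℓ → ℝ) (x : Simplex ℓ) : weightedDist w x x = 0 := by
  simp [weightedDist]

/-- After `ρ` the division is first returned to `N₀`, at cost at most the sum of the weights. The
return is performed lazily: the distance to the division of `τ` is kept as a debt that the next
request settles. -/
lemma GridReach.concat {k : ℕ} (hk : 0 < k) {w : Fin ℓ → ℝ} (hw : ∀ i, 0 < w i)
    {N₀ N₁ N : Fin ℓ → ℕ} (h0 : ∑ i, N₀ i ≤ k) {ρ τ : List (Fin ℓ × ℕ)} {v₁ v : ℝ}
    (h1 : GridReach k w N₀ ρ N₁ v₁) (h : GridReach k w N₀ τ N v) :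
    ∃ M u, GridReach k w N₀ (ρ ++ τ) M u ∧
      u + (∑ i, w i * |(N i : ℝ) - M i|) / k ≤ v₁ + ∑ i, w i + v := by
  have hkr : (0 : ℝ) < k := Nat.cast_pos.2 hk
  induction h with
  | nil =>
    refine ⟨N₁, v₁, by simpa using h1, ?_⟩
    rw [add_zero]
    refine add_le_add le_rfl ?_
    rw [div_le_iff₀ hkr, Finset.sum_mul]
    refine Finset.sum_le_sum fun i _ => mul_le_mul_of_nonneg_left ?_ (hw i).le
    have h2 : N₀ i ≤ k := (Finset.single_le_sum (fun _ _ => Nat.zero_le _)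
      (Finset.mem_univ i)).trans h0
    have h3 : N₁ i ≤ k := (Finset.single_le_sum (fun _ _ => Nat.zero_le _)
      (Finset.mem_univ i)).trans (h1.sum_le h0)
    have h2' : (N₀ i : ℝ) ≤ k := by exact_mod_cast h2
    have h3' : (N₁ i : ℝ) ≤ k := by exact_mod_cast h3
    have h4 : (0 : ℝ) ≤ N₀ i := Nat.cast_nonneg _
    have h5 : (0 : ℝ) ≤ N₁ i := Nat.cast_nonneg _
    rw [abs_le]
    constructor <;> linarith
  | @append τ N N' v r _ hN hr ih =>
    obtain ⟨M, u, hM, hu⟩ := ih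
    refine ⟨N', _, by rw [← List.append_assoc]; exact hM.append hN hr, ?_⟩
    have h2 : ∑ i, w i * |(N' i : ℝ) - M i| ≤
        ∑ i, w i * |(N' i : ℝ) - N i| + ∑ i, w i * |(N i : ℝ) - M i| := by
      rw [← Finset.sum_add_distrib]
      refine Finset.sum_le_sum fun i _ => ?_
      rw [← mul_add]
      exact mul_le_mul_of_nonneg_left (abs_sub_le _ _ _) (hw i).le
    have h3 := div_le_div_of_nonneg_right h2 hkr.le
    rw [add_div] at h3
    simp only [sub_self, abs_zero, mul_zero, Finset.sum_const_zero, zero_div, add_zero]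
    linarith

/-- By restarting after a prefix that maximizes the additive constant, it is made independent
of the grid. -/
theorem exists_grid_algorithm_uniform (hℓ : 1 ≤ ℓ) {φ : ℝ≥0} (h : WIMPCompetitive ℓ φ)
    {w : Fin ℓ → ℝ} (hw : ∀ i, 0 < w i) {k : ℕ} (hk : 0 < k) {N₀ : Fin ℓ → ℕ}
    (hN : ∑ i, N₀ i ≤ k) (x₀ : Simplex ℓ) :
    ∃ p : List (Fin ℓ × ℕ) → Simplex ℓ, p [] = x₀ ∧
      (∀ ρ i j, j + 1 ≤ k → (j : ℝ) / k ≤ (p (ρ ++ [(i, j)])).1 i) ∧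
      ∀ ρ N v, GridReach k w N₀ ρ N v →
        pathCost w p ρ ≤ 8 * φ * v + (1 + (8 * φ + 1) * ∑ i, w i) := by
  obtain ⟨p, a, hp, hcost⟩ := exists_grid_algorithm hℓ h hw hk hN
  set S : Set ℝ := {s | ∃ ρ N v, GridReach k w N₀ ρ N v ∧ s = pathCost w p ρ - 8 * φ * v} with hS
  have hbdd : BddAbove S := by
    refine ⟨a, ?_⟩
    rintro s ⟨ρ, N, v, hr, rfl⟩
    linarith [hcost ρ N v hr]
  have hne : S.Nonempty := ⟨_, [], N₀, 0, GridReach.nil, rfl⟩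
  -- After a prefix whose excess over the competitive bound is within 1 of the supremum, any
  -- continuation can add at most 1 to the excess, besides the cost of joining the two offline
  -- solutions.
  obtain ⟨s, ⟨ρ₀, N₁, v₁, hr₁, rfl⟩, hs⟩ := exists_lt_of_lt_csSup hne (sub_one_lt (sSup S))
  set q : List (Fin ℓ × ℕ) → Simplex ℓ := fun τ => if τ = [] then x₀ else p (ρ₀ ++ τ) with hq
  refine ⟨q, by simp [hq], fun ρ i j hj => ?_, fun τ N v hr => ?_⟩
  · simp only [hq, List.append_eq_nil_iff, List.cons_ne_self, and_false, if_false]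
    rw [← List.append_assoc]
    exact hp _ i j hj
  · obtain ⟨M, u, hM, hu⟩ := GridReach.concat hk hw hN hr₁ hr
    have h1 : pathCost w p (ρ₀ ++ τ) - 8 * φ * u ≤ sSup S := le_csSup hbdd ⟨_, M, u, hM, rfl⟩
    have h2 : 0 ≤ (∑ i, w i * |(N i : ℝ) - M i|) / k := div_nonneg (Finset.sum_nonneg fun i _ =>
      mul_nonneg (hw i).le (abs_nonneg _)) (Nat.cast_nonneg _)
    -- The new algorithm waits at `x₀` and joins the old one at its first request; the distance term
    -- covers this single jump.
    have h3 : ∀ τ, pathCost w q τ + weightedDist w (q τ) (p (ρ₀ ++ τ)) ≤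
        pathCost w p (ρ₀ ++ τ) - pathCost w p ρ₀ + ∑ i, w i := by
      intro τ
      induction τ using List.reverseRecOn with
      | nil => simpa [pathCost] using weightedDist_le hw (q []) (p ρ₀)
      | append_singleton τ r ih =>
        have h4 : q (τ ++ [r]) = p (ρ₀ ++ τ ++ [r]) := by simp [hq]
        rw [← List.append_assoc, pathCost_append_singleton, pathCost_append_singleton, h4,
          weightedDist_self]
        have := weightedDist_triangle hw (q τ) (p (ρ₀ ++ τ)) (p (ρ₀ ++ τ ++ [r]))
        linarith
    have h4 := h3 τ
    have h5 := weightedDist_nonneg hw (q τ) (p (ρ₀ ++ τ))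
    have h6 : (8 * φ : ℝ) * u ≤ 8 * φ * (v₁ + ∑ i, w i + v) :=
      mul_le_mul_of_nonneg_left (by linarith) (by positivity)
    linarith

end Restart

open Filter Topology

/-! ### Limits of grid algorithms as the mesh tends to zero -/

section Limit

variable {ℓ : ℕ}

/-- `c` is a threshold of the request `r`, and a threshold that can be exceeded. -/
def IsThreshold (r : AllocRequest ℓ) (c : ℝ) : Prop :=
  0 ≤ c ∧ c < 1 ∧ ∀ z : Set.Icc (0 : ℝ) 1, r.cost z = if (z : ℝ) ≤ c then ⊤ else 0

/-- The threshold of a request. -/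
noncomputable def threshold (r : AllocRequest ℓ) : ℝ := Classical.epsilon (IsThreshold r)

lemma isThreshold_threshold {r : AllocRequest ℓ} (h : ∃ c, IsThreshold r c) :
    IsThreshold r (threshold r) := Classical.epsilon_spec h

/-- The threshold of the `t`-th request `r`, raised by an amount that is summable in `t`. -/
noncomputable def raisedThreshold (t : ℕ) (r : AllocRequest ℓ) : ℝ :=
  threshold r + (1 / 2) ^ (t + 2) * (1 - threshold r)

/-- The requests on a grid with mesh `1 / k` that correspond to `σ`. -/
noncomputable def gridRequests (k : ℕ) (σ : List (AllocRequest ℓ)) : List (Fin ℓ × ℕ) :=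
  σ.mapIdx fun t r => (r.dir, ⌊k * raisedThreshold t r⌋₊)

lemma gridRequests_append_singleton (k : ℕ) (σ : List (AllocRequest ℓ)) (r : AllocRequest ℓ) :
    gridRequests k (σ ++ [r]) =
      gridRequests k σ ++ [(r.dir, ⌊k * raisedThreshold σ.length r⌋₊)] := by
  simp [gridRequests, List.mapIdx_append]

lemma raisedThreshold_mem {t : ℕ} {r : AllocRequest ℓ} (h : ∃ c, IsThreshold r c) :
    0 ≤ threshold r ∧ threshold r < raisedThreshold t r ∧ raisedThreshold t r < 1 := by
  obtain ⟨h0, h1, -⟩ := isThreshold_threshold h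
  have h2 : (0 : ℝ) < (1 / 2) ^ (t + 2) := by positivity
  have h3 : (1 / 2 : ℝ) ^ (t + 2) < 1 := pow_lt_one₀ (by norm_num) (by norm_num) (by omega)
  refine ⟨h0, ?_, ?_⟩ <;> rw [raisedThreshold] <;> nlinarith

/-- The units that an integral division on a grid with mesh `1 / k` assigns to the coordinates. -/
noncomputable def gridFloor (k : ℕ) (x : Simplex ℓ) (i : Fin ℓ) : ℕ := ⌊k * x.1 i⌋₊

lemma gridFloor_le (k : ℕ) (x : Simplex ℓ) (i : Fin ℓ) : (gridFloor k x i : ℝ) ≤ k * x.1 i :=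
  Nat.floor_le (mul_nonneg (Nat.cast_nonneg _) (x.2.1 i))

lemma sum_gridFloor_le (k : ℕ) (x : Simplex ℓ) : ∑ i, gridFloor k x i ≤ k := by
  have h : (∑ i, (gridFloor k x i : ℝ)) ≤ k := by
    refine (Finset.sum_le_sum fun i _ => gridFloor_le k x i).trans ?_
    rw [← Finset.mul_sum, x.2.2, mul_one]
  exact_mod_cast h

/-- Rounding down moves each coordinate by less than one unit, in the same direction at both points,
so a difference changes by at most one unit. -/
lemma sum_abs_gridFloor_le {w : Fin ℓ → ℝ} (hw : ∀ i, 0 < w i) {k : ℕ} (hk : 0 < k)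
    (x y : Simplex ℓ) : (∑ i, w i * |(gridFloor k y i : ℝ) - gridFloor k x i|) / k ≤
      weightedDist w x y + (∑ i, w i) / k := by
  have hkr : (0 : ℝ) < k := Nat.cast_pos.2 hk
  rw [div_le_iff₀ hkr, add_mul, div_mul_cancel₀ _ hkr.ne', weightedDist, Finset.sum_mul,
    ← Finset.sum_add_distrib]
  refine Finset.sum_le_sum fun i _ => ?_
  have h1 := gridFloor_le k x i
  have h2 := gridFloor_le k y i
  have h3 : k * x.1 i < gridFloor k x i + 1 := Nat.lt_floor_add_one _
  have h4 : k * y.1 i < gridFloor k y i + 1 := Nat.lt_floor_add_one _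
  have h5 : |(gridFloor k y i : ℝ) - gridFloor k x i| ≤ |y.1 i - x.1 i| * k + 1 := by
    have h6 : |y.1 i - x.1 i| * k = |k * y.1 i - k * x.1 i| := by
      rw [← mul_sub, abs_mul, abs_of_pos hkr, mul_comm]
    rw [h6, abs_le]
    have h7 := le_abs_self (k * y.1 i - k * x.1 i)
    have h8 := neg_abs_le (k * y.1 i - k * x.1 i)
    constructor <;> linarith
  calc _ ≤ w i * (|y.1 i - x.1 i| * k + 1) := mul_le_mul_of_nonneg_left h5 (hw i).le
    _ = _ := by ring

/-- The point that divides the segment from `x` to the `j`-th vertex in the ratio `θ : 1 - θ`. -/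
noncomputable def towards (x : Simplex ℓ) (j : Fin ℓ) {θ : ℝ} (h0 : 0 ≤ θ) (h1 : θ ≤ 1) :
    Simplex ℓ :=
  ⟨fun i => (1 - θ) * x.1 i + θ * (if i = j then 1 else 0), fun i => by
    have := x.2.1 i
    have : 0 ≤ 1 - θ := by linarith
    dsimp only
    split_ifs <;> positivity, by
    rw [Finset.sum_add_distrib, ← Finset.mul_sum, ← Finset.mul_sum, x.2.2]
    simp⟩

lemma weightedDist_towards_le {w : Fin ℓ → ℝ} (hw : ∀ i, 0 < w i) (x : Simplex ℓ) (j : Fin ℓ)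
    {θ : ℝ} (h0 : 0 ≤ θ) (h1 : θ ≤ 1) : weightedDist w x (towards x j h0 h1) ≤ θ * ∑ i, w i := by
  rw [weightedDist, Finset.mul_sum]
  refine Finset.sum_le_sum fun i _ => ?_
  have h2 := mem_Icc_of_mem_stdSimplex x.2 i
  have h3 : (towards x j h0 h1).1 i - x.1 i = θ * ((if i = j then 1 else 0) - x.1 i) := by
    simp only [towards]
    ring
  have h4 : |(if i = j then 1 else 0) - x.1 i| ≤ 1 := by
    rw [abs_le]
    split_ifs <;> constructor <;> linarith [h2.1, h2.2]
  rw [h3, abs_mul, abs_of_nonneg h0, mul_comm θ (w i)]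
  exact mul_le_mul_of_nonneg_left (mul_le_of_le_one_right h0 h4) (hw i).le

lemma le_towards (x : Simplex ℓ) (j : Fin ℓ) {θ : ℝ} (h0 : 0 ≤ θ) (h1 : θ ≤ 1) :
    (towards x j h0 h1).1 j = x.1 j + θ * (1 - x.1 j) := by
  simp only [towards, if_true]
  ring

lemma moveCost_eq (w : Fin ℓ → ℝ) (x y : Simplex ℓ) :
    moveCost w x y = ENNReal.ofReal (weightedDist w x y) := rfl

/-- A trajectory of finite cost is turned into a solution on all sufficiently fine grids. -/
lemma eventually_gridReach {w : Fin ℓ → ℝ} (hw : ∀ i, 0 < w i) (x : ℕ → Simplex ℓ)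
    {σ : List (AllocRequest ℓ)} (hσ : ∀ r ∈ σ, IsStrictThreshold r) (hx : allocCost w σ x ≠ ⊤) :
    (∀ r ∈ σ, ∃ c, IsThreshold r c) ∧
    ∃ z : Simplex ℓ, weightedDist w z (x σ.length) ≤ (1 / 2) ^ σ.length * ∑ i, w i ∧
      ∀ᶠ k : ℕ in atTop, ∃ v,
        GridReach (k + 1) w (gridFloor (k + 1) (x 0)) (gridRequests (k + 1) σ)
          (gridFloor (k + 1) z) v ∧
        v ≤ (allocCost w σ x).toReal + 3 * (1 - (1 / 2) ^ σ.length) * ∑ i, w i +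
          σ.length * ((∑ i, w i) / (k + 1 : ℕ)) := by
  have hW : 0 ≤ ∑ i, w i := Finset.sum_nonneg fun i _ => (hw i).le
  induction σ using List.reverseRecOn with
  | nil =>
    refine ⟨by simp, x 0, by simpa [weightedDist_self] using hW, Eventually.of_forall fun k => ?_⟩
    exact ⟨0, GridReach.nil, by simp [allocCost_nil]⟩
  | append_singleton σ r ih =>
    rw [allocCost_append_singleton] at hx
    have hx1 := (ENNReal.add_ne_top.1 hx).1
    have hx2 := (ENNReal.add_ne_top.1 (ENNReal.add_ne_top.1 hx).2)
    obtain ⟨hthr, z, hz, hev⟩ := ih (fun q hq => hσ q (List.mem_append_left _ hq)) hx1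
    set s := σ.length with hs
    have hr : ∃ c, IsThreshold r c := by
      obtain ⟨c, hc0, hc⟩ := hσ r (by simp)
      have h1 : c < (x (s + 1)).1 r.dir := by
        by_contra hle
        refine hx2.2 ?_
        rw [hc]
        exact if_pos (not_lt.1 hle)
      exact ⟨c, hc0, h1.trans_le (mem_Icc_of_mem_stdSimplex (x (s + 1)).2 r.dir).2, hc⟩
    obtain ⟨hc0, hc1, hc⟩ := isThreshold_threshold hr
    have hgt : threshold r < (x (s + 1)).1 r.dir := by
      by_contra hle
      refine hx2.2 ?_
      rw [hc]
      exact if_pos (not_lt.1 hle)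
    have hcost : r.cost (coord (x (s + 1)) r.dir) = 0 := by
      rw [hc]
      exact if_neg (not_le.2 hgt)
    have hθ0 : (0 : ℝ) ≤ (1 / 2) ^ (s + 1) := by positivity
    have hθ1 : (1 / 2 : ℝ) ^ (s + 1) ≤ 1 := pow_le_one₀ (by norm_num) (by norm_num)
    -- This push raises the requested coordinate to at least the raised threshold plus `(1 / 2) ^ (s
    -- + 2) * (1 - threshold r)`. On grids with `k ≥ K` that gap exceeds one unit and absorbs the
    -- rounding and the required extra unit.
    set z' := towards (x (s + 1)) r.dir hθ0 hθ1 with hz'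
    have hdz' := weightedDist_towards_le hw (x (s + 1)) r.dir hθ0 hθ1
    have hsymm : weightedDist w z' (x (s + 1)) = weightedDist w (x (s + 1)) z' := by
      simp only [weightedDist, abs_sub_comm]
    refine ⟨?_, z', ?_, ?_⟩
    · intro q hq
      rcases List.mem_append.1 hq with hq | hq
      · exact hthr q hq
      · rw [List.mem_singleton.1 hq]
        exact hr
    · rw [List.length_append, List.length_singleton, ← hs, hsymm]
      exact hdz'
    · have hpos : 0 < (1 / 2 : ℝ) ^ (s + 2) * (1 - threshold r) :=
        mul_pos (by positivity) (by linarith)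
      obtain ⟨K, hK⟩ := exists_nat_gt (1 / ((1 / 2 : ℝ) ^ (s + 2) * (1 - threshold r)))
      rw [div_lt_iff₀ hpos] at hK
      filter_upwards [hev, eventually_ge_atTop K] with k ⟨v, hv, hvle⟩ hkK
      have hj : ⌊((k + 1 : ℕ) : ℝ) * raisedThreshold s r⌋₊ + 1 ≤ gridFloor (k + 1) z' r.dir := by
        refine Nat.le_floor ?_
        rw [hz', le_towards]
        have h1 : (⌊((k + 1 : ℕ) : ℝ) * raisedThreshold s r⌋₊ : ℝ) ≤
            ((k + 1 : ℕ) : ℝ) * raisedThreshold s r := by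
          refine Nat.floor_le (mul_nonneg (Nat.cast_nonneg _) ?_)
          have := raisedThreshold_mem (t := s) hr
          linarith
        have h2 : ((K : ℕ) : ℝ) ≤ ((k + 1 : ℕ) : ℝ) := by exact_mod_cast hkK.trans (Nat.le_succ k)
        have h3 : 1 ≤ ((k + 1 : ℕ) : ℝ) * ((1 / 2 : ℝ) ^ (s + 2) * (1 - threshold r)) :=
          hK.le.trans (mul_le_mul_of_nonneg_right h2 hpos.le)
        have h4 : (1 - (1 / 2 : ℝ) ^ (s + 1)) * threshold r ≤
            (1 - (1 / 2 : ℝ) ^ (s + 1)) * (x (s + 1)).1 r.dir :=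
          mul_le_mul_of_nonneg_left hgt.le (by linarith)
        have h5 : raisedThreshold s r + (1 / 2 : ℝ) ^ (s + 2) * (1 - threshold r) ≤
            (x (s + 1)).1 r.dir + (1 / 2) ^ (s + 1) * (1 - (x (s + 1)).1 r.dir) := by
          rw [raisedThreshold]
          have h6 : (1 / 2 : ℝ) ^ (s + 1) = 2 * (1 / 2) ^ (s + 2) := by ring
          rw [h6] at h4 ⊢
          linarith
        have h7 := mul_le_mul_of_nonneg_left h5 (Nat.cast_nonneg (α := ℝ) (k + 1))
        push_cast at h1 h3 h7 ⊢
        linarith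
      refine ⟨_, by
        rw [gridRequests_append_singleton]
        exact hv.append (sum_gridFloor_le _ z') hj, ?_⟩
      have h1 := sum_abs_gridFloor_le hw (Nat.succ_pos k) z z'
      have h2 := weightedDist_triangle hw z (x s) z'
      have h3 := weightedDist_triangle hw (x s) (x (s + 1)) z'
      have h4 : (allocCost w (σ ++ [r]) x).toReal =
          (allocCost w σ x).toReal + weightedDist w (x s) (x (s + 1)) := by
        rw [allocCost_append_singleton, ← hs, hcost, add_zero, ENNReal.toReal_add hx1 hx2.1,
          moveCost_eq, ENNReal.toReal_ofReal (weightedDist_nonneg hw _ _)]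
      rw [h4, List.length_append, List.length_singleton, ← hs]
      -- Beyond the original move, the detour costs `(1 / 2) ^ s + (1 / 2) ^ (s + 1)`, i.e. `3 * (1
      -- / 2) ^ (s + 1)`, times the total weight; the sum over the steps is the bound with `3 * (1 -
      -- (1 / 2) ^ s)`.
      have h5 : (1 / 2 : ℝ) ^ s = 2 * (1 / 2) ^ (s + 1) := by ring
      rw [h5] at hvle hz
      rw [Nat.cast_add_one s, add_mul _ 1, one_mul]
      linarith

/-- Compactness of the simplex. A fixed ultrafilter provides limits for all histories
simultaneously, without choosing subsequences. -/
lemma exists_tendsto_hyperfilter (f : ℕ → Simplex ℓ) :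
    ∃ x, Tendsto f (hyperfilter ℕ : Filter ℕ) (𝓝 x) := by
  have := (isCompact_univ (X := Simplex ℓ)).ultrafilter_le_nhds ((hyperfilter ℕ).map f)
    (by simp)
  obtain ⟨x, -, hx⟩ := this
  exact ⟨x, hx⟩

lemma tendsto_coordinate {F : Filter ℕ} {f : ℕ → Simplex ℓ} {x : Simplex ℓ}
    (hf : Tendsto f F (𝓝 x)) (i : Fin ℓ) : Tendsto (fun k => (f k).1 i) F (𝓝 (x.1 i)) :=
  tendsto_pi_nhds.1 ((continuous_subtype_val.tendsto x).comp hf) i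

lemma tendsto_weightedDist (w : Fin ℓ → ℝ) {F : Filter ℕ} {f g : ℕ → Simplex ℓ} {x y : Simplex ℓ}
    (hf : Tendsto f F (𝓝 x)) (hg : Tendsto g F (𝓝 y)) :
    Tendsto (fun k => weightedDist w (f k) (g k)) F (𝓝 (weightedDist w x y)) :=
  tendsto_finsetSum _ fun i _ =>
    (((tendsto_coordinate hg i).sub (tendsto_coordinate hf i)).abs).const_mul _

lemma hyperfilter_nat_le_atTop : (hyperfilter ℕ : Filter ℕ) ≤ atTop := by
  rw [← Nat.cofinite_eq_atTop]
  exact hyperfilter_le_cofinite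

/-- A positive competitive ratio for paging is, up to a constant factor, attained for strict
allocation. -/
theorem strictAllocCompetitive_of_wimp (hℓ : 1 ≤ ℓ) {φ : ℝ≥0} (hφ : 0 < φ)
    (h : WIMPCompetitive ℓ φ) : StrictAllocCompetitive ℓ (8 * φ) := by
  intro w hw x₀
  set W := ∑ i, w i with hW
  have hW0 : 0 ≤ W := Finset.sum_nonneg fun i _ => (hw i).le
  choose p hp0 hpfeas hpcost using fun k : ℕ =>
    exists_grid_algorithm_uniform hℓ h hw (Nat.succ_pos k) (sum_gridFloor_le (k + 1) x₀) x₀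
  choose A hA using fun σ : List (AllocRequest ℓ) =>
    exists_tendsto_hyperfilter fun k => p k (gridRequests (k + 1) σ)
  have hA0 : A [] = x₀ := by
    refine tendsto_nhds_unique (hA []) ?_
    have : (fun k => p k (gridRequests (k + 1) [])) = fun _ => x₀ := funext fun k => hp0 k
    rw [this]
    exact tendsto_const_nhds
  have hpath : ∀ σ, Tendsto (fun k => pathCost w (p k) (gridRequests (k + 1) σ))
      (hyperfilter ℕ : Filter ℕ) (𝓝 (pathCost w A σ)) := by
    intro σ
    induction σ using List.reverseRecOn with
    | nil => simp [pathCost, gridRequests]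
    | append_singleton σ r ih =>
      simp only [gridRequests_append_singleton, pathCost_append_singleton]
      refine ih.add ?_
      have h1 := hA (σ ++ [r])
      simp only [gridRequests_append_singleton] at h1
      exact tendsto_weightedDist w (hA σ) h1
  have hserve : ∀ σ r, (∃ c, IsThreshold r c) →
      r.cost (coord (A (σ ++ [r])) r.dir) = 0 := by
    intro σ r hr
    obtain ⟨hc0, hc1, hc2⟩ := raisedThreshold_mem (t := σ.length) hr
    rw [(isThreshold_threshold hr).2.2, if_neg]
    refine not_le.2 (hc1.trans_le ?_)
    have h1 : Tendsto (fun k => (p k (gridRequests (k + 1) (σ ++ [r]))).1 r.dir)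
        (hyperfilter ℕ : Filter ℕ) (𝓝 ((A (σ ++ [r])).1 r.dir)) :=
      tendsto_coordinate (hA (σ ++ [r])) r.dir
    -- Only the threshold rounded down to the grid is guaranteed, at a loss of at most one mesh
    -- width. The limit therefore reaches the raised threshold, which lies strictly above the
    -- original one.
    have h2 : Tendsto (fun k : ℕ => raisedThreshold σ.length r - 1 / ((k : ℝ) + 1))
        (hyperfilter ℕ : Filter ℕ) (𝓝 (raisedThreshold σ.length r - 0)) :=
      (tendsto_const_nhds.sub tendsto_one_div_add_atTop_nhds_zero_nat).mono_left
        hyperfilter_nat_le_atTop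
    rw [sub_zero] at h2
    refine le_of_tendsto_of_tendsto' h2 h1 fun k => ?_
    have hk : (0 : ℝ) < (k : ℝ) + 1 := by positivity
    rw [gridRequests_append_singleton]
    refine le_trans ?_ (hpfeas k _ _ _ ?_)
    · have := Nat.lt_floor_add_one (((k + 1 : ℕ) : ℝ) * raisedThreshold σ.length r)
      push_cast at this ⊢
      rw [le_div_iff₀ hk, sub_mul, one_div, inv_mul_cancel₀ hk.ne']
      linarith
    · refine (Nat.floor_lt (by positivity [hc0.trans hc1.le])).2 ?_
      have hk' : (0 : ℝ) < ((k + 1 : ℕ) : ℝ) := by positivity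
      nlinarith
  have honline : ∀ σ : List (AllocRequest ℓ), (∀ r ∈ σ, ∃ c, IsThreshold r c) →
      onlineCost w A σ = ENNReal.ofReal (pathCost w A σ) := by
    intro σ hσ
    induction σ using List.reverseRecOn with
    | nil => simp [onlineCost, allocCost_nil, pathCost]
    | append_singleton σ r ih =>
      rw [onlineCost_append_singleton, pathCost_append_singleton,
        ih fun q hq => hσ q (List.mem_append_left _ hq), hserve σ r (hσ r (by simp)), add_zero,
        moveCost_eq, ENNReal.ofReal_add ?_ (weightedDist_nonneg hw _ _)]
      exact Finset.sum_nonneg fun _ _ => weightedDist_nonneg hw _ _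
  set D : ℝ := 8 * φ * (4 * W) + (1 + (8 * φ + 1) * W) with hD
  have hD0 : 0 ≤ D := by positivity
  refine ⟨A, hA0, D.toNNReal, fun σ hσ => ?_⟩
  -- Needed for sequences that cannot be served: there the optimum is infinite, and the bound is
  -- trivial only because the ratio is not zero.
  have h8 : ((8 * φ : ℝ≥0) : ℝ≥0∞) ≠ 0 := by
    simpa using hφ.ne'
  rw [allocOpt, ENNReal.mul_iInf_of_ne h8 ENNReal.coe_ne_top, ENNReal.iInf_add]
  refine le_iInf fun ⟨x, hx0⟩ => ?_
  by_cases hx : allocCost w σ x = ⊤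
  · simp only [hx, ENNReal.mul_top h8, top_add, le_top]
  obtain ⟨hthr, z, -, hev⟩ := eventually_gridReach hw x hσ hx
  change onlineCost w A σ ≤ _
  rw [honline σ hthr]
  have hbound : pathCost w A σ ≤ 8 * φ * (allocCost w σ x).toReal + D := by
    -- Once `k` exceeds the length of `σ`, all rounding losses together cost at most `W`. With the
    -- `3 * W` spent on the raised thresholds, this is the `4 * W` in `D`.
    obtain ⟨K, hK⟩ := exists_nat_gt (σ.length : ℝ)
    refine le_of_tendsto (hpath σ) (hyperfilter_nat_le_atTop ?_)
    filter_upwards [hev, eventually_ge_atTop K] with k ⟨v, hv, hvle⟩ hkK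
    rw [hx0] at hv
    have h1 := hpcost k _ _ _ hv
    have hk : (0 : ℝ) < ((k + 1 : ℕ) : ℝ) := by positivity
    have h2 : (σ.length : ℝ) * (W / (k + 1 : ℕ)) ≤ W := by
      rw [mul_div_assoc', div_le_iff₀ hk, mul_comm]
      refine mul_le_mul_of_nonneg_left (hK.le.trans ?_) hW0
      exact_mod_cast hkK.trans (Nat.le_succ k)
    have h3 : 0 ≤ 3 * (1 / 2 : ℝ) ^ σ.length * W := by positivity
    have h4 : v ≤ (allocCost w σ x).toReal + 4 * W := by linarith
    have h5 : (8 * φ : ℝ) * v ≤ 8 * φ * ((allocCost w σ x).toReal + 4 * W) :=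
      mul_le_mul_of_nonneg_left h4 (by positivity)
    rw [hD]
    linarith
  refine (ENNReal.ofReal_le_ofReal hbound).trans ?_
  rw [ENNReal.ofReal_add (by positivity) hD0, ENNReal.ofReal_mul (by positivity),
    ENNReal.ofReal_toReal hx]
  refine add_le_add (mul_le_mul_left (le_of_eq ?_) _) le_rfl
  rw [← ENNReal.ofReal_coe_nnreal]
  simp

end Limit

/-! ### Positivity of the competitive ratio -/

section Positive

variable {ℓ : ℕ}

/-- A cache for a single page, and two pages of the first class. -/
def twoPageInstance (hℓ : 1 ≤ ℓ) : PagingInstance ℓ where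
  n := 2
  cls _ := ⟨0, hℓ⟩
  weight i := i + 1
  weight_pos i := by positivity
  weight_injective i j h := by
    have h1 : (i : ℝ) + 1 = j + 1 := h
    exact Fin.ext (by exact_mod_cast add_right_cancel h1)
  k := 1
  k_pos := one_pos
  init := ∅
  init_card := by simp

/-- Alternating requests to the two pages. -/
def alternating (T : ℕ) : List (Fin 2) := (List.range T).map fun t => Fin.ofNat 2 t

lemma length_alternating (T : ℕ) : (alternating T).length = T := by simp [alternating]

lemma getElem_alternating {T t : ℕ} (ht : t < (alternating T).length) :
    (alternating T)[t] = Fin.ofNat 2 t := by simp [alternating]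

/-- With one slot and alternating pages, each request after the first fetches a page, and the first
class has weight 1. -/
lemma le_cost_alternating (hℓ : 1 ≤ ℓ) (D : (twoPageInstance hℓ).DetAlgorithm) (T : ℕ) :
    (T : ℝ≥0∞) ≤ D.cost (alternating (T + 1)) := by
  let I := twoPageInstance hℓ
  set σ : List I.Page := alternating (T + 1) with hσ
  have hlen : σ.length = T + 1 := length_alternating _
  have hget : ∀ t (ht : t < σ.length), σ[t] = Fin.ofNat 2 t := fun t ht =>
    getElem_alternating ht
  have hmem : ∀ t, t < σ.length →
      (Fin.ofNat 2 t : I.Page) ∈ D.cache ((I.observations σ).take (t + 1)) ∧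
      (D.cache ((I.observations σ).take (t + 1))).card ≤ 1 := by
    intro t ht
    rw [I.observations_take_succ σ t ht]
    refine ⟨?_, D.card_le _ _⟩
    have := D.serves ((I.observations σ).take t) (σ[t], I.Earlier (σ.drop (t + 1)))
    rwa [hget t ht] at this ⊢
  rw [PagingInstance.DetAlgorithm.cost, PagingInstance.cost, hlen, Finset.sum_range_succ']
  refine le_add_of_le_of_nonneg ?_ zero_le
  have h1 : (T : ℝ≥0∞) = ∑ _t ∈ Finset.range T, 1 := by simp
  rw [h1]
  refine Finset.sum_le_sum fun t ht => ?_
  have ht' := Finset.mem_range.1 ht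
  obtain ⟨h2, h3⟩ := hmem t (by omega)
  obtain ⟨h4, -⟩ := hmem (t + 1) (by omega)
  have h5 : (Fin.ofNat 2 (t + 1) : I.Page) ∉ D.cache ((I.observations σ).take (t + 1)) := by
    intro h6
    have h7 : Fin.ofNat 2 (t + 1) = Fin.ofNat 2 t := Finset.card_le_one.1 h3 _ h6 _ h2
    have h8 := congrArg Fin.val h7
    simp only [Fin.ofNat] at h8
    omega
  refine le_trans ?_ (Finset.single_le_sum (fun _ _ => zero_le)
    (Finset.mem_sdiff.2 ⟨h4, h5⟩))
  simp [twoPageInstance]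

/-- No paging algorithm has competitive ratio zero. -/
lemma pos_of_wimpCompetitive (hℓ : 1 ≤ ℓ) {φ : ℝ≥0} (h : WIMPCompetitive ℓ φ) : 0 < φ := by
  rw [pos_iff_ne_zero]
  rintro rfl
  obtain ⟨Ω, _, μ, _, A, -, a, ha⟩ := h (twoPageInstance hℓ)
  obtain ⟨T, hT⟩ := exists_nat_gt a
  have h1 := ha (alternating (T + 1))
  have h2 : ((T : ℕ) : ℝ≥0∞) ≤ a := by
    calc ((T : ℕ) : ℝ≥0∞) = ∫⁻ _ω, (T : ℝ≥0∞) ∂μ := by simp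
      _ ≤ _ := lintegral_mono fun ω => le_cost_alternating hℓ (A ω) T
      _ ≤ _ := h1
      _ = a := by simp
  have h3 : (T : ℝ≥0) ≤ a := by exact_mod_cast h2
  exact absurd hT (not_lt.2 h3)

lemma AllocCompetitive.mono {kind : AllocRequest ℓ → Prop} {c c' : ℝ≥0} (hc : c ≤ c')
    (h : AllocCompetitive ℓ kind c) : AllocCompetitive ℓ kind c' := by
  intro w hw x₀
  obtain ⟨A, h0, a, ha⟩ := h w hw x₀
  refine ⟨A, h0, a, fun σ hσ => (ha σ hσ).trans ?_⟩
  gcongr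

end Positive

end MyopicPaging

theorem theorem3 :
    ∃ C : ℝ≥0, ∀ (φ : ℕ → ℝ≥0) (ℓ : ℕ), 1 ≤ ℓ →
      (MyopicPaging.SoftAllocCompetitive ℓ (φ ℓ) →
        MyopicPaging.WIMPCompetitive ℓ (C * φ ℓ)) ∧
      (MyopicPaging.WIMPCompetitive ℓ (φ ℓ) →
        MyopicPaging.StrictAllocCompetitive ℓ (C * φ ℓ)) := by
  -- 96 is 16 from the rounding times 6 from the simulation of the optimum; the second reduction
  -- needs only 8.
  refine ⟨96, fun φ ℓ hℓ => ⟨MyopicPaging.wimpCompetitive_of_soft hℓ, fun h => ?_⟩⟩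
  refine MyopicPaging.AllocCompetitive.mono ?_ (MyopicPaging.strictAllocCompetitive_of_wimp hℓ
    (MyopicPaging.pos_of_wimpCompetitive hℓ h) h)
  gcongr
  norm_num
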